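/- **Setting.** For $x\in\mathbb R$ let $\langle x\rangle=(1+x^2)^{1/2}$, and for $R>0$ let $\sigma_R(x)=e^{-\langle x/R\rangle}$. Fix a smooth function $\rho\colon\mathbb R\to[0,1]$ with $\rho=1$ on $[-1,1]$ and $\rho=0$ outside $[-\tfrac98,\tfrac98]$. For $N>0$ let $P_{\le N}$ be the Fourier multiplier with symbol $\rho(\xi/N)$, i.e., the convolution with the kernel $x\mapsto\frac1{2\pi}\int_{\mathbb R}\rho(\xi/N)e^{i\xi x}\,\mathrm d\xi$, let $P_{>N}=1-P_{\le N}$, and let $$M_R(f)=\int_{\mathbb R}|P_{\le R}f(x)|^2\,\sigma_R(x)\,\mathrm dx .$$ For a random continuous $2\pi L$-periodic function $\phi_L\colon\Omega\times\mathbb R\to\mathbb C$, let $u_L$ be the global solution, continuous in $(t,x)$ and $2\pi L$-periodic in $x$, of $$i\partial_tu+\partial_x^2u=|u|^{p-1}u,\qquad u(0)=\phi_L ,$$ and let $w_L=u_L-u_{L/2}$. (This includes initial data distributed according to the $2\pi L$-periodic Gibbs measures; the law of $\phi_L$ plays no role below. The statement is understood for each sample for which $u_L$ and $u_{L/2}$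 exist.) For $A_0\ge1$, $\delta>0$, $L\ge10$, $T\ge1$ and $R\ge10$, the good event $\mathcal G_{L,T,R}$ is the set of samples for which both $u=u_L$ and $u=u_{L/2}$ satisfy $$\Big\|\log(T+R+\langle x\rangle)^{-\frac2{p+3}}\,u\Big\|_{L^\infty_tL^\infty_x([-T,T]\times\mathbb R)}\le A_0,\qquad \sup_{N}N^{\frac12-\delta}\Big\|\log(T+R+\langle x\rangle)^{-\frac12}P_{>N}u\Big\|_{L^\infty_tL^\infty_x([-T,T]\times\mathbb R)}\le A_0,$$ where the supremum runs over $N\in\{1,2,4,8,\dots\}$. **Lemma 5.4 (Iterated difference estimate).** There is an absolute constant $\delta_0>0$ such that the following holds. Let $\rho$ be as above, let $3\le p\le5$, $A_0\ge1$ and $0<\delta\le\delta_0$. Then there are constants $A_{3,\min}\ge1$ and $\tau_0>0$, depending only on $\rho$, $p$, $A_0$ and $\delta$, such that for all $A_3\ge A_{3,\min}$, all real $L\ge10$, $T\ge1$, $R\ge10$, and all integers $J\ge1$ with $\tau:=T/J\le\tau_0$, the following is true for every sample in $\mathcal G_{L,T,R}$. Let $R_0:=R^{2^J}$. If $$M_{R_0}(w_L(0))\le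 A_3R_0^{-\frac12},$$ then $$\sup_{t\in[0,T]}M_R(w_L(t))\le A_3^{J+2}R^{-\frac12}.$$ -/

import Mathlib

open Set MeasureTheory
open scoped ENNReal

noncomputable section

namespace GibbsNLS

/-- The Japanese bracket `⟨x⟩ = (1 + x²)^{1/2}`. -/
def bracket (x : ℝ) : ℝ := Real.sqrt (1 + x ^ 2)

/-- The cut-off functions from which the Littlewood-Paley operators are built: smooth,
`[0,1]`-valued, equal to `1` on `[-1, 1]` and equal to `0` outside `[-9/8, 9/8]`. -/
structure IsCutoff (ρ : ℝ → ℝ) : Prop where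
  smooth : ContDiff ℝ (⊤ : ℕ∞) ρ
  mem_Icc : ∀ ξ, ρ ξ ∈ Icc (0 : ℝ) 1
  eq_one : ∀ ξ ∈ Icc (-1 : ℝ) 1, ρ ξ = 1
  eq_zero : ∀ ξ, ξ ∉ Icc (-(9 / 8) : ℝ) (9 / 8) → ρ ξ = 0

/-- The convolution kernel of the Fourier multiplier with symbol `ξ ↦ ρ (ξ / N)`. -/
def kernel (ρ : ℝ → ℝ) (N x : ℝ) : ℂ :=
  ((2 * Real.pi : ℝ) : ℂ)⁻¹ *
    ∫ ξ : ℝ, ((ρ (ξ / N) : ℝ) : ℂ) * Complex.exp (Complex.I * ((ξ * x : ℝ) : ℂ))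

/-- The Littlewood-Paley operator `P_{≤ N}`, as a convolution operator. -/
def PLow (ρ : ℝ → ℝ) (N : ℝ) (f : ℝ → ℂ) (x : ℝ) : ℂ :=
  ∫ y : ℝ, kernel ρ N (x - y) * f y

/-- The Littlewood-Paley operator `P_{> N} = 1 - P_{≤ N}`. -/
def PHigh (ρ : ℝ → ℝ) (N : ℝ) (f : ℝ → ℂ) (x : ℝ) : ℂ :=
  f x - PLow ρ N f x

/-- The weight `σ_R(x) = exp (-⟨x / R⟩)`. -/
def weight (R x : ℝ) : ℝ := Real.exp (-bracket (x / R))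

/-- The frequency-truncated, localized mass `M_R(f) = ∫ |P_{≤ R} f|² σ_R dx`. -/
def mass (ρ : ℝ → ℝ) (R : ℝ) (f : ℝ → ℂ) : ℝ :=
  ∫ x : ℝ, ‖PLow ρ R f x‖ ^ 2 * weight R x

/-- The `L_t^∞ L_x^∞([-T,T] × ℝ)`-norm, with values in `[0,∞]`. It is only applied to functions
which are continuous in `(t, x)`, so that the essential supremum is the supremum. -/
def supNorm (T : ℝ) (f : ℝ → ℝ → ℂ) : ℝ≥0∞ :=
  ⨆ t ∈ Icc (-T) T, ⨆ x : ℝ, ‖f t x‖ₑ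

/-- `u` (as a function of `t` and `x`) is a global, continuous, `2πL`-periodic solution of
`i ∂_t u + ∂_x² u = |u|^{p-1} u` with `u(0) = φ`. The equation holds in the sense of distributions
in `x`, integrated in time. -/
structure IsGlobalSolution (p L : ℝ) (φ : ℝ → ℂ) (u : ℝ → ℝ → ℂ) : Prop where
  continuous : Continuous (fun z : ℝ × ℝ => u z.1 z.2)
  periodic : ∀ t x, u t (x + 2 * Real.pi * L) = u t x
  initial : ∀ x, u 0 x = φ x
  equation : ∀ ψ : ℝ → ℂ, ContDiff ℝ (⊤ : ℕ∞) ψ → HasCompactSupport ψ → ∀ t : ℝ,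
    Complex.I * ((∫ x : ℝ, u t x * ψ x) - ∫ x : ℝ, u 0 x * ψ x)
        + (∫ s in (0 : ℝ)..t, ∫ x : ℝ, u s x * deriv (deriv ψ) x)
      = ∫ s in (0 : ℝ)..t, ∫ x : ℝ, ((‖u s x‖ ^ (p - 1) : ℝ) : ℂ) * u s x * ψ x

/-- The a priori bounds which the good event requires of a single function `u`.
The frequencies `N ≥ 1` are dyadic, i.e., `N = 2^k`. -/
structure GoodBounds (ρ : ℝ → ℝ) (p A₀ δ T R : ℝ) (u : ℝ → ℝ → ℂ) : Prop where
  pointwise :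
    supNorm T (fun t x =>
      ((Real.log (T + R + bracket x) ^ (-(2 / (p + 3))) : ℝ) : ℂ) * u t x)
      ≤ ENNReal.ofReal A₀
  high_frequency :
    (⨆ k : ℕ, ENNReal.ofReal (((2 : ℝ) ^ k) ^ (1 / 2 - δ)) *
      supNorm T (fun t x =>
        ((Real.log (T + R + bracket x) ^ (-(1 / 2) : ℝ) : ℝ) : ℂ)
          * PHigh ρ ((2 : ℝ) ^ k) (u t) x))
      ≤ ENNReal.ofReal A₀

/-- The good event, for a family `u L ω t x` of random functions indexed by the period
parameter `L`. -/
def goodEvent {Ω : Type*} (ρ : ℝ → ℝ) (p A₀ δ : ℝ) (u : ℝ → Ω → ℝ → ℝ → ℂ) (L T R : ℝ) : Set Ω :=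
  {ω | GoodBounds ρ p A₀ δ T R (u L ω) ∧ GoodBounds ρ p A₀ δ T R (u (L / 2) ω)}

/-- The difference `w_L = u_L - u_{L/2}`. -/
def diff {Ω : Type*} (u : ℝ → Ω → ℝ → ℝ → ℂ) (L : ℝ) (ω : Ω) (t x : ℝ) : ℂ :=
  u L ω t x - u (L / 2) ω t x

end GibbsNLS

end

namespace GibbsNLS

open scoped FourierTransform Convolution SchwartzMap

/-! ### Littlewood-Paley kernels -/

/-! The proof is a Gronwall argument for localized masses, run along a hierarchy of scales. The
exponential weight is replaced by `polyWeight`, which tolerates convolution with kernels that decay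
only polynomially. The resulting `polyMass` dominates `mass` at the same scale up to a constant.

The core is the differential inequality `exists_deriv_polyMass_le`. For `r ≥ T, R`, the time
derivative of the mass at scale `r` is at most `K log r` times the mass at scale `2r` plus
`r^(-3/5)`. In the dispersive term one derivative falls on the weight and gains `1/r`, while the
other costs `r`. In the nonlinear term the difference of the nonlinearities is written as `a w + b
w̄`, with segment averages `a`, `b` of its derivatives. On the part of `w` below frequency `2r`, the
a priori bound makes the coefficients `O(log r)` on the relevant region. This is where `p ≤ 5` is
essential, because `2(p-1)/(p+3) ≤ 1`. On the part above `2r`, `P_{≤ r}` annihilates both the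
function and its conjugate. Only increments of `a`, `b` over distances about `1/r` remain, of size
`r^(-1/3+δ)` up to logarithms. They multiply a high-frequency part of size `r^(-1/2+δ)`. Squared and
integrated over a length `r`, the product is smaller than `r^(-3/5)`.

The inequality does not close, since it moves from `r` to `2r`. `hierarchy_bound` iterates it over
the dyadic scales from `Q` to about `Q^(3/2)`. The crude polynomial bound at the top scale is beaten
by a geometric gain at each step, and the price is an exponential of `log Q` times the elapsed time.
On a time interval of length at most `τ₀` this price is at most `Q^(1/10)`. Hence smallness `Q^(-1)`
on all these scales at the initial time yields smallness `Q^(-1/2)` at scale `Q` throughout the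
interval (`exists_polyMass_propagation`).

A bound `(Q²)^(-1/2)` at scale `Q²` is exactly `Q^(-1)`, and it passes down to all scales between
`Q` and `Q^(3/2)`. So each time step costs one square root of the scale and one factor of the
constant. After `J` steps, `R^(2^J)` has become `R` (`scale_iteration`). This requires `T ≤ R`. If
`R < T`, then `J ≥ T`, and the a priori bound alone is already below `A₃^(J+2) R^(-1/2)`
(`mul_le_pow_mul_rpow`). -/

lemma IsCutoff.reflect {ρ : ℝ → ℝ} (hρ : IsCutoff ρ) : IsCutoff (fun ξ => ρ (-ξ)) where
  smooth := hρ.smooth.comp contDiff_neg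
  mem_Icc ξ := hρ.mem_Icc _
  eq_one ξ hξ := hρ.eq_one _ ⟨by linarith [hξ.2], by linarith [hξ.1]⟩
  eq_zero ξ hξ := hρ.eq_zero _ fun h => hξ ⟨by linarith [h.2], by linarith [h.1]⟩

lemma IsCutoff.hasCompactSupport {ρ : ℝ → ℝ} (hρ : IsCutoff ρ) : HasCompactSupport ρ :=
  HasCompactSupport.intro (isCompact_Icc (a := -(9 / 8 : ℝ)) (b := 9 / 8)) fun ξ hξ =>
    hρ.eq_zero ξ hξ

lemma IsCutoff.hasCompactSupport_scaled {ρ : ℝ → ℝ} (hρ : IsCutoff ρ) {c : ℝ} (hc : c ≠ 0) :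
    HasCompactSupport (fun ξ => ρ (c * ξ)) :=
  hρ.hasCompactSupport.comp_homeomorph (Homeomorph.mulLeft₀ c hc)

/-- The substitution `ξ = 2πη` absorbs the prefactor `1/(2π)` and moves the factor `2π` into the
phase, which is the normalization of `𝓕⁻`. -/
lemma kernel_eq_fourierInv (ρ : ℝ → ℝ) {N : ℝ} (x : ℝ) :
    kernel ρ N x = 𝓕⁻ (fun η : ℝ => ((ρ ((2 * Real.pi / N) * η) : ℝ) : ℂ)) x := by
  have h := Measure.integral_comp_mul_left
    (fun ξ : ℝ => ((ρ (ξ / N) : ℝ) : ℂ) * Complex.exp (Complex.I * ((ξ * x : ℝ) : ℂ)))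
    (2 * Real.pi)
  rw [abs_of_pos (by positivity)] at h
  rw [Real.fourierInv_eq', kernel, ← Complex.ofReal_inv, ← Complex.real_smul, ← h]
  refine integral_congr_ae (.of_forall fun η => ?_)
  simp only [smul_eq_mul]
  rw [mul_comm]
  congr 2
  · simp only [RCLike.inner_apply, conj_trivial]
    push_cast
    ring
  · congr 2
    ring

/-- The convolution kernel of a Littlewood-Paley operator is a Schwartz function. -/
lemma IsCutoff.exists_schwartzMap {ρ : ℝ → ℝ} (hρ : IsCutoff ρ) {N : ℝ} (hN : 0 < N) :
    ∃ κ : 𝓢(ℝ, ℂ), (⇑κ = kernel ρ N) ∧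
      ∀ η, 𝓕 κ η = ((ρ ((2 * Real.pi / N) * η) : ℝ) : ℂ) := by
  have hc : 2 * Real.pi / N ≠ 0 := by positivity
  have h1 : HasCompactSupport (fun η : ℝ => ((ρ ((2 * Real.pi / N) * η) : ℝ) : ℂ)) :=
    (hρ.hasCompactSupport_scaled hc).comp_left (g := fun r : ℝ => (r : ℂ)) (by simp)
  have h2 : ContDiff ℝ (⊤ : ℕ∞) (fun η : ℝ => ((ρ ((2 * Real.pi / N) * η) : ℝ) : ℂ)) :=
    Complex.ofRealCLM.contDiff.comp (hρ.smooth.comp (contDiff_const.mul contDiff_id))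
  refine ⟨𝓕⁻ (h1.toSchwartzMap h2), ?_, fun η => ?_⟩
  · ext x
    rw [SchwartzMap.fourierInv_coe, kernel_eq_fourierInv]
    rfl
  · rw [FourierTransform.fourier_fourierInv_eq]
    rfl

lemma IsCutoff.contDiff_kernel {ρ : ℝ → ℝ} (hρ : IsCutoff ρ) {N : ℝ} (hN : 0 < N) :
    ContDiff ℝ (⊤ : ℕ∞) (kernel ρ N) := by
  obtain ⟨κ, hκ, -⟩ := hρ.exists_schwartzMap hN
  rw [← hκ]
  exact κ.smooth _

lemma kernel_scaling (ρ : ℝ → ℝ) {N : ℝ} (hN : 0 < N) (x : ℝ) :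
    kernel ρ N x = N * kernel ρ 1 (N * x) := by
  have h := Measure.integral_comp_mul_left
    (fun ξ : ℝ => ((ρ (ξ / N) : ℝ) : ℂ) * Complex.exp (Complex.I * ((ξ * x : ℝ) : ℂ))) N
  rw [abs_of_pos (by positivity), Complex.real_smul] at h
  have hN' : (N : ℂ) ≠ 0 := by exact_mod_cast hN.ne'
  simp only [kernel]
  rw [mul_left_comm]
  congr 1
  rw [Complex.ofReal_inv, eq_inv_mul_iff_mul_eq₀ hN'] at h
  rw [← h]
  congr 1
  refine integral_congr_ae (.of_forall fun η => ?_)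
  simp only [div_one]
  rw [mul_div_cancel_left₀ _ hN.ne']
  congr 4
  ring

/-- The cut-off need not be even, so the kernel need not be real. Conjugation reflects the symbol,
which is why the composition identities below allow two different cut-offs. -/
lemma conj_kernel (ρ : ℝ → ℝ) (N x : ℝ) :
    (starRingEnd ℂ) (kernel ρ N x) = kernel (fun ξ => ρ (-ξ)) N x := by
  simp only [kernel, map_mul, map_inv₀, Complex.conj_ofReal]
  congr 1
  rw [← integral_conj, ← integral_neg_eq_self]
  refine integral_congr_ae (.of_forall fun η => ?_)
  simp only [map_mul, Complex.conj_ofReal, ← Complex.exp_conj, Complex.conj_I, neg_div]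
  congr 2
  push_cast
  ring

/-- Uniform decay estimates for the Littlewood-Paley kernels and their derivatives. -/
lemma IsCutoff.exists_kernel_bound {ρ : ℝ → ℝ} (hρ : IsCutoff ρ) (j : ℕ) :
    ∃ C : ℝ, 1 ≤ C ∧ ∀ N : ℝ, 0 < N → ∀ z : ℝ,
      ‖iteratedDeriv j (kernel ρ N) z‖ * (1 + N * |z|) ^ 20 ≤ C * N * N ^ j := by
  obtain ⟨κ, hκ, -⟩ := hρ.exists_schwartzMap one_pos
  have hb := SchwartzMap.one_add_le_sup_seminorm_apply (𝕜 := ℝ) (m := (20, j)) le_rfl le_rfl κ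
  set C₀ := 2 ^ (20, j).1 * (Finset.Iic (20, j)).sup (fun m => SchwartzMap.seminorm ℝ m.1 m.2) κ
  refine ⟨max C₀ 1, le_max_right _ _, fun N hN z => ?_⟩
  have h1 : kernel ρ N = fun x => (N : ℂ) • κ (N * x) := by
    ext x
    rw [kernel_scaling ρ hN, hκ, smul_eq_mul]
  have hs : ContDiff ℝ j κ := κ.smooth j
  have h2 : iteratedDeriv j (kernel ρ N) z = (N : ℂ) * ((N : ℝ) ^ j • iteratedDeriv j κ (N * z)) := by
    rw [h1, iteratedDeriv_fun_const_smul, iteratedDeriv_comp_const_smul hs, smul_eq_mul]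
    exact (hs.comp (contDiff_const.mul contDiff_id)).contDiffAt
  have h3 := hb (N * z)
  rw [norm_iteratedFDeriv_eq_norm_iteratedDeriv, Real.norm_eq_abs, abs_mul, abs_of_pos hN] at h3
  rw [h2, norm_mul, norm_smul, Complex.norm_real, Real.norm_of_nonneg hN.le,
    Real.norm_of_nonneg (by positivity)]
  calc N * (N ^ j * ‖iteratedDeriv j κ (N * z)‖) * (1 + N * |z|) ^ 20
      = N * N ^ j * ((1 + N * |z|) ^ 20 * ‖iteratedDeriv j κ (N * z)‖) := by ring
    _ ≤ N * N ^ j * max C₀ 1 := by gcongr; exact h3.trans (le_max_left _ _)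
    _ = _ := by ring

/-- The kernel identity `P_{≤ N} P_{≤ N'} = P_{≤ N}` for `9/8 N ≤ N'`. -/
lemma integral_kernel_mul_kernel {ρ₁ ρ₂ : ℝ → ℝ} (h₁ : IsCutoff ρ₁) (h₂ : IsCutoff ρ₂) {N N' : ℝ}
    (hN : 0 < N) (hN' : 9 / 8 * N ≤ N') (x : ℝ) :
    ∫ y, kernel ρ₁ N y * kernel ρ₂ N' (x - y) = kernel ρ₁ N x := by
  have hN'0 : 0 < N' := by linarith
  obtain ⟨κ₁, hκ₁, hf₁⟩ := h₁.exists_schwartzMap hN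
  obtain ⟨κ₂, hκ₂, hf₂⟩ := h₂.exists_schwartzMap hN'0
  have key : SchwartzMap.convolution (ContinuousLinearMap.mul ℂ ℂ) κ₁ κ₂ = κ₁ := by
    rw [← FourierTransform.fourierInv_fourier_eq (E := 𝓢(ℝ, ℂ)) (F := 𝓢(ℝ, ℂ))
      (SchwartzMap.convolution (ContinuousLinearMap.mul ℂ ℂ) κ₁ κ₂),
      SchwartzMap.fourier_convolution]
    conv_rhs => rw [← FourierTransform.fourierInv_fourier_eq (E := 𝓢(ℝ, ℂ)) (F := 𝓢(ℝ, ℂ)) κ₁]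
    congr 1
    ext η
    rw [SchwartzMap.pairing_apply_apply]
    simp only [ContinuousLinearMap.mul_apply', hf₁, hf₂]
    -- On the support of the first symbol the frequency is at most `9/8 N ≤ N'` in absolute value,
    -- so the second symbol equals one there.
    by_cases hη : (2 * Real.pi / N) * η ∈ Icc (-(9 / 8) : ℝ) (9 / 8)
    · rw [h₂.eq_one, Complex.ofReal_one, mul_one]
      have e1 : (2 * Real.pi / N) * η = (2 * Real.pi * η) / N := by ring
      have e2 : (2 * Real.pi / N') * η = (2 * Real.pi * η) / N' := by ring
      rw [e1] at hη
      rw [e2]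
      have := (le_div_iff₀ hN).1 hη.1
      have := (div_le_iff₀ hN).1 hη.2
      constructor
      · rw [le_div_iff₀ hN'0]; linarith
      · rw [div_le_iff₀ hN'0]; linarith
    · rw [h₁.eq_zero _ hη]
      simp
  have := congrArg (fun f : 𝓢(ℝ, ℂ) => f x) key
  simp only [SchwartzMap.convolution_apply, convolution_def, ContinuousLinearMap.mul_apply'] at this
  rwa [hκ₁, hκ₂] at this

end GibbsNLS

namespace GibbsNLS

/-! ### Polynomial weights -/

/-- The polynomially decaying weight `(1 + (x/r)²)^{-8}`. -/
noncomputable def polyWeight (r x : ℝ) : ℝ := ((1 + (x / r) ^ 2) ^ 8)⁻¹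

/-- The growth function `1 + |x| / r`. -/
noncomputable def growth (r x : ℝ) : ℝ := 1 + |x| / r

lemma polyWeight_pos (r x : ℝ) : 0 < polyWeight r x := by unfold polyWeight; positivity

lemma polyWeight_le_one (r x : ℝ) : polyWeight r x ≤ 1 :=
  inv_le_one_of_one_le₀ (one_le_pow₀ (by linarith [sq_nonneg (x / r)]))

lemma continuous_polyWeight (r : ℝ) : Continuous (polyWeight r) := by
  unfold polyWeight
  exact Continuous.inv₀ (by fun_prop) fun x => by positivity

lemma one_le_growth {r : ℝ} (hr : 0 < r) (x : ℝ) : 1 ≤ growth r x :=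
  le_add_of_nonneg_right (by positivity)

lemma continuous_growth (r : ℝ) : Continuous (growth r) := by unfold growth; fun_prop

lemma growth_sq_le {r : ℝ} (hr : 0 < r) (x : ℝ) : growth r x ^ 2 ≤ 2 * (1 + (x / r) ^ 2) := by
  have h : |x| / r = |x / r| := by rw [abs_div, abs_of_pos hr]
  rw [growth, h, ← sq_abs (x / r)]
  nlinarith [sq_nonneg (1 - |x / r|)]

/-- The weight decays like the power `-16` of the growth function. Up to 14 powers can be spent
while integrable quadratic decay remains. -/
lemma growth_pow_mul_polyWeight_le {r : ℝ} (hr : 0 < r) {k : ℕ} (hk : k ≤ 14) (x : ℝ) :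
    growth r x ^ k * polyWeight r x ≤ 128 * (1 + (x / r) ^ 2)⁻¹ := by
  have h1 : growth r x ^ k ≤ growth r x ^ 14 := pow_le_pow_right₀ (one_le_growth hr x) hk
  have h2 : growth r x ^ 14 ≤ (2 * (1 + (x / r) ^ 2)) ^ 7 := by
    have := pow_le_pow_left₀ (by positivity) (growth_sq_le hr x) 7
    rwa [← pow_mul] at this
  have hp : 0 < 1 + (x / r) ^ 2 := by positivity
  calc growth r x ^ k * polyWeight r x
      ≤ (2 * (1 + (x / r) ^ 2)) ^ 7 * polyWeight r x :=
        mul_le_mul_of_nonneg_right (h1.trans h2) (polyWeight_pos r x).le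
    _ = _ := by unfold polyWeight; field_simp; norm_num

lemma integrable_inv_one_add_sq_div {r : ℝ} (hr : 0 < r) :
    Integrable (fun x : ℝ => (1 + (x / r) ^ 2)⁻¹) := by
  have := integrable_inv_one_add_sq.comp_mul_left' (R := r⁻¹) (inv_ne_zero hr.ne')
  refine this.congr (.of_forall fun x => ?_)
  simp only [div_eq_inv_mul]

lemma integral_inv_one_add_sq_div {r : ℝ} (hr : 0 < r) :
    ∫ x : ℝ, (1 + (x / r) ^ 2)⁻¹ = r * Real.pi := by
  have := Measure.integral_comp_div (fun x : ℝ => (1 + x ^ 2)⁻¹) r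
  rw [this, integral_univ_inv_one_add_sq, abs_of_pos hr, smul_eq_mul]

lemma integrable_growth_pow_mul_polyWeight {r : ℝ} (hr : 0 < r) {k : ℕ} (hk : k ≤ 14) :
    Integrable (fun x => growth r x ^ k * polyWeight r x) := by
  refine ((integrable_inv_one_add_sq_div hr).const_mul 128).mono'
    (((continuous_growth r).pow k).mul (continuous_polyWeight r)).aestronglyMeasurable
    (.of_forall fun x => ?_)
  rw [Real.norm_of_nonneg
    (mul_nonneg (pow_nonneg (zero_le_one.trans (one_le_growth hr x)) _) (polyWeight_pos r x).le)]
  exact growth_pow_mul_polyWeight_le hr hk x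

lemma integral_growth_pow_mul_polyWeight_le {r : ℝ} (hr : 0 < r) {k : ℕ} (hk : k ≤ 14) :
    ∫ x, growth r x ^ k * polyWeight r x ≤ 512 * r := by
  calc ∫ x, growth r x ^ k * polyWeight r x
      ≤ ∫ x, 128 * (1 + (x / r) ^ 2)⁻¹ := by
        refine integral_mono (integrable_growth_pow_mul_polyWeight hr hk)
          ((integrable_inv_one_add_sq_div hr).const_mul 128) fun x => ?_
        exact growth_pow_mul_polyWeight_le hr hk x
    _ = 128 * (r * Real.pi) := by rw [integral_const_mul, integral_inv_one_add_sq_div hr]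
    _ ≤ 512 * r := by nlinarith [Real.pi_lt_four]

lemma integrable_polyWeight {r : ℝ} (hr : 0 < r) : Integrable (polyWeight r) := by
  simpa using integrable_growth_pow_mul_polyWeight hr (k := 0) (by norm_num)

lemma polyWeight_mono {r r' : ℝ} (hr : 0 < r) (h : r ≤ r') (x : ℝ) :
    polyWeight r x ≤ polyWeight r' x := by
  unfold polyWeight
  have : (x / r') ^ 2 ≤ (x / r) ^ 2 := by
    rw [div_pow, div_pow]
    gcongr
  gcongr

/-- Peetre's inequality: a translation costs only a power of the distance, which a rapidly decaying
kernel pays for. This is the reason for a polynomial weight; an exponential one would demand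
exponentially decaying kernels. -/
lemma polyWeight_le_mul (r x y : ℝ) :
    polyWeight r x ≤ 256 * (1 + ((x - y) / r) ^ 2) ^ 8 * polyWeight r y := by
  have h : 1 + (y / r) ^ 2 ≤ 2 * (1 + ((x - y) / r) ^ 2) * (1 + (x / r) ^ 2) := by
    have e : (x - y) / r = x / r - y / r := by ring
    rw [e]
    nlinarith [sq_nonneg (x / r + (x / r - y / r)), sq_nonneg ((x / r) * (x / r - y / r))]
  have h8 := pow_le_pow_left₀ (by positivity) h 8
  unfold polyWeight
  rw [← div_eq_mul_inv, le_div_iff₀ (by positivity), inv_mul_le_iff₀ (by positivity)]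
  calc _ ≤ _ := h8
    _ = _ := by ring

/-- The growth function varies on the scale `r`, which is no shorter than the kernel scale `1 / N`.
-/
lemma growth_le_mul {r N : ℝ} (hr : 0 < r) (hN : 1 ≤ N * r) (x y : ℝ) :
    growth r y ≤ growth r x * (1 + N * |x - y|) := by
  have hN0 : 0 < N := by
    by_contra h
    nlinarith
  have h1 : |y| ≤ |x| + |x - y| := by
    have := abs_sub_abs_le_abs_sub y x
    rw [abs_sub_comm] at this
    linarith
  have h2 : |x - y| / r ≤ N * |x - y| := by
    rw [div_le_iff₀ hr]
    nlinarith [abs_nonneg (x - y)]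
  have h3 : |y| / r ≤ |x| / r + |x - y| / r := by rw [← add_div]; gcongr
  have h4 : 0 ≤ |x| / r := by positivity
  have h5 : 0 ≤ N * |x - y| := by positivity
  unfold growth
  nlinarith

/-! ### Convolution with rapidly decaying kernels -/

/-- Continuous kernels of size `C` which decay rapidly at scale `1 / N`. -/
structure IsMollifier (C N : ℝ) (H : ℝ → ℂ) : Prop where
  continuous : Continuous H
  bound : ∀ z, ‖H z‖ * (1 + N * |z|) ^ 20 ≤ C * N

/-- The convolution of `H` and `f`. -/
noncomputable def conv (H : ℝ → ℂ) (f : ℝ → ℂ) (x : ℝ) : ℂ := ∫ y, H (x - y) * f y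

lemma PLow_eq_conv (ρ : ℝ → ℝ) (N : ℝ) (f : ℝ → ℂ) : PLow ρ N f = conv (kernel ρ N) f := rfl

lemma conv_eq_integral_sub (H f : ℝ → ℂ) (x : ℝ) : conv H f x = ∫ z, H z * f (x - z) := by
  rw [conv, ← integral_sub_left_eq_self _ _ x]
  simp

lemma integral_mollifier {N : ℝ} (hN : 0 < N) (x : ℝ) :
    ∫ y : ℝ, N * (1 + (N * (x - y)) ^ 2)⁻¹ = Real.pi := by
  rw [integral_sub_left_eq_self (fun z => N * (1 + (N * z) ^ 2)⁻¹), integral_const_mul]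
  have := Measure.integral_comp_mul_left (fun x : ℝ => (1 + x ^ 2)⁻¹) N
  rw [this, integral_univ_inv_one_add_sq, abs_of_pos (by positivity), smul_eq_mul]
  field_simp

lemma integrable_mollifier {N : ℝ} (hN : 0 < N) (x : ℝ) :
    Integrable (fun y : ℝ => N * (1 + (N * (x - y)) ^ 2)⁻¹) :=
  ((integrable_inv_one_add_sq.comp_mul_left' hN.ne').comp_sub_left x).const_mul N

namespace IsMollifier

variable {C N : ℝ} {H : ℝ → ℂ}

lemma nonneg (h : IsMollifier C N H) (hN : 0 < N) : 0 ≤ C := by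
  have := (mul_nonneg (norm_nonneg (H 0)) (by simp)).trans (h.bound 0)
  exact nonneg_of_mul_nonneg_left this hN

/-- Two of the twenty powers of decay are kept for integrability; the other eighteen may compensate
growth of the function being convolved. -/
lemma norm_mul_le (h : IsMollifier C N H) (hN : 0 < N) {k : ℕ} (hk : k ≤ 18) (z : ℝ) :
    ‖H z‖ * (1 + N * |z|) ^ k ≤ C * (N * (1 + (N * z) ^ 2)⁻¹) := by
  have h0 : 0 ≤ N * |z| := by positivity
  have h1 : (1 + N * |z|) ^ k * (1 + (N * z) ^ 2) ≤ (1 + N * |z|) ^ 20 := by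
    have : 1 + (N * z) ^ 2 ≤ (1 + N * |z|) ^ 2 := by
      rw [mul_pow, ← sq_abs z]; nlinarith
    calc (1 + N * |z|) ^ k * (1 + (N * z) ^ 2) ≤ (1 + N * |z|) ^ 18 * (1 + N * |z|) ^ 2 := by
          gcongr
          linarith
      _ = _ := by ring
  rw [← mul_assoc, ← div_eq_mul_inv, le_div_iff₀ (by positivity), mul_assoc]
  exact (mul_le_mul_of_nonneg_left h1 (norm_nonneg _)).trans (h.bound z)

lemma integrable_mul (h : IsMollifier C N H) (hN : 0 < N) {f : ℝ → ℂ} (x : ℝ)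
    (hf : AEStronglyMeasurable f) {D : ℝ} {k : ℕ} (hk : k ≤ 18)
    (hD : ∀ y, ‖f y‖ ≤ D * (1 + N * |x - y|) ^ k) :
    Integrable (fun y => H (x - y) * f y) ∧
      ∫ y, ‖H (x - y)‖ * ‖f y‖ ≤ D * C * Real.pi := by
  have hpt : ∀ y, ‖H (x - y)‖ * ‖f y‖ ≤ D * C * (N * (1 + (N * (x - y)) ^ 2)⁻¹) := fun y => by
    have hD0 : 0 ≤ D := by
      have h1 := (norm_nonneg _).trans (hD y)
      have h2 : 0 < (1 + N * |x - y|) ^ k := by positivity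
      exact nonneg_of_mul_nonneg_left h1 h2
    calc ‖H (x - y)‖ * ‖f y‖ ≤ ‖H (x - y)‖ * (D * (1 + N * |x - y|) ^ k) := by gcongr; exact hD y
      _ = D * (‖H (x - y)‖ * (1 + N * |x - y|) ^ k) := by ring
      _ ≤ D * (C * (N * (1 + (N * (x - y)) ^ 2)⁻¹)) := by
        exact mul_le_mul_of_nonneg_left (h.norm_mul_le hN hk _) hD0
      _ = _ := by ring
  have hint : Integrable (fun y => H (x - y) * f y) := by
    refine ((integrable_mollifier hN x).const_mul (D * C)).mono'
      ((h.continuous.comp (by fun_prop)).aestronglyMeasurable.mul hf) (.of_forall fun y => ?_)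
    rw [norm_mul]
    exact hpt y
  refine ⟨hint, ?_⟩
  calc ∫ y, ‖H (x - y)‖ * ‖f y‖ ≤ ∫ y, D * C * (N * (1 + (N * (x - y)) ^ 2)⁻¹) := by
        refine integral_mono ?_ ((integrable_mollifier hN x).const_mul (D * C)) hpt
        simpa only [norm_mul] using hint.norm
    _ = _ := by rw [integral_const_mul, integral_mollifier hN]

lemma norm_conv_le (h : IsMollifier C N H) (hN : 0 < N) {f : ℝ → ℂ} (x : ℝ)
    (hf : AEStronglyMeasurable f) {D : ℝ} {k : ℕ} (hk : k ≤ 18)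
    (hD : ∀ y, ‖f y‖ ≤ D * (1 + N * |x - y|) ^ k) : ‖conv H f x‖ ≤ D * C * Real.pi := by
  refine (norm_integral_le_integral_norm _).trans ?_
  simpa only [norm_mul] using (h.integrable_mul hN x hf hk hD).2

lemma integrable_of_bounded (h : IsMollifier C N H) (hN : 0 < N) {f : ℝ → ℂ} (x : ℝ)
    (hf : AEStronglyMeasurable f) {D : ℝ} (hD : ∀ y, ‖f y‖ ≤ D) :
    Integrable (fun y => H (x - y) * f y) :=
  (h.integrable_mul hN x hf (k := 0) (by norm_num) (by simpa using hD)).1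

lemma norm_conv_le_of_bounded (h : IsMollifier C N H) (hN : 0 < N) {f : ℝ → ℂ} (x : ℝ)
    (hf : AEStronglyMeasurable f) {D : ℝ} (hD : ∀ y, ‖f y‖ ≤ D) :
    ‖conv H f x‖ ≤ D * C * Real.pi :=
  h.norm_conv_le hN x hf (k := 0) (by norm_num) (by simpa using hD)

/-- Convolution with a mollifier preserves linear growth. -/
lemma norm_conv_le_growth (h : IsMollifier C N H) (hN : 0 < N) {r : ℝ} (hr : 0 < r)
    (hNr : 1 ≤ N * r) {f : ℝ → ℂ} (hf : AEStronglyMeasurable f) {D : ℝ} (hD0 : 0 ≤ D)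
    (hD : ∀ y, ‖f y‖ ≤ D * growth r y) (x : ℝ) :
    ‖conv H f x‖ ≤ 4 * C * D * growth r x := by
  have hC := h.nonneg hN
  have hg := one_le_growth hr x
  refine (h.norm_conv_le hN x hf (k := 1) (by norm_num) (D := D * growth r x)
    fun y => (hD y).trans ?_).trans ?_
  · rw [pow_one, mul_assoc]
    gcongr
    exact growth_le_mul hr hNr x y
  · have : 0 ≤ D * growth r x * C := by positivity
    nlinarith [Real.pi_lt_four]

lemma integrable (h : IsMollifier C N H) (hN : 0 < N) : Integrable H := by
  have := (h.integrable_of_bounded hN 0 (f := fun _ => 1) aestronglyMeasurable_const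
    (D := 1) (by simp)).comp_neg
  simpa using this

lemma continuous_conv (h : IsMollifier C N H) (hN : 0 < N) {f : ℝ → ℂ} (hf : Continuous f)
    {D : ℝ} (hD : ∀ y, ‖f y‖ ≤ D) : Continuous (conv H f) := by
  have : conv H f = fun x => ∫ z, H z * f (x - z) := funext fun x => conv_eq_integral_sub H f x
  rw [this]
  refine continuous_of_dominated (bound := fun z => D * ‖H z‖)
    (fun x => (h.continuous.mul (hf.comp (by fun_prop))).aestronglyMeasurable)
    (fun x => .of_forall fun z => ?_) ((h.integrable hN).norm.const_mul D)
    (.of_forall fun z => continuous_const.mul (hf.comp (by fun_prop)))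
  rw [norm_mul, mul_comm]
  gcongr
  exact hD _

lemma hasDerivAt_conv {C' : ℝ} {H' : ℝ → ℂ} (h : IsMollifier C N H) (h' : IsMollifier C' N H')
    (hN : 0 < N) (hd : ∀ z, HasDerivAt H (H' z) z) {f : ℝ → ℂ} (hf : Continuous f)
    {D : ℝ} (hD : ∀ y, ‖f y‖ ≤ D) (x : ℝ) : HasDerivAt (conv H f) (conv H' f x) x := by
  have hC' := h'.nonneg hN
  have hD0 : 0 ≤ D := (norm_nonneg _).trans (hD 0)
  have hm : ∀ x', AEStronglyMeasurable (fun y => H (x' - y) * f y) := fun x' =>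
    ((h.continuous.comp (by fun_prop)).mul hf).aestronglyMeasurable
  refine (hasDerivAt_integral_of_dominated_loc_of_deriv_le
    (bound := fun y => D * C' * (1 + N) ^ 2 * (N * (1 + (N * (x - y)) ^ 2)⁻¹))
    (F := fun x' y => H (x' - y) * f y) (F' := fun x' y => H' (x' - y) * f y)
    (Metric.ball_mem_nhds x one_pos) (.of_forall hm)
    (h.integrable_of_bounded hN x hf.aestronglyMeasurable hD)
    ((h'.continuous.comp (by fun_prop)).mul hf).aestronglyMeasurable
    (.of_forall fun y x' hx' => ?_) ((integrable_mollifier hN x).const_mul _)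
    (.of_forall fun y x' _ => ?_)).2
  · rw [Metric.mem_ball, Real.dist_eq] at hx'
    have h1 := h'.norm_mul_le hN (k := 0) (by norm_num) (x' - y)
    rw [pow_zero, mul_one] at h1
    -- A shift of the base point by at most one changes the profile by a bounded factor, so one
    -- integrable majorant serves the whole ball.
    have h2 : (1 + (N * (x' - y)) ^ 2)⁻¹ ≤ (1 + N) ^ 2 * (1 + (N * (x - y)) ^ 2)⁻¹ := by
      rw [← div_eq_mul_inv, le_div_iff₀ (by positivity), inv_mul_le_iff₀ (by positivity)]
      have e : |N * (x - y)| ≤ |N * (x' - y)| + N := by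
        have e1 : N * (x - y) = N * (x' - y) - N * (x' - x) := by ring
        have e2 : |N * (x' - x)| ≤ N := by
          rw [abs_mul, abs_of_pos hN]
          nlinarith [abs_nonneg (x' - x)]
        rw [e1]
        exact (abs_sub _ _).trans (by linarith)
      have e3 := pow_le_pow_left₀ (abs_nonneg _) e 2
      rw [← sq_abs (N * (x - y)), ← sq_abs (N * (x' - y))]
      nlinarith [sq_nonneg (1 - |N * (x' - y)|), abs_nonneg (N * (x' - y)), sq_nonneg N]
    rw [norm_mul]
    calc ‖H' (x' - y)‖ * ‖f y‖ ≤ C' * (N * (1 + (N * (x' - y)) ^ 2)⁻¹) * D := by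
          gcongr
          exact hD y
      _ ≤ C' * (N * ((1 + N) ^ 2 * (1 + (N * (x - y)) ^ 2)⁻¹)) * D := by gcongr
      _ = _ := by ring
  · exact ((hd (x' - y)).comp_sub_const x' y).mul_const (f y)

end IsMollifier

end GibbsNLS

/-! ### Weighted `L²` bounds for convolutions and the composition of Littlewood-Paley operators. -/

namespace GibbsNLS

/-- Cauchy-Schwarz for the measure with density `h`, obtained by integrating `h (g - A/I)² ≥ 0`,
where `A` is the integral of `h g`. -/
lemma sq_integral_mul_le {α : Type*} [MeasurableSpace α] {μ : Measure α} {h g : α → ℝ} {I : ℝ}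
    (hI : 0 < I) (h0 : ∀ x, 0 ≤ h x) (i0 : Integrable h μ) (i1 : Integrable (fun x => h x * g x) μ)
    (i2 : Integrable (fun x => h x * g x ^ 2) μ) (hle : ∫ x, h x ∂μ ≤ I) :
    (∫ x, h x * g x ∂μ) ^ 2 ≤ I * ∫ x, h x * g x ^ 2 ∂μ := by
  set A := ∫ x, h x * g x ∂μ
  set B := ∫ x, h x * g x ^ 2 ∂μ
  have key : 0 ≤ ∫ x, (h x * g x ^ 2 - 2 * (A / I) * (h x * g x) + (A / I) ^ 2 * h x) ∂μ := by
    refine integral_nonneg fun x => ?_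
    have := mul_nonneg (h0 x) (sq_nonneg (g x - A / I))
    simp only [Pi.zero_apply]
    linarith
  rw [integral_add (f := fun x => h x * g x ^ 2 - 2 * (A / I) * (h x * g x))
    (i2.sub (i1.const_mul _)) (i0.const_mul _), integral_sub i2 (i1.const_mul _),
    integral_const_mul, integral_const_mul] at key
  have h3 : (A / I) ^ 2 * ∫ x, h x ∂μ ≤ (A / I) ^ 2 * I := by gcongr
  have h4 : 2 * (A / I) * A - (A / I) ^ 2 * I = A ^ 2 / I := by field_simp; ring
  have h5 : A ^ 2 / I ≤ B := by change 0 ≤ B - 2 * (A / I) * A + _ at key; linarith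
  rwa [div_le_iff₀ hI, mul_comm] at h5

/-- The weighted `L²`-bound for the convolution with a rapidly decaying kernel. -/
lemma IsMollifier.integral_norm_sq_conv_le {C N : ℝ} {H : ℝ → ℂ} (h : IsMollifier C N H)
    (hC : 0 < C) (hN : 0 < N) {r : ℝ} (hr : 0 < r) (hNr : 1 ≤ N * r) {f : ℝ → ℂ}
    (hf : Continuous f) {D : ℝ} (hD : ∀ y, ‖f y‖ ≤ D) :
    ∫ x, ‖conv H f x‖ ^ 2 * polyWeight r x ≤ 4096 * C ^ 2 * ∫ x, ‖f x‖ ^ 2 * polyWeight r x := by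
  have hD0 : 0 ≤ D := (norm_nonneg _).trans (hD 0)
  have hbH : ∀ x, Integrable (fun y => ‖H (x - y)‖) := fun x => by
    simpa using (h.integrable_of_bounded hN x (f := fun _ => 1) aestronglyMeasurable_const
      (D := 1) (by simp)).norm
  have hIH : ∀ x, ∫ y, ‖H (x - y)‖ ≤ C * Real.pi := fun x => by
    simpa using (h.integrable_mul hN x (f := fun _ => 1) aestronglyMeasurable_const (k := 0)
      (D := 1) (by norm_num) (by simp)).2
  have i1 : ∀ x, Integrable (fun y => ‖H (x - y)‖ * ‖f y‖) := fun x => by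
    simpa only [norm_mul] using (h.integrable_of_bounded hN x hf.aestronglyMeasurable hD).norm
  have i2 : ∀ x, Integrable (fun y => ‖H (x - y)‖ * ‖f y‖ ^ 2) := fun x =>
    (hbH x).mul_bdd (c := D ^ 2) (by fun_prop) (.of_forall fun y => by
      rw [norm_pow, norm_norm]
      gcongr
      exact hD y)
  have h1 : ∀ x, ‖conv H f x‖ ^ 2 ≤ C * Real.pi * ∫ y, ‖H (x - y)‖ * ‖f y‖ ^ 2 := fun x => by
    have hx : ‖conv H f x‖ ≤ ∫ y, ‖H (x - y)‖ * ‖f y‖ := by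
      have := norm_integral_le_integral_norm (μ := volume) (fun y => H (x - y) * f y)
      simp only [norm_mul] at this
      exact this
    refine (pow_le_pow_left₀ (norm_nonneg _) hx 2).trans ?_
    exact sq_integral_mul_le (by positivity) (fun _ => norm_nonneg _) (hbH x) (i1 x) (i2 x) (hIH x)
  have iprod : Integrable (fun p : ℝ × ℝ => polyWeight r p.1 * (‖H (p.1 - p.2)‖ * ‖f p.2‖ ^ 2))
      (volume.prod volume) := by
    have e0 : Integrable (fun p : ℝ × ℝ => polyWeight r p.2 * ‖H (p.2 - p.1)‖)
        (volume.prod volume) := by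
      have := (integrable_polyWeight hr).convolution_integrand (ContinuousLinearMap.mul ℝ ℝ)
        ((h.integrable hN).norm.comp_neg)
      simpa using this
    have e1 := e0.swap
    have e2 := e1.mul_bdd (g := fun p : ℝ × ℝ => ‖f p.2‖ ^ 2) (c := D ^ 2)
      (Continuous.aestronglyMeasurable (by fun_prop)) (.of_forall fun p => by
        rw [norm_pow, norm_norm]
        gcongr
        exact hD p.2)
    refine e2.congr (.of_forall fun p => ?_)
    simp only [Function.comp_apply, Prod.fst_swap, Prod.snd_swap]
    ring
  have ifw : Integrable (fun y => ‖f y‖ ^ 2 * polyWeight r y) :=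
    (integrable_polyWeight hr).bdd_mul (c := D ^ 2) (by fun_prop) (.of_forall fun y => by
      rw [norm_pow, norm_norm]
      gcongr
      exact hD y)
  -- The second half of Schur's test: moving the weight from `x` to `y` costs sixteen powers of the
  -- distance, and the kernel has eighteen to spare.
  have h2 : ∀ y, ∫ x, polyWeight r x * (‖H (x - y)‖ * ‖f y‖ ^ 2) ≤
      256 * C * Real.pi * (‖f y‖ ^ 2 * polyWeight r y) := fun y => by
    have hm : Integrable (fun x => N * (1 + (N * (x - y)) ^ 2)⁻¹) := by
      refine (integrable_mollifier hN y).congr (.of_forall fun x => ?_)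
      simp only
      rw [← neg_sub x y, mul_neg, neg_sq]
    have hmI : ∫ x, N * (1 + (N * (x - y)) ^ 2)⁻¹ = Real.pi := by
      rw [← integral_mollifier hN y]
      refine integral_congr_ae (.of_forall fun x => ?_)
      simp only
      rw [← neg_sub x y, mul_neg, neg_sq]
    have hpt : ∀ x, polyWeight r x * (‖H (x - y)‖ * ‖f y‖ ^ 2) ≤
        256 * C * (‖f y‖ ^ 2 * polyWeight r y) * (N * (1 + (N * (x - y)) ^ 2)⁻¹) := fun x => by
      have a1 := polyWeight_le_mul r x y
      have a2 : (1 + ((x - y) / r) ^ 2) ^ 8 ≤ (1 + N * |x - y|) ^ 16 := by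
        have : 1 + ((x - y) / r) ^ 2 ≤ (1 + N * |x - y|) ^ 2 := by
          have b1 : |x - y| / r ≤ N * |x - y| := by
            rw [div_le_iff₀ hr]
            nlinarith [abs_nonneg (x - y)]
          have b2 : ((x - y) / r) ^ 2 = (|x - y| / r) ^ 2 := by rw [div_pow, div_pow, sq_abs]
          have b3 : 0 ≤ |x - y| / r := by positivity
          rw [b2]
          nlinarith
        calc _ ≤ ((1 + N * |x - y|) ^ 2) ^ 8 := by gcongr
          _ = _ := by ring
      have a3 := h.norm_mul_le hN (k := 16) (by norm_num) (x - y)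
      have hw := (polyWeight_pos r y).le
      calc polyWeight r x * (‖H (x - y)‖ * ‖f y‖ ^ 2)
          ≤ 256 * (1 + N * |x - y|) ^ 16 * polyWeight r y * (‖H (x - y)‖ * ‖f y‖ ^ 2) := by
            gcongr
            exact a1.trans (by gcongr)
        _ = 256 * (‖f y‖ ^ 2 * polyWeight r y) * (‖H (x - y)‖ * (1 + N * |x - y|) ^ 16) := by ring
        _ ≤ 256 * (‖f y‖ ^ 2 * polyWeight r y) * (C * (N * (1 + (N * (x - y)) ^ 2)⁻¹)) := by
            gcongr
        _ = _ := by ring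
    calc ∫ x, polyWeight r x * (‖H (x - y)‖ * ‖f y‖ ^ 2)
        ≤ ∫ x, 256 * C * (‖f y‖ ^ 2 * polyWeight r y) * (N * (1 + (N * (x - y)) ^ 2)⁻¹) :=
          integral_mono_of_nonneg (.of_forall fun x => by
            have := (polyWeight_pos r x).le
            positivity) (hm.const_mul _) (.of_forall hpt)
      _ = _ := by rw [integral_const_mul, hmI]; ring
  calc ∫ x, ‖conv H f x‖ ^ 2 * polyWeight r x
      ≤ ∫ x, C * Real.pi * ∫ y, polyWeight r x * (‖H (x - y)‖ * ‖f y‖ ^ 2) := by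
        refine integral_mono_of_nonneg (.of_forall fun x => ?_)
          (iprod.integral_prod_left.const_mul _) (.of_forall fun x => ?_)
        · have := (polyWeight_pos r x).le
          positivity
        · simp only [integral_const_mul]
          have := mul_le_mul_of_nonneg_right (h1 x) (polyWeight_pos r x).le
          linarith
    _ = C * Real.pi * ∫ y, ∫ x, polyWeight r x * (‖H (x - y)‖ * ‖f y‖ ^ 2) := by
        rw [integral_const_mul, integral_integral_swap iprod]
    _ ≤ C * Real.pi * ∫ y, 256 * C * Real.pi * (‖f y‖ ^ 2 * polyWeight r y) := by
        refine mul_le_mul_of_nonneg_left (integral_mono_of_nonneg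
          (.of_forall fun y => integral_nonneg fun x => ?_) (ifw.const_mul _) (.of_forall h2))
          (by positivity)
        have := (polyWeight_pos r x).le
        positivity
    _ = Real.pi ^ 2 * (256 * C ^ 2 * ∫ y, ‖f y‖ ^ 2 * polyWeight r y) := by
        rw [integral_const_mul]; ring
    _ ≤ 16 * (256 * C ^ 2 * ∫ y, ‖f y‖ ^ 2 * polyWeight r y) := by
        have : 0 ≤ ∫ y, ‖f y‖ ^ 2 * polyWeight r y :=
          integral_nonneg fun y => mul_nonneg (by positivity) (polyWeight_pos r y).le
        gcongr
        nlinarith [Real.pi_lt_four, Real.pi_pos]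
    _ = _ := by ring

/-- The Littlewood-Paley kernels and their first two derivatives are mollifiers. -/
lemma IsCutoff.exists_isMollifier {ρ : ℝ → ℝ} (hρ : IsCutoff ρ) :
    ∃ C : ℝ, 1 ≤ C ∧ ∀ N : ℝ, 0 < N → IsMollifier C N (kernel ρ N) ∧
      IsMollifier (C * N) N (deriv (kernel ρ N)) ∧
      IsMollifier (C * N ^ 2) N (deriv (deriv (kernel ρ N))) := by
  obtain ⟨C₀, h0, hC₀⟩ := hρ.exists_kernel_bound 0
  obtain ⟨C₁, h1, hC₁⟩ := hρ.exists_kernel_bound 1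
  obtain ⟨C₂, h2, hC₂⟩ := hρ.exists_kernel_bound 2
  have hsm : ∀ N : ℝ, 0 < N → ∀ j : ℕ, Continuous (iteratedDeriv j (kernel ρ N)) := fun N hN j =>
    (hρ.contDiff_kernel hN).continuous_iteratedDeriv j (by exact_mod_cast le_top)
  refine ⟨C₀ + C₁ + C₂, by linarith, fun N hN => ⟨⟨?_, fun z => ?_⟩, ⟨?_, fun z => ?_⟩,
    ⟨?_, fun z => ?_⟩⟩⟩
  · simpa using hsm N hN 0
  · have := hC₀ N hN z
    rw [iteratedDeriv_zero, pow_zero, mul_one] at this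
    refine this.trans ?_
    gcongr
    linarith
  · simpa [iteratedDeriv_one] using hsm N hN 1
  · have := hC₁ N hN z
    rw [iteratedDeriv_one, pow_one] at this
    refine this.trans ?_
    have : C₁ * N * N ≤ (C₀ + C₁ + C₂) * N * N := by gcongr; linarith
    linarith
  · simpa [iteratedDeriv_succ, iteratedDeriv_zero] using hsm N hN 2
  · have := hC₂ N hN z
    rw [iteratedDeriv_succ, iteratedDeriv_one] at this
    refine this.trans ?_
    have : C₂ * N * N ^ 2 ≤ (C₀ + C₁ + C₂) * N * N ^ 2 := by gcongr; linarith
    linarith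

lemma IsCutoff.hasDerivAt_kernel {ρ : ℝ → ℝ} (hρ : IsCutoff ρ) {N : ℝ} (hN : 0 < N) (z : ℝ) :
    HasDerivAt (kernel ρ N) (deriv (kernel ρ N) z) z :=
  ((hρ.contDiff_kernel hN).differentiable (by simp) z).hasDerivAt

lemma IsCutoff.hasDerivAt_deriv_kernel {ρ : ℝ → ℝ} (hρ : IsCutoff ρ) {N : ℝ} (hN : 0 < N) (z : ℝ) :
    HasDerivAt (deriv (kernel ρ N)) (deriv (deriv (kernel ρ N)) z) z := by
  exact ((contDiff_infty_iff_deriv.1 (hρ.contDiff_kernel hN)).2.differentiable (by simp) z).hasDerivAt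

/-- Associativity of the convolution. -/
lemma conv_conv {C₁ N₁ C₂ N₂ : ℝ} {H₁ H₂ H₃ : ℝ → ℂ} (h₁ : IsMollifier C₁ N₁ H₁) (hN₁ : 0 < N₁)
    (h₂ : IsMollifier C₂ N₂ H₂) (hN₂ : 0 < N₂) (h : ∀ x, ∫ y, H₁ y * H₂ (x - y) = H₃ x)
    {f : ℝ → ℂ} (hf : Continuous f) {D : ℝ} (hD : ∀ y, ‖f y‖ ≤ D) :
    conv H₁ (conv H₂ f) = conv H₃ f := by
  have i₁ := h₁.integrable hN₁
  have i₂ := h₂.integrable hN₂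
  ext x
  have iprod : Integrable (fun p : ℝ × ℝ => H₁ (x - p.1) * (H₂ (p.1 - p.2) * f p.2))
      (volume.prod volume) := by
    have e0 : Integrable (fun p : ℝ × ℝ => H₁ (x - p.2) * H₂ (p.2 - p.1))
        (volume.prod volume) := by
      have := (i₁.comp_sub_left x).convolution_integrand (ContinuousLinearMap.mul ℝ ℂ)
        i₂.comp_neg
      simpa using this
    have e2 := e0.swap.mul_bdd (g := fun p : ℝ × ℝ => f p.2) (c := D)
      (Continuous.aestronglyMeasurable (by fun_prop)) (.of_forall fun p => hD p.2)
    refine e2.congr (.of_forall fun p => ?_)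
    simp only [Function.comp_apply, Prod.fst_swap, Prod.snd_swap]
    ring
  calc conv H₁ (conv H₂ f) x
      = ∫ y, ∫ z, H₁ (x - y) * (H₂ (y - z) * f z) := by
        simp only [conv, integral_const_mul]
    _ = ∫ z, ∫ y, H₁ (x - y) * (H₂ (y - z) * f z) := integral_integral_swap iprod
    _ = ∫ z, H₃ (x - z) * f z := by
        refine integral_congr_ae (.of_forall fun z => ?_)
        simp only [← mul_assoc, integral_mul_const]
        congr 1
        rw [← h (x - z), ← integral_sub_left_eq_self _ _ x]
        refine integral_congr_ae (.of_forall fun t => ?_)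
        simp only
        congr 2 <;> ring

/-- `P_{≤ N} P_{≤ N'} = P_{≤ N}` if `9/8 N ≤ N'`, on bounded continuous functions. -/
lemma PLow_PLow {ρ₁ ρ₂ : ℝ → ℝ} (h₁ : IsCutoff ρ₁) (h₂ : IsCutoff ρ₂) {N N' : ℝ}
    (hN : 0 < N) (hN' : 9 / 8 * N ≤ N') {f : ℝ → ℂ} (hf : Continuous f) {D : ℝ}
    (hD : ∀ y, ‖f y‖ ≤ D) : PLow ρ₁ N (PLow ρ₂ N' f) = PLow ρ₁ N f := by
  obtain ⟨C₁, -, hC₁⟩ := h₁.exists_isMollifier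
  obtain ⟨C₂, -, hC₂⟩ := h₂.exists_isMollifier
  exact conv_conv (hC₁ N hN).1 hN (hC₂ N' (by linarith)).1 (by linarith)
    (integral_kernel_mul_kernel h₁ h₂ hN hN') hf hD

/-- `P_{≤ N'} P_{≤ N} = P_{≤ N}` if `9/8 N ≤ N'`, on bounded continuous functions. -/
lemma PLow_PLow' {ρ₁ ρ₂ : ℝ → ℝ} (h₁ : IsCutoff ρ₁) (h₂ : IsCutoff ρ₂) {N N' : ℝ}
    (hN : 0 < N) (hN' : 9 / 8 * N ≤ N') {f : ℝ → ℂ} (hf : Continuous f) {D : ℝ}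
    (hD : ∀ y, ‖f y‖ ≤ D) : PLow ρ₂ N' (PLow ρ₁ N f) = PLow ρ₁ N f := by
  obtain ⟨C₁, -, hC₁⟩ := h₁.exists_isMollifier
  obtain ⟨C₂, -, hC₂⟩ := h₂.exists_isMollifier
  refine conv_conv (hC₂ N' (by linarith)).1 (by linarith) (hC₁ N hN).1 hN (fun x => ?_) hf hD
  rw [← integral_kernel_mul_kernel h₁ h₂ hN hN' x, ← integral_sub_left_eq_self _ _ x]
  simp only [sub_sub_cancel, mul_comm]

end GibbsNLS

namespace GibbsNLS

/-! ### The power nonlinearity -/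

/-- The nonlinearity `|z|^{p-1} z`. -/
noncomputable def nonlin (p : ℝ) (z : ℂ) : ℂ := ((‖z‖ ^ (p - 1) : ℝ) : ℂ) * z

/-- The derivative `∂_z (|z|^{p-1} z)`. -/
noncomputable def nonlinD (p : ℝ) (z : ℂ) : ℂ := (((p + 1) / 2 * ‖z‖ ^ (p - 1) : ℝ) : ℂ)

/-- The derivative `∂_{z̄} (|z|^{p-1} z)`. -/
noncomputable def nonlinDbar (p : ℝ) (z : ℂ) : ℂ := (((p - 1) / 2 * ‖z‖ ^ (p - 3) : ℝ) : ℂ) * z ^ 2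

/-- The average of `g` over the segment from `v` to `u`. -/
noncomputable def segAvg (g : ℂ → ℂ) (u v : ℂ) : ℂ := ∫ θ in (0 : ℝ)..1, g (v + θ * (u - v))

lemma norm_segment_le {X : ℝ} {u v : ℂ} (hu : ‖u‖ ≤ X) (hv : ‖v‖ ≤ X) {θ : ℝ} (h0 : 0 ≤ θ)
    (h1 : θ ≤ 1) : ‖v + θ * (u - v)‖ ≤ X := by
  have e : v + θ * (u - v) = ((1 - θ : ℝ) : ℂ) * v + (θ : ℂ) * u := by push_cast; ring
  rw [e]
  refine (norm_add_le _ _).trans ?_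
  rw [norm_mul, norm_mul, Complex.norm_real, Complex.norm_real, Real.norm_of_nonneg h0,
    Real.norm_of_nonneg (by linarith)]
  nlinarith

lemma continuous_nonlinD {p : ℝ} (hp : 3 ≤ p) : Continuous (nonlinD p) := by
  unfold nonlinD
  exact Complex.continuous_ofReal.comp
    (continuous_const.mul (continuous_norm.rpow_const fun _ => Or.inr (by linarith)))

lemma continuous_nonlinDbar {p : ℝ} (hp : 3 ≤ p) : Continuous (nonlinDbar p) := by
  unfold nonlinDbar
  exact (Complex.continuous_ofReal.comp (continuous_const.mul
    (continuous_norm.rpow_const fun _ => Or.inr (by linarith)))).mul (continuous_pow 2)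

lemma continuous_nonlin {p : ℝ} (hp : 3 ≤ p) : Continuous (nonlin p) := by
  unfold nonlin
  exact (Complex.continuous_ofReal.comp
    (continuous_norm.rpow_const fun _ => Or.inr (by linarith))).mul continuous_id

/-- Writing the modulus power as `(|z|²)^((p-1)/2)` avoids the singularity of the norm at zero:
`|z|²` is smooth, and the exponent is at least one because `p ≥ 3`. -/
lemma hasDerivAt_nonlin_comp {p : ℝ} (hp : 3 ≤ p) {z : ℝ → ℂ} {w : ℂ} {θ : ℝ}
    (hz : HasDerivAt z w θ) :
    HasDerivAt (fun θ => nonlin p (z θ))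
      (nonlinD p (z θ) * w + nonlinDbar p (z θ) * (starRingEnd ℂ) w) θ := by
  have e : ∀ (c : ℝ) (ζ : ℂ), ‖ζ‖ ^ (2 * c) = (‖ζ‖ ^ 2) ^ c := fun c ζ => by
    rw [Real.rpow_mul (norm_nonneg _)]
    norm_num
  have h1 : HasDerivAt (fun θ => (‖z θ‖ ^ 2) ^ ((p - 1) / 2))
      (2 * inner ℝ (z θ) w * ((p - 1) / 2) * (‖z θ‖ ^ 2) ^ ((p - 1) / 2 - 1)) θ :=
    hz.norm_sq.rpow_const (Or.inr (by linarith))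
  have h2 := h1.ofReal_comp.mul hz
  have e1 : ∀ ζ : ℂ, (‖ζ‖ ^ 2) ^ ((p - 1) / 2) = ‖ζ‖ ^ (p - 1) := fun ζ => by
    rw [← e]; congr 1; ring
  have e2 : (‖z θ‖ ^ 2) ^ ((p - 1) / 2 - 1) = ‖z θ‖ ^ (p - 3) := by
    rw [← e]; congr 1; ring
  rw [e2] at h2
  simp only [e1] at h2
  refine h2.congr_deriv ?_
  have e3 : ‖z θ‖ ^ (p - 1) = ‖z θ‖ ^ (p - 3) * ‖z θ‖ ^ 2 := by
    have := Real.rpow_add_natCast' (n := 2) (norm_nonneg (z θ)) (y := p - 3)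
      (by push_cast; linarith)
    rw [← this]
    congr 1
    push_cast
    ring
  have e4 : ((2 * inner ℝ (z θ) w : ℝ) : ℂ)
      = (starRingEnd ℂ) (z θ) * w + z θ * (starRingEnd ℂ) w := by
    have e5 := Complex.add_conj ((starRingEnd ℂ) (z θ) * w)
    rw [Complex.inner, mul_comm w]
    push_cast
    push_cast at e5
    rw [← e5]
    simp
  have e6 : ((‖z θ‖ ^ 2 : ℝ) : ℂ) = (starRingEnd ℂ) (z θ) * z θ := by
    rw [mul_comm, Complex.mul_conj, Complex.normSq_eq_norm_sq]
  simp only [nonlinD, nonlinDbar]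
  rw [e3, Complex.ofReal_mul, Complex.ofReal_mul, e4]
  push_cast
  push_cast at e6
  rw [e6]
  ring

/-- The difference of the nonlinearity as a linear expression in the difference. -/
lemma nonlin_sub {p : ℝ} (hp : 3 ≤ p) (u v : ℂ) :
    nonlin p u - nonlin p v = segAvg (nonlinD p) u v * (u - v)
      + segAvg (nonlinDbar p) u v * (starRingEnd ℂ) (u - v) := by
  have hc1 : Continuous fun θ : ℝ => nonlinD p (v + θ * (u - v)) :=
    (continuous_nonlinD hp).comp (by fun_prop)
  have hc2 : Continuous fun θ : ℝ => nonlinDbar p (v + θ * (u - v)) :=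
    (continuous_nonlinDbar hp).comp (by fun_prop)
  have h := intervalIntegral.integral_eq_sub_of_hasDerivAt (a := (0 : ℝ)) (b := 1)
    (f := fun θ : ℝ => nonlin p (v + θ * (u - v)))
    (f' := fun θ : ℝ => nonlinD p (v + θ * (u - v)) * (u - v)
      + nonlinDbar p (v + θ * (u - v)) * (starRingEnd ℂ) (u - v))
    (fun θ _ => hasDerivAt_nonlin_comp hp (z := fun θ : ℝ => v + θ * (u - v)) (by
      simpa using ((Complex.ofRealCLM.hasDerivAt (x := θ)).mul_const (u - v)).const_add v))
    (Continuous.intervalIntegrable (by fun_prop) _ _)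
  rw [intervalIntegral.integral_add (Continuous.intervalIntegrable (by fun_prop) _ _)
    (Continuous.intervalIntegrable (by fun_prop) _ _), intervalIntegral.integral_mul_const,
    intervalIntegral.integral_mul_const] at h
  simp only [Complex.ofReal_one, one_mul, Complex.ofReal_zero, zero_mul, add_zero,
    add_sub_cancel] at h
  exact h.symm

lemma continuous_segAvg {g : ℂ → ℂ} (hg : Continuous g) {u v : ℝ → ℂ} (hu : Continuous u)
    (hv : Continuous v) : Continuous fun x => segAvg g (u x) (v x) := by
  unfold segAvg
  exact intervalIntegral.continuous_parametric_intervalIntegral_of_continuous'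
    (f := fun x θ => g (v x + θ * (u x - v x)))
    (hg.comp (f := fun q : ℝ × ℝ => v q.1 + q.2 * (u q.1 - v q.1)) (by fun_prop)) _ _

lemma norm_segAvg_le {g : ℂ → ℂ} {X B : ℝ} (hg : ∀ z, ‖z‖ ≤ X → ‖g z‖ ≤ B) {u v : ℂ}
    (hu : ‖u‖ ≤ X) (hv : ‖v‖ ≤ X) : ‖segAvg g u v‖ ≤ B := by
  have := intervalIntegral.norm_integral_le_of_norm_le_const (a := (0 : ℝ)) (b := 1) (C := B)
    (f := fun θ : ℝ => g (v + θ * (u - v))) fun θ hθ => by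
      rw [uIoc_of_le zero_le_one] at hθ
      exact hg _ (norm_segment_le hu hv hθ.1.le hθ.2)
  simpa [segAvg] using this

lemma norm_segAvg_sub_le {g : ℂ → ℂ} (hc : Continuous g) {X B : ℝ} (hB : 0 ≤ B)
    (hg : ∀ z z', ‖z‖ ≤ X → ‖z'‖ ≤ X → ‖g z - g z'‖ ≤ B * ‖z - z'‖) {u v u' v' : ℂ}
    (hu : ‖u‖ ≤ X) (hv : ‖v‖ ≤ X) (hu' : ‖u'‖ ≤ X) (hv' : ‖v'‖ ≤ X) :
    ‖segAvg g u v - segAvg g u' v'‖ ≤ B * (‖u - u'‖ + ‖v - v'‖) := by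
  rw [segAvg, segAvg, ← intervalIntegral.integral_sub
    (Continuous.intervalIntegrable (by fun_prop) _ _)
    (Continuous.intervalIntegrable (by fun_prop) _ _)]
  have := intervalIntegral.norm_integral_le_of_norm_le_const (a := (0 : ℝ)) (b := 1)
    (C := B * (‖u - u'‖ + ‖v - v'‖))
    (f := fun θ : ℝ => g (v + θ * (u - v)) - g (v' + θ * (u' - v'))) fun θ hθ => by
      rw [uIoc_of_le zero_le_one] at hθ
      refine (hg _ _ (norm_segment_le hu hv hθ.1.le hθ.2)
        (norm_segment_le hu' hv' hθ.1.le hθ.2)).trans ?_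
      gcongr
      have e : v + θ * (u - v) - (v' + θ * (u' - v'))
          = ((1 - θ : ℝ) : ℂ) * (v - v') + (θ : ℂ) * (u - u') := by push_cast; ring
      rw [e]
      refine (norm_add_le _ _).trans ?_
      rw [norm_mul, norm_mul, Complex.norm_real, Complex.norm_real, Real.norm_of_nonneg hθ.1.le,
        Real.norm_of_nonneg (by linarith [hθ.2])]
      nlinarith [norm_nonneg (u - u'), norm_nonneg (v - v'), hθ.1, hθ.2]
  simpa using this

lemma abs_rpow_sub_rpow_le {q X s t : ℝ} (hq : 1 ≤ q) (hs : 0 ≤ s) (ht : 0 ≤ t) (hsX : s ≤ X)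
    (htX : t ≤ X) : |s ^ q - t ^ q| ≤ q * X ^ (q - 1) * |s - t| := by
  have := Convex.norm_image_sub_le_of_norm_hasDerivWithin_le (f := fun x : ℝ => x ^ q)
    (f' := fun x => q * x ^ (q - 1)) (s := Icc 0 X) (C := q * X ^ (q - 1))
    (fun x _ => (Real.hasDerivAt_rpow_const (Or.inr hq)).hasDerivWithinAt)
    (fun x hx => by
      rw [Real.norm_of_nonneg (by have := Real.rpow_nonneg hx.1 (q - 1); positivity)]
      have := Real.rpow_le_rpow hx.1 hx.2 (by linarith : 0 ≤ q - 1)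
      gcongr) (convex_Icc 0 X) ⟨ht, htX⟩ ⟨hs, hsX⟩
  simpa using this

lemma norm_nonlinD_le {p X : ℝ} (hp : 3 ≤ p) (hp' : p ≤ 5) {z : ℂ} (hz : ‖z‖ ≤ X) :
    ‖nonlinD p z‖ ≤ 3 * X ^ (p - 1) := by
  have h1 := Real.rpow_le_rpow (norm_nonneg z) hz (by linarith : 0 ≤ p - 1)
  have h0 := Real.rpow_nonneg (norm_nonneg z) (p - 1)
  rw [nonlinD, Complex.norm_real, Real.norm_of_nonneg (by positivity)]
  gcongr
  linarith

lemma norm_rpow_mul_sq {p : ℝ} (hp : 3 ≤ p) {s : ℝ} (hs : 0 ≤ s) :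
    s ^ (p - 3) * s ^ 2 = s ^ (p - 1) := by
  rw [← Real.rpow_add_natCast' (n := 2) hs (by push_cast; linarith)]
  congr 1
  push_cast
  ring

lemma norm_nonlinDbar_le {p X : ℝ} (hp : 3 ≤ p) (hp' : p ≤ 5) {z : ℂ} (hz : ‖z‖ ≤ X) :
    ‖nonlinDbar p z‖ ≤ 3 * X ^ (p - 1) := by
  have h1 := Real.rpow_le_rpow (norm_nonneg z) hz (by linarith : 0 ≤ p - 1)
  have h0 := Real.rpow_nonneg (norm_nonneg z) (p - 1)
  have h3 := Real.rpow_nonneg (norm_nonneg z) (p - 3)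
  rw [nonlinDbar, norm_mul, Complex.norm_real, Real.norm_of_nonneg
    (mul_nonneg (by linarith) h3), norm_pow, mul_assoc, norm_rpow_mul_sq hp (norm_nonneg _)]
  gcongr
  linarith

lemma norm_nonlinD_sub_le {p X : ℝ} (hp : 3 ≤ p) (hp' : p ≤ 5) {z z' : ℂ} (hz : ‖z‖ ≤ X)
    (hz' : ‖z'‖ ≤ X) : ‖nonlinD p z - nonlinD p z'‖ ≤ 12 * X ^ (p - 2) * ‖z - z'‖ := by
  have hX : 0 ≤ X := (norm_nonneg _).trans hz
  have h := abs_rpow_sub_rpow_le (q := p - 1) (by linarith) (norm_nonneg z) (norm_nonneg z') hz hz'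
  have e : p - 1 - 1 = p - 2 := by ring
  rw [e] at h
  have hX2 := Real.rpow_nonneg hX (p - 2)
  rw [nonlinD, nonlinD, ← Complex.ofReal_sub, Complex.norm_real, ← mul_sub, norm_mul,
    Real.norm_of_nonneg (by linarith), Real.norm_eq_abs]
  calc (p + 1) / 2 * |‖z‖ ^ (p - 1) - ‖z'‖ ^ (p - 1)|
      ≤ 3 * (4 * X ^ (p - 2) * ‖z - z'‖) := by
        gcongr
        · linarith
        · refine h.trans ?_
          gcongr
          · linarith
          · exact abs_norm_sub_norm_le z z'
    _ = _ := by ring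

/-- The factor `|z|^(p-3)` need not be Lipschitz when `p < 4`. With `z'` the smaller point, its
increment is multiplied by `|z'|² ≤ |z|²`, which reduces matters to the Lipschitz power `p - 1`. -/
lemma norm_nonlinDbar_sub_le {p X : ℝ} (hp : 3 ≤ p) (hp' : p ≤ 5) {z z' : ℂ} (hz : ‖z‖ ≤ X)
    (hz' : ‖z'‖ ≤ X) : ‖nonlinDbar p z - nonlinDbar p z'‖ ≤ 12 * X ^ (p - 2) * ‖z - z'‖ := by
  wlog hle : ‖z'‖ ≤ ‖z‖ generalizing z z'
  · rw [norm_sub_rev, norm_sub_rev z]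
    exact this hz' hz (not_le.1 hle).le
  have hX : 0 ≤ X := (norm_nonneg _).trans hz
  have hX2 := Real.rpow_nonneg hX (p - 2)
  have h3 := Real.rpow_nonneg (norm_nonneg z) (p - 3)
  have h3' := Real.rpow_nonneg (norm_nonneg z') (p - 3)
  have hmono := Real.rpow_le_rpow (norm_nonneg z') hle (by linarith : 0 ≤ p - 3)
  have h := abs_rpow_sub_rpow_le (q := p - 1) (by linarith) (norm_nonneg z) (norm_nonneg z') hz hz'
  have e : p - 1 - 1 = p - 2 := by ring
  rw [e] at h
  have hb : ‖z‖ ^ (p - 3) * ‖z‖ ≤ X ^ (p - 2) := by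
    have e2 : p - 2 = p - 3 + 1 := by ring
    rw [← Real.rpow_add_one' (norm_nonneg _) (by linarith), e2]
    exact Real.rpow_le_rpow (norm_nonneg _) hz (by linarith)
  have hsplit : nonlinDbar p z - nonlinDbar p z' = (((p - 1) / 2 : ℝ) : ℂ) *
      (((‖z‖ ^ (p - 3) : ℝ) : ℂ) * ((z + z') * (z - z')) +
        ((‖z‖ ^ (p - 3) - ‖z'‖ ^ (p - 3) : ℝ) : ℂ) * z' ^ 2) := by
    simp only [nonlinDbar]
    push_cast
    ring
  have t1 : ‖z‖ ^ (p - 3) * (‖z + z'‖ * ‖z - z'‖) ≤ 2 * X ^ (p - 2) * ‖z - z'‖ := by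
    have : ‖z + z'‖ ≤ 2 * ‖z‖ := (norm_add_le _ _).trans (by linarith)
    calc _ ≤ ‖z‖ ^ (p - 3) * (2 * ‖z‖ * ‖z - z'‖) := by gcongr
      _ = 2 * (‖z‖ ^ (p - 3) * ‖z‖) * ‖z - z'‖ := by ring
      _ ≤ _ := by gcongr
  have t2 : (‖z‖ ^ (p - 3) - ‖z'‖ ^ (p - 3)) * ‖z'‖ ^ 2 ≤ 4 * X ^ (p - 2) * ‖z - z'‖ := by
    calc (‖z‖ ^ (p - 3) - ‖z'‖ ^ (p - 3)) * ‖z'‖ ^ 2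
        = ‖z‖ ^ (p - 3) * ‖z'‖ ^ 2 - ‖z'‖ ^ (p - 3) * ‖z'‖ ^ 2 := by ring
      _ ≤ ‖z‖ ^ (p - 3) * ‖z‖ ^ 2 - ‖z'‖ ^ (p - 3) * ‖z'‖ ^ 2 := by gcongr
      _ = ‖z‖ ^ (p - 1) - ‖z'‖ ^ (p - 1) := by
        rw [norm_rpow_mul_sq hp (norm_nonneg _), norm_rpow_mul_sq hp (norm_nonneg _)]
      _ ≤ (p - 1) * X ^ (p - 2) * |‖z‖ - ‖z'‖| := (le_abs_self _).trans h
      _ ≤ _ := by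
        gcongr
        · linarith
        · exact abs_norm_sub_norm_le z z'
  rw [hsplit, norm_mul, Complex.norm_real, Real.norm_of_nonneg (by linarith)]
  have t3 : ‖((‖z‖ ^ (p - 3) : ℝ) : ℂ) * ((z + z') * (z - z')) +
        ((‖z‖ ^ (p - 3) - ‖z'‖ ^ (p - 3) : ℝ) : ℂ) * z' ^ 2‖ ≤ 6 * X ^ (p - 2) * ‖z - z'‖ := by
    refine (norm_add_le _ _).trans ?_
    rw [norm_mul, norm_mul, norm_mul, norm_pow, Complex.norm_real, Complex.norm_real,
      Real.norm_of_nonneg h3, Real.norm_of_nonneg (by linarith)]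
    linarith
  calc _ ≤ 2 * (6 * X ^ (p - 2) * ‖z - z'‖) := by
        gcongr
        linarith
    _ = _ := by ring

end GibbsNLS

namespace GibbsNLS

/-! ### Consequences of the a priori bounds at a fixed time -/

/-- The logarithmic weight in the a priori bounds. -/
noncomputable def logWeight (T R x : ℝ) : ℝ := Real.log (T + R + bracket x)

/-- The a priori bounds at a fixed time. -/
structure SliceBounds (ρ : ℝ → ℝ) (p A₀ δ T R : ℝ) (u : ℝ → ℂ) : Prop where
  continuous : Continuous u
  bounded : ∃ D, ∀ x, ‖u x‖ ≤ D
  pointwise : ∀ x, ‖u x‖ ≤ A₀ * logWeight T R x ^ (2 / (p + 3))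
  high : ∀ (k : ℕ) x, ((2 : ℝ) ^ k) ^ (1 / 2 - δ) * ‖PHigh ρ (2 ^ k) u x‖
    ≤ A₀ * logWeight T R x ^ (1 / 2 : ℝ)

lemma bracket_le (x : ℝ) : bracket x ≤ 1 + |x| := by
  unfold bracket
  rw [Real.sqrt_le_left (by positivity), ← sq_abs x]
  nlinarith [abs_nonneg x]

lemma one_le_bracket (x : ℝ) : 1 ≤ bracket x := by
  unfold bracket
  rw [Real.one_le_sqrt]
  nlinarith [sq_nonneg x]

lemma one_le_logWeight {T R : ℝ} (hT : 1 ≤ T) (hR : 10 ≤ R) (x : ℝ) : 1 ≤ logWeight T R x := by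
  unfold logWeight
  rw [Real.le_log_iff_exp_le (by linarith [one_le_bracket x])]
  linarith [Real.exp_one_lt_d9, one_le_bracket x]

lemma add_bracket_le {T R s r : ℝ} (hr : 1 ≤ r) (hTs : T ≤ s) (hRs : R ≤ s) (hrs : r ≤ s) (x : ℝ) :
    T + R + bracket x ≤ 4 * s * growth r x := by
  have h := bracket_le x
  have hr0 : 0 < r := by linarith
  have h2 : |x| = r * (|x| / r) := by field_simp
  have h3 : 0 ≤ |x| / r := by positivity
  unfold growth
  nlinarith

/-- The scale `s`, which dominates `T`, is kept apart from the spatial scale `r` so that the bound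
also covers the case `R < T`. -/
lemma logWeight_le {T R s r : ℝ} (hT : 1 ≤ T) (hR : 10 ≤ R) (hr : 1 ≤ r) (hTs : T ≤ s)
    (hRs : R ≤ s) (hrs : r ≤ s) (x : ℝ) :
    logWeight T R x ≤ (1 + Real.log (4 * s)) * growth r x := by
  have hg := one_le_growth (zero_lt_one.trans_le hr) x
  have hs : 0 < 4 * s := by linarith
  have h0 : 0 ≤ Real.log (4 * s) := Real.log_nonneg (by linarith)
  have h1 : logWeight T R x ≤ Real.log (4 * s * growth r x) :=
    Real.log_le_log (by linarith [one_le_bracket x]) (add_bracket_le hr hTs hRs hrs x)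
  rw [Real.log_mul hs.ne' (by linarith)] at h1
  have h2 := Real.log_le_sub_one_of_pos (zero_lt_one.trans_le hg)
  nlinarith

/-- Away from `|x| ≫ r`, the logarithmic weight is of size `log r`. -/
lemma logWeight_sq_le {T R r : ℝ} (hT : 1 ≤ T) (hR : 10 ≤ R) (hTr : T ≤ r) (hRr : R ≤ r) (x : ℝ) :
    logWeight T R x ^ 2 ≤ 16 * Real.log r ^ 2 +
      (1 + Real.log (4 * r)) ^ 2 * growth r x ^ 6 * (r ^ 8)⁻¹ := by
  have hr : 10 ≤ r := by linarith
  have hr0 : 0 < r := by linarith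
  have hg := one_le_growth hr0 x
  have hl1 := one_le_logWeight hT hR x
  have hlog : 0 ≤ Real.log r := Real.log_nonneg (by linarith)
  -- In the far region the growth function exceeds `r²`, so four extra powers of it buy the factor
  -- `r^(-8)`, which later makes this contribution negligible.
  rcases le_or_gt (growth r x) (r ^ 2) with h | h
  · have h1 : logWeight T R x ≤ 4 * Real.log r := by
      have : logWeight T R x ≤ Real.log (r ^ 4) := by
        refine Real.log_le_log (by linarith [one_le_bracket x])
          ((add_bracket_le (by linarith) hTr hRr le_rfl x).trans ?_)
        calc 4 * r * growth r x ≤ r * r * r ^ 2 := by gcongr; linarith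
          _ = r ^ 4 := by ring
      rwa [Real.log_pow] at this
    have h2 : 0 ≤ (1 + Real.log (4 * r)) ^ 2 * growth r x ^ 6 * (r ^ 8)⁻¹ := by positivity
    nlinarith
  · have h1 := logWeight_le hT hR (by linarith) hTr hRr le_rfl x
    have h2 : 1 ≤ growth r x ^ 4 * (r ^ 8)⁻¹ := by
      rw [← div_eq_mul_inv, one_le_div (by positivity)]
      calc r ^ 8 = (r ^ 2) ^ 4 := by ring
        _ ≤ _ := by gcongr
    calc logWeight T R x ^ 2 ≤ ((1 + Real.log (4 * r)) * growth r x) ^ 2 := by gcongr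
      _ ≤ ((1 + Real.log (4 * r)) * growth r x) ^ 2 * (growth r x ^ 4 * (r ^ 8)⁻¹) :=
        le_mul_of_one_le_right (sq_nonneg _) h2
      _ = (1 + Real.log (4 * r)) ^ 2 * growth r x ^ 6 * (r ^ 8)⁻¹ := by ring
      _ ≤ _ := by nlinarith [sq_nonneg (Real.log r)]

namespace SliceBounds

variable {ρ : ℝ → ℝ} {p A₀ δ T R : ℝ} {u : ℝ → ℂ}

lemma norm_le (h : SliceBounds ρ p A₀ δ T R u) (hp : 3 ≤ p) (hA : 1 ≤ A₀) (hT : 1 ≤ T)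
    (hR : 10 ≤ R) {s r : ℝ} (hr : 1 ≤ r) (hTs : T ≤ s) (hRs : R ≤ s) (hrs : r ≤ s) (x : ℝ) :
    ‖u x‖ ≤ A₀ * (1 + Real.log (4 * s)) * growth r x := by
  rw [mul_assoc]
  refine (h.pointwise x).trans ?_
  gcongr
  refine le_trans ?_ (logWeight_le hT hR hr hTs hRs hrs x)
  conv_rhs => rw [← Real.rpow_one (logWeight T R x)]
  exact Real.rpow_le_rpow_of_exponent_le (one_le_logWeight hT hR x)
    (by rw [div_le_one (by linarith)]; linarith)

lemma norm_high_le (h : SliceBounds ρ p A₀ δ T R u) (hA : 1 ≤ A₀) (hT : 1 ≤ T)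
    (hR : 10 ≤ R) {r : ℝ} (hTr : T ≤ r) (hRr : R ≤ r) (k : ℕ) (x : ℝ) :
    ‖PHigh ρ (2 ^ k) u x‖ ≤
      A₀ * (1 + Real.log (4 * r)) * ((2 : ℝ) ^ k) ^ (-(1 / 2 - δ)) * growth r x := by
  have h1 := h.high k x
  have hpos : 0 < ((2 : ℝ) ^ k) ^ (1 / 2 - δ) := Real.rpow_pos_of_pos (by positivity) _
  have h2 : logWeight T R x ^ (1 / 2 : ℝ) ≤ (1 + Real.log (4 * r)) * growth r x := by
    refine le_trans ?_ (logWeight_le hT hR (by linarith) hTr hRr le_rfl x)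
    conv_rhs => rw [← Real.rpow_one (logWeight T R x)]
    exact Real.rpow_le_rpow_of_exponent_le (one_le_logWeight hT hR x) (by norm_num)
  rw [Real.rpow_neg (by positivity)]
  have h3 : ‖PHigh ρ (2 ^ k) u x‖ ≤
      (A₀ * ((1 + Real.log (4 * r)) * growth r x)) / ((2 : ℝ) ^ k) ^ (1 / 2 - δ) := by
    rw [le_div_iff₀ hpos, mul_comm]
    exact h1.trans (by gcongr)
  refine h3.trans (le_of_eq ?_)
  ring

lemma continuous_PLow (h : SliceBounds ρ p A₀ δ T R u) (hρ : IsCutoff ρ) {N : ℝ} (hN : 0 < N) :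
    Continuous (PLow ρ N u) := by
  obtain ⟨C, -, hC⟩ := hρ.exists_isMollifier
  obtain ⟨D, hD⟩ := h.bounded
  exact (hC N hN).1.continuous_conv hN h.continuous hD

end SliceBounds

lemma exists_dyadic_near {x : ℝ} (hx : 1 ≤ x) : ∃ k : ℕ, (2 : ℝ) ^ k ≤ x ∧ x ≤ 2 * 2 ^ k := by
  obtain ⟨k, h1, h2⟩ := exists_nat_pow_near hx (one_lt_two : (1 : ℝ) < 2)
  exact ⟨k, h1, by rw [pow_succ] at h2; linarith⟩

lemma dyadic_rpow_le {x y θ : ℝ} (hy : 0 < y) (h : x ≤ 2 * y) (hx : 0 < x) (h0 : 0 ≤ θ)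
    (h1 : θ ≤ 1) : y ^ (-θ) ≤ 2 * x ^ (-θ) := by
  rw [Real.rpow_neg hy.le, Real.rpow_neg hx.le, ← div_eq_mul_inv, le_div_iff₀
    (Real.rpow_pos_of_pos hx _), inv_mul_le_iff₀ (Real.rpow_pos_of_pos hy _)]
  calc x ^ θ ≤ (2 * y) ^ θ := Real.rpow_le_rpow hx.le h h0
    _ = 2 ^ θ * y ^ θ := Real.mul_rpow (by norm_num) hy.le
    _ ≤ 2 ^ (1 : ℝ) * y ^ θ := by
      have := Real.rpow_nonneg hy.le θ
      gcongr
      norm_num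
    _ = _ := by rw [Real.rpow_one]; ring

lemma one_add_log_pos {r : ℝ} (hr : 10 ≤ r) : 1 ≤ 1 + Real.log (4 * r) :=
  le_add_of_nonneg_right (Real.log_nonneg (by linarith))

/-- The modulus of continuity which follows from the a priori bounds. -/
lemma SliceBounds.norm_increment_le {ρ : ℝ → ℝ} {p A₀ δ T R : ℝ} {u : ℝ → ℂ}
    (h : SliceBounds ρ p A₀ δ T R u) (hρ : IsCutoff ρ) {C : ℝ} (hC1 : 1 ≤ C)
    (hC : ∀ N : ℝ, 0 < N → IsMollifier C N (kernel ρ N) ∧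
      IsMollifier (C * N) N (deriv (kernel ρ N))) (hp : 3 ≤ p) (hA : 1 ≤ A₀)
    (hδ : 0 < δ) (hδ' : δ ≤ 1 / 100) (hT : 1 ≤ T) (hR : 10 ≤ R) {r : ℝ} (hTr : T ≤ r)
    (hRr : R ≤ r) (x y : ℝ) :
    ‖u y - u x‖ ≤ 8 * C * A₀ * (1 + Real.log (4 * r)) * r ^ (-(1 / 3 : ℝ) + δ) * growth r x
      * (1 + r * |x - y|) ^ 2 := by
  have hr : 10 ≤ r := by linarith
  have hr0 : 0 < r := by linarith
  obtain ⟨D, hD⟩ := h.bounded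
  -- The splitting frequency `N ≈ r^(2/3)` balances the high part, about `N^(-1/2)`, against the low
  -- part, whose derivative costs `N` over a distance about `1/r`. Both are then about `r^(-1/3)`.
  have hx23 : 1 ≤ r ^ (2 / 3 : ℝ) := Real.one_le_rpow (by linarith) (by norm_num)
  obtain ⟨k, hk1, hk2⟩ := exists_dyadic_near hx23
  set N : ℝ := 2 ^ k with hN
  have hN1 : 1 ≤ N := one_le_pow₀ (by norm_num)
  have hN0 : 0 < N := by linarith
  set Λ := 1 + Real.log (4 * r) with hΛ
  have hΛ1 : 1 ≤ Λ := one_add_log_pos hr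
  have hg := one_le_growth hr0 x
  set s := 1 + r * |x - y| with hs
  have hs1 : 1 ≤ s := le_add_of_nonneg_right (by positivity)
  have hgy : growth r y ≤ growth r x * s := growth_le_mul hr0 (by nlinarith) x y
  have hNr : 1 ≤ N * r := by nlinarith
  have hγ : N ^ (-(1 / 2 - δ)) ≤ 2 * r ^ (-(1 / 3 : ℝ) + δ) := by
    refine (dyadic_rpow_le hN0 hk2 (by linarith) (by linarith) (by linarith)).trans ?_
    rw [← Real.rpow_mul hr0.le]
    gcongr
    · linarith
    · nlinarith
  have hγ' : N / r ≤ r ^ (-(1 / 3 : ℝ) + δ) := by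
    rw [div_le_iff₀ hr0]
    refine hk1.trans ?_
    conv_rhs => rw [← Real.rpow_one r, ← Real.rpow_mul hr0.le, one_mul, ← Real.rpow_add hr0]
    exact Real.rpow_le_rpow_of_exponent_le (by linarith) (by linarith)
  set γ := r ^ (-(1 / 3 : ℝ) + δ)
  have hγ0 : 0 ≤ γ := Real.rpow_nonneg hr0.le _
  have e1 : ‖PHigh ρ N u y - PHigh ρ N u x‖ ≤ 4 * A₀ * Λ * γ * growth r x * s := by
    have a1 := h.norm_high_le hA hT hR hTr hRr k x
    have a2 := h.norm_high_le hA hT hR hTr hRr k y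
    have b1 : ‖PHigh ρ N u x‖ ≤ A₀ * Λ * (2 * γ) * (growth r x * s) := by
      refine a1.trans ?_
      gcongr
      nlinarith
    have b2 : ‖PHigh ρ N u y‖ ≤ A₀ * Λ * (2 * γ) * (growth r x * s) := by
      have := one_le_growth hr0 y
      refine a2.trans ?_
      gcongr
    refine (norm_sub_le _ _).trans ?_
    linarith
  have e2 : ‖PLow ρ N u y - PLow ρ N u x‖ ≤ 4 * C * A₀ * Λ * γ * growth r x * s ^ 2 := by
    have hB := Convex.norm_image_sub_le_of_norm_hasDerivWithin_le (f := PLow ρ N u)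
      (f' := conv (deriv (kernel ρ N)) u) (s := uIcc x y)
      (C := 4 * (C * N) * (A₀ * Λ) * (growth r x * s))
      (fun z _ => ((hC N hN0).1.hasDerivAt_conv (hC N hN0).2 hN0 (hρ.hasDerivAt_kernel hN0)
        h.continuous hD z).hasDerivWithinAt)
      (fun z hz => by
        refine ((hC N hN0).2.norm_conv_le_growth hN0 hr0 hNr h.continuous.aestronglyMeasurable
          (by positivity) (h.norm_le hp hA hT hR (by linarith) hTr hRr le_rfl) z).trans ?_
        gcongr
        refine (growth_le_mul hr0 (by nlinarith) x z).trans ?_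
        have hz' : |x - z| ≤ |x - y| := by
          rw [abs_sub_comm x z, abs_sub_comm x y]
          exact abs_sub_left_of_mem_uIcc hz
        refine mul_le_mul_of_nonneg_left ?_ (by linarith)
        linarith [mul_le_mul_of_nonneg_left hz' hr0.le]) (convex_uIcc x y) left_mem_uIcc right_mem_uIcc
    refine hB.trans ?_
    rw [Real.norm_eq_abs, abs_sub_comm]
    have hxy : |x - y| ≤ s / r := by
      rw [le_div_iff₀ hr0, hs]; linarith
    calc 4 * (C * N) * (A₀ * Λ) * (growth r x * s) * |x - y|
        ≤ 4 * (C * N) * (A₀ * Λ) * (growth r x * s) * (s / r) := by gcongr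
      _ = 4 * C * (A₀ * Λ) * (growth r x * s) * s * (N / r) := by ring
      _ ≤ 4 * C * (A₀ * Λ) * (growth r x * s) * s * γ := by gcongr
      _ = _ := by ring
  have e3 : u y - u x = (PHigh ρ N u y - PHigh ρ N u x) + (PLow ρ N u y - PLow ρ N u x) := by
    simp only [PHigh]; ring
  rw [e3]
  refine (norm_add_le _ _).trans ((add_le_add e1 e2).trans ?_)
  have e4 : 4 * A₀ * Λ * γ * growth r x * s ≤ 4 * C * A₀ * Λ * γ * growth r x * s ^ 2 := by
    calc 4 * A₀ * Λ * γ * growth r x * s = 4 * 1 * A₀ * Λ * γ * growth r x * (s * 1) := by ring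
      _ ≤ 4 * C * A₀ * Λ * γ * growth r x * (s * s) := by gcongr
      _ = _ := by ring
  linarith

/-- The bound on the high-frequency part for general real frequencies. -/
lemma SliceBounds.norm_remainder_le {ρ : ℝ → ℝ} {p A₀ δ T R : ℝ} {u : ℝ → ℂ}
    (h : SliceBounds ρ p A₀ δ T R u) (hρ : IsCutoff ρ) {C : ℝ} (hC1 : 1 ≤ C)
    (hC : ∀ N : ℝ, 0 < N → IsMollifier C N (kernel ρ N)) (hA : 1 ≤ A₀)
    (hδ : 0 < δ) (hδ' : δ ≤ 1 / 100) (hT : 1 ≤ T) (hR : 10 ≤ R) {r : ℝ} (hTr : T ≤ r)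
    (hRr : R ≤ r) (x : ℝ) :
    ‖u x - PLow ρ (2 * r) u x‖ ≤
      10 * C * A₀ * (1 + Real.log (4 * r)) * r ^ (-(1 / 2 : ℝ) + δ) * growth r x := by
  have hr : 10 ≤ r := by linarith
  have hr0 : 0 < r := by linarith
  obtain ⟨D, hD⟩ := h.bounded
  obtain ⟨k, hk1, hk2⟩ := exists_dyadic_near (x := r) (by linarith)
  set N : ℝ := 2 ^ k with hN
  have hN0 : 0 < N := by positivity
  set Λ := 1 + Real.log (4 * r) with hΛ
  have hΛ1 : 1 ≤ Λ := one_add_log_pos hr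
  have hg := one_le_growth hr0 x
  have hγ : N ^ (-(1 / 2 - δ)) ≤ 2 * r ^ (-(1 / 2 : ℝ) + δ) := by
    refine (dyadic_rpow_le hN0 hk2 hr0 (by linarith) (by linarith)).trans (le_of_eq ?_)
    congr 2
    ring
  set γ := r ^ (-(1 / 2 : ℝ) + δ)
  have hγ0 : 0 ≤ γ := Real.rpow_nonneg hr0.le _
  have hf : ∀ y, ‖PHigh ρ N u y‖ ≤ A₀ * Λ * (2 * γ) * growth r y := fun y => by
    have := one_le_growth hr0 y
    refine (h.norm_high_le hA hT hR hTr hRr k y).trans ?_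
    gcongr
  have hcN := h.continuous_PLow hρ hN0
  have hcf : Continuous (PHigh ρ N u) := h.continuous.sub hcN
  have hlow := (hC (2 * r) (by linarith)).norm_conv_le_growth (by linarith) hr0 (by nlinarith)
    hcf.aestronglyMeasurable (by positivity) hf x
  have hDN : ∀ y, ‖PLow ρ N u y‖ ≤ D * C * Real.pi := fun y =>
    (hC N hN0).norm_conv_le_of_bounded hN0 y h.continuous.aestronglyMeasurable hD
  -- Since `P_{≤ 2r}` fixes `P_{≤ N} u`, the operator `P_{> 2r}` sees only `P_{> N} u`. This
  -- transfers the bound from dyadic `N` to the real frequency `2r`.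
  have e : u x - PLow ρ (2 * r) u x = PHigh ρ N u x - conv (kernel ρ (2 * r)) (PHigh ρ N u) x := by
    have e1 : conv (kernel ρ (2 * r)) (PHigh ρ N u) x
        = PLow ρ (2 * r) u x - PLow ρ (2 * r) (PLow ρ N u) x := by
      simp only [conv, PHigh, PLow_eq_conv, mul_sub]
      refine integral_sub ?_ ?_
      · exact (hC _ (by linarith)).integrable_of_bounded (by linarith) x
          h.continuous.aestronglyMeasurable hD
      · exact (hC _ (by linarith)).integrable_of_bounded (by linarith) x
          hcN.aestronglyMeasurable hDN
    rw [e1, PLow_PLow' hρ hρ hN0 (by linarith) h.continuous hD, PHigh]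
    ring
  rw [e]
  refine (norm_sub_le _ _).trans ((add_le_add (hf x) hlow).trans ?_)
  have : A₀ * Λ * (2 * γ) * growth r x ≤ 2 * C * A₀ * Λ * γ * growth r x := by
    calc A₀ * Λ * (2 * γ) * growth r x = 2 * 1 * A₀ * Λ * γ * growth r x := by ring
      _ ≤ _ := by gcongr
  linarith

end GibbsNLS

namespace GibbsNLS

/-! ### The nonlinearity at low frequencies -/

lemma PLow_conj (ρ : ℝ → ℝ) (N : ℝ) (f : ℝ → ℂ) (x : ℝ) :
    PLow ρ N (fun y => (starRingEnd ℂ) (f y)) x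
      = (starRingEnd ℂ) (PLow (fun ξ => ρ (-ξ)) N f x) := by
  simp only [PLow]
  rw [← integral_conj]
  refine integral_congr_ae (.of_forall fun y => ?_)
  simp only [map_mul, conj_kernel, neg_neg]

lemma IsMollifier.conv_sub {C N : ℝ} {H : ℝ → ℂ} (hH : IsMollifier C N H) (hN : 0 < N)
    {f g : ℝ → ℂ} (hf : Continuous f) (hg : Continuous g) {D D' : ℝ} (hD : ∀ y, ‖f y‖ ≤ D)
    (hD' : ∀ y, ‖g y‖ ≤ D') (x : ℝ) :
    conv H (fun y => f y - g y) x = conv H f x - conv H g x := by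
  simp only [conv, mul_sub]
  exact integral_sub (hH.integrable_of_bounded hN x hf.aestronglyMeasurable hD)
    (hH.integrable_of_bounded hN x hg.aestronglyMeasurable hD')

/-- `P_{≤ r} P_{> 2r} = 0`. -/
lemma PLow_PHigh_eq_zero {ρ₁ ρ₂ : ℝ → ℝ} (h₁ : IsCutoff ρ₁) (h₂ : IsCutoff ρ₂) {r : ℝ}
    (hr : 0 < r) {f : ℝ → ℂ} (hf : Continuous f) {D : ℝ} (hD : ∀ y, ‖f y‖ ≤ D) (x : ℝ) :
    PLow ρ₁ r (PHigh ρ₂ (2 * r) f) x = 0 := by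
  obtain ⟨C₁, -, hC₁⟩ := h₁.exists_isMollifier
  obtain ⟨C₂, -, hC₂⟩ := h₂.exists_isMollifier
  have hr2 : 0 < 2 * r := by linarith
  have hc := (hC₂ _ hr2).1.continuous_conv hr2 hf hD
  have e : PLow ρ₁ r (PHigh ρ₂ (2 * r) f) x = PLow ρ₁ r f x - PLow ρ₁ r (PLow ρ₂ (2 * r) f) x :=
    (hC₁ r hr).1.conv_sub hr hf hc hD
      (fun y => (hC₂ _ hr2).1.norm_conv_le_of_bounded hr2 y hf.aestronglyMeasurable hD) x
  rw [e, PLow_PLow h₁ h₂ hr (by linarith) hf hD, sub_self]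

lemma PLow_conj_PHigh_eq_zero {ρ : ℝ → ℝ} (h : IsCutoff ρ) {r : ℝ}
    (hr : 0 < r) {f : ℝ → ℂ} (hf : Continuous f) {D : ℝ} (hD : ∀ y, ‖f y‖ ≤ D) (x : ℝ) :
    PLow ρ r (fun y => (starRingEnd ℂ) (PHigh ρ (2 * r) f y)) x = 0 := by
  rw [PLow_conj, PLow_PHigh_eq_zero h.reflect h hr hf hD, map_zero]

/-- Commuting the low-frequency projection with coefficients: if `P_{≤ r} h = P_{≤ r} h̄ = 0`, then
the coefficients `a`, `b` may be replaced by their increments. -/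
lemma conv_coeff_mul {C N : ℝ} {H : ℝ → ℂ} (hH : IsMollifier C N H) (hN : 0 < N) {a b h : ℝ → ℂ}
    (ha : Continuous a) (hb : Continuous b) (hh : Continuous h) {A B D : ℝ} (hA : ∀ y, ‖a y‖ ≤ A)
    (hB : ∀ y, ‖b y‖ ≤ B) (hD : ∀ y, ‖h y‖ ≤ D) (x : ℝ) (h0 : conv H h x = 0)
    (h0' : conv H (fun y => (starRingEnd ℂ) (h y)) x = 0) :
    conv H (fun y => a y * h y + b y * (starRingEnd ℂ) (h y)) x =
      conv H (fun y => (a y - a x) * h y + (b y - b x) * (starRingEnd ℂ) (h y)) x := by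
  have hA0 := (norm_nonneg _).trans (hA 0)
  have hB0 := (norm_nonneg _).trans (hB 0)
  have hD0 := (norm_nonneg _).trans (hD 0)
  have hDc : ∀ y, ‖(starRingEnd ℂ) (h y)‖ ≤ D := fun y => by simpa using hD y
  have i1 : Integrable fun y => H (x - y) * (a y * h y + b y * (starRingEnd ℂ) (h y)) := by
    refine hH.integrable_of_bounded hN x (D := A * D + B * D)
      (Continuous.aestronglyMeasurable (by fun_prop)) fun y => ?_
    refine (norm_add_le _ _).trans ?_
    rw [norm_mul, norm_mul]
    exact add_le_add (mul_le_mul (hA y) (hD y) (norm_nonneg _) hA0)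
      (mul_le_mul (hB y) (hDc y) (norm_nonneg _) hB0)
  have i2 : Integrable fun y => H (x - y) * h y :=
    hH.integrable_of_bounded hN x hh.aestronglyMeasurable hD
  have i3 : Integrable fun y => H (x - y) * (starRingEnd ℂ) (h y) :=
    hH.integrable_of_bounded hN x (Continuous.aestronglyMeasurable (by fun_prop)) hDc
  have e : ∀ y, H (x - y) * ((a y - a x) * h y + (b y - b x) * (starRingEnd ℂ) (h y))
      = H (x - y) * (a y * h y + b y * (starRingEnd ℂ) (h y)) -
        (a x * (H (x - y) * h y) + b x * (H (x - y) * (starRingEnd ℂ) (h y))) := fun y => by ring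
  rw [conv, conv]
  simp only [e]
  rw [integral_sub (g := fun y => a x * (H (x - y) * h y) +
    b x * (H (x - y) * (starRingEnd ℂ) (h y))) i1 ((i2.const_mul _).add (i3.const_mul _)),
    integral_add (i2.const_mul _) (i3.const_mul _), integral_const_mul, integral_const_mul]
  change _ = _ - (a x * conv H h x + b x * conv H (fun y => (starRingEnd ℂ) (h y)) x)
  rw [h0, h0']
  simp

lemma rpow_le_cube {p X : ℝ} (hp' : p ≤ 5) (hX : 1 ≤ X) : X ^ (p - 2) ≤ X ^ 3 := by
  rw [← Real.rpow_natCast]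
  exact Real.rpow_le_rpow_of_exponent_le hX (by push_cast; linarith)

/-- The main part of the nonlinear term, in which both factors have frequency at most `2r`. -/
noncomputable def nonlinMain (ρ : ℝ → ℝ) (p r : ℝ) (u v : ℝ → ℂ) (y : ℝ) : ℂ :=
  segAvg (nonlinD p) (u y) (v y) * PLow ρ (2 * r) (fun z => u z - v z) y
    + segAvg (nonlinDbar p) (u y) (v y) * (starRingEnd ℂ) (PLow ρ (2 * r) (fun z => u z - v z) y)

section

variable {ρ : ℝ → ℝ} {p A₀ δ T R : ℝ} {u v : ℝ → ℂ}

/-- A purely qualitative bound, used only to justify integrability; it enters no estimate. -/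
lemma exists_bound_segAvg {g : ℂ → ℂ} (hg : Continuous g) {u v : ℝ → ℂ}
    (hu : ∃ D, ∀ x, ‖u x‖ ≤ D) (hv : ∃ D, ∀ x, ‖v x‖ ≤ D) :
    ∃ B, ∀ x, ‖segAvg g (u x) (v x)‖ ≤ B := by
  obtain ⟨D, hD⟩ := hu
  obtain ⟨D', hD'⟩ := hv
  obtain ⟨B, hB⟩ := (isCompact_closedBall (0 : ℂ) (max D D')).exists_bound_of_continuousOn
    hg.continuousOn
  exact ⟨B, fun x => norm_segAvg_le (X := max D D') (fun z hz => hB z (by simpa using hz))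
    ((hD x).trans (le_max_left _ _)) ((hD' x).trans (le_max_right _ _))⟩

/-- The difference is the contribution of `P_{> 2r} w`. As `P_{≤ r}` annihilates this function and
its conjugate, the coefficients may be replaced by their increments from `x`. The increment gives
`r^(-1/3+δ)` and the high-frequency factor `r^(-1/2+δ)`, each up to logarithms and growth factors.
-/
lemma norm_PLow_nonlin_sub_main_le (hu : SliceBounds ρ p A₀ δ T R u)
    (hv : SliceBounds ρ p A₀ δ T R v) (hρ : IsCutoff ρ) {C : ℝ} (hC1 : 1 ≤ C)
    (hC : ∀ N : ℝ, 0 < N → IsMollifier C N (kernel ρ N) ∧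
      IsMollifier (C * N) N (deriv (kernel ρ N))) (hp : 3 ≤ p) (hp' : p ≤ 5) (hA : 1 ≤ A₀)
    (hδ : 0 < δ) (hδ' : δ ≤ 1 / 100) (hT : 1 ≤ T) (hR : 10 ≤ R) {r : ℝ} (hTr : T ≤ r)
    (hRr : R ≤ r) (x : ℝ) :
    ‖PLow ρ r (fun y => nonlin p (u y) - nonlin p (v y)) x
        - PLow ρ r (nonlinMain ρ p r u v) x‖ ≤
      40000 * C ^ 3 * A₀ ^ 5 * (1 + Real.log (4 * r)) ^ 5 * r ^ (-(5 / 6 : ℝ) + 2 * δ)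
        * growth r x ^ 5 := by
  have hr : 10 ≤ r := by linarith
  have hr0 : 0 < r := by linarith
  have hr2 : 0 < 2 * r := by linarith
  obtain ⟨Du, hDu⟩ := hu.bounded
  obtain ⟨Dv, hDv⟩ := hv.bounded
  set w : ℝ → ℂ := fun z => u z - v z with hw
  have hcu := hu.continuous
  have hcv := hv.continuous
  have hcw : Continuous w := hcu.sub hcv
  have hDw : ∀ y, ‖w y‖ ≤ Du + Dv := fun y =>
    (norm_sub_le _ _).trans (add_le_add (hDu y) (hDv y))
  set a : ℝ → ℂ := fun y => segAvg (nonlinD p) (u y) (v y) with ha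
  set b : ℝ → ℂ := fun y => segAvg (nonlinDbar p) (u y) (v y) with hb
  have hca : Continuous a := continuous_segAvg (continuous_nonlinD hp) hcu hcv
  have hcb : Continuous b := continuous_segAvg (continuous_nonlinDbar hp) hcu hcv
  obtain ⟨A, hBA⟩ := exists_bound_segAvg (continuous_nonlinD hp) hu.bounded hv.bounded
  obtain ⟨B, hBB⟩ := exists_bound_segAvg (continuous_nonlinDbar hp) hu.bounded hv.bounded
  have hA0 := (norm_nonneg _).trans (hBA 0)
  have hB0 := (norm_nonneg _).trans (hBB 0)
  set w2 := PLow ρ (2 * r) w with hw2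
  have hcw2 : Continuous w2 := (hC _ hr2).1.continuous_conv hr2 hcw hDw
  have hDw2 : ∀ y, ‖w2 y‖ ≤ (Du + Dv) * C * Real.pi := fun y =>
    (hC _ hr2).1.norm_conv_le_of_bounded hr2 y hcw.aestronglyMeasurable hDw
  set D2 := (Du + Dv) * C * Real.pi
  set h : ℝ → ℂ := PHigh ρ (2 * r) w with hh
  have hch : Continuous h := hcw.sub hcw2
  have hDh : ∀ y, ‖h y‖ ≤ (Du + Dv) + D2 := fun y =>
    (norm_sub_le _ _).trans (add_le_add (hDw y) (hDw2 y))
  -- reduction to the high-frequency part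
  have e1 : PLow ρ r (fun y => nonlin p (u y) - nonlin p (v y)) x
      - PLow ρ r (nonlinMain ρ p r u v) x
      = conv (kernel ρ r) (fun y => a y * h y + b y * (starRingEnd ℂ) (h y)) x := by
    simp only [PLow_eq_conv]
    rw [conv, conv, conv, ← integral_sub]
    · refine integral_congr_ae (.of_forall fun y => ?_)
      simp only [nonlin_sub hp, nonlinMain, ← mul_sub]
      congr 1
      simp only [hh, PHigh, ha, hb, hw, map_sub]
      ring
    · obtain ⟨F, hF⟩ : ∃ F, ∀ y, ‖nonlin p (u y) - nonlin p (v y)‖ ≤ F := by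
        refine ⟨A * (Du + Dv) + B * (Du + Dv), fun y => ?_⟩
        rw [nonlin_sub hp]
        refine (norm_add_le _ _).trans ?_
        rw [norm_mul, norm_mul, RCLike.norm_conj]
        exact add_le_add (mul_le_mul (hBA y) (hDw y) (norm_nonneg _) hA0)
          (mul_le_mul (hBB y) (hDw y) (norm_nonneg _) hB0)
      exact (hC r hr0).1.integrable_of_bounded hr0 x (((continuous_nonlin hp).comp hcu).sub
        ((continuous_nonlin hp).comp hcv)).aestronglyMeasurable hF
    · refine (hC r hr0).1.integrable_of_bounded hr0 x (D := A * D2 + B * D2)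
        (Continuous.aestronglyMeasurable ?_) fun y => ?_
      · exact (hca.mul hcw2).add (hcb.mul (Complex.continuous_conj.comp hcw2))
      · refine (norm_add_le _ _).trans ?_
        rw [norm_mul, norm_mul, RCLike.norm_conj]
        exact add_le_add (mul_le_mul (hBA y) (hDw2 y) (norm_nonneg _) hA0)
          (mul_le_mul (hBB y) (hDw2 y) (norm_nonneg _) hB0)
  rw [e1, conv_coeff_mul (hC r hr0).1 hr0 hca hcb hch hBA hBB hDh x
    (PLow_PHigh_eq_zero hρ hρ hr0 hcw hDw x) (PLow_conj_PHigh_eq_zero hρ hr0 hcw hDw x)]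
  -- pointwise bounds
  set Λ := 1 + Real.log (4 * r) with hΛ
  have hΛ1 : 1 ≤ Λ := one_add_log_pos hr
  have hg := one_le_growth hr0 x
  set γ := r ^ (-(1 / 3 : ℝ) + δ) with hγ
  set γ' := r ^ (-(1 / 2 : ℝ) + δ) with hγ'
  have hγ0 : 0 ≤ γ := Real.rpow_nonneg hr0.le _
  have hγ0' : 0 ≤ γ' := Real.rpow_nonneg hr0.le _
  have hγγ : γ * γ' = r ^ (-(5 / 6 : ℝ) + 2 * δ) := by
    rw [hγ, hγ', ← Real.rpow_add hr0]; congr 1; ring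
  rw [← hγγ]
  -- Six powers of `s = 1 + r|x - y|` occur: three from the Lipschitz constant of the coefficients,
  -- two from the increment, one from the high-frequency factor.
  refine ((hC r hr0).1.norm_conv_le hr0 x (k := 6)
    (D := 7680 * C ^ 2 * A₀ ^ 5 * Λ ^ 5 * growth r x ^ 5 * (γ * γ'))
    (Continuous.aestronglyMeasurable (by fun_prop)) (by norm_num) fun y => ?_).trans ?_
  · set s := 1 + r * |x - y| with hs
    have hs1 : 1 ≤ s := le_add_of_nonneg_right (by positivity)
    have hgy : growth r y ≤ growth r x * s := growth_le_mul hr0 (by nlinarith) x y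
    set X := A₀ * Λ * (growth r x * s) with hX
    have hgs : 1 ≤ growth r x * s := one_le_mul_of_one_le_of_one_le hg hs1
    have hX1 : 1 ≤ X :=
      one_le_mul_of_one_le_of_one_le (one_le_mul_of_one_le_of_one_le hA hΛ1) hgs
    have bx : ∀ {f : ℝ → ℂ}, SliceBounds ρ p A₀ δ T R f → ‖f x‖ ≤ X := fun hf => by
      refine (hf.norm_le hp hA hT hR (by linarith) hTr hRr le_rfl x).trans ?_
      rw [hX]
      gcongr
      exact le_mul_of_one_le_right (by linarith) hs1
    have bY : ∀ {f : ℝ → ℂ}, SliceBounds ρ p A₀ δ T R f → ‖f y‖ ≤ X := fun hf => by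
      refine (hf.norm_le hp hA hT hR (by linarith) hTr hRr le_rfl y).trans ?_
      rw [hX]
      gcongr
    have dd : ∀ {f : ℝ → ℂ}, SliceBounds ρ p A₀ δ T R f →
        ‖f y - f x‖ ≤ 8 * C * A₀ * Λ * γ * growth r x * s ^ 2 := fun hf =>
      hf.norm_increment_le hρ hC1 hC hp hA hδ hδ' hT hR hTr hRr x y
    have hX3 := rpow_le_cube hp' hX1
    have hXp := Real.rpow_nonneg (zero_le_one.trans hX1) (p - 2)
    have coeff : ∀ {g : ℂ → ℂ}, Continuous g → (∀ z z', ‖z‖ ≤ X → ‖z'‖ ≤ X →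
        ‖g z - g z'‖ ≤ 12 * X ^ (p - 2) * ‖z - z'‖) →
        ‖segAvg g (u y) (v y) - segAvg g (u x) (v x)‖ ≤
          192 * C * A₀ ^ 4 * Λ ^ 4 * γ * growth r x ^ 4 * s ^ 5 := fun hgc hgl => by
      refine (norm_segAvg_sub_le hgc (by positivity) hgl (bY hu) (bY hv) (bx hu) (bx hv)).trans ?_
      calc 12 * X ^ (p - 2) * (‖u y - u x‖ + ‖v y - v x‖)
          ≤ 12 * X ^ 3 * (8 * C * A₀ * Λ * γ * growth r x * s ^ 2 +
            8 * C * A₀ * Λ * γ * growth r x * s ^ 2) := by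
            gcongr
            · exact dd hu
            · exact dd hv
        _ = _ := by rw [hX]; ring
    have ca := coeff (continuous_nonlinD hp) fun z z' hz hz' => norm_nonlinD_sub_le hp hp' hz hz'
    have cb := coeff (continuous_nonlinDbar hp) fun z z' hz hz' =>
      norm_nonlinDbar_sub_le hp hp' hz hz'
    have hhy : ‖h y‖ ≤ 20 * C * A₀ * Λ * γ' * (growth r x * s) := by
      have e2 : h y = (u y - PLow ρ (2 * r) u y) - (v y - PLow ρ (2 * r) v y) := by
        have : PLow ρ (2 * r) w y = PLow ρ (2 * r) u y - PLow ρ (2 * r) v y :=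
          (hC _ hr2).1.conv_sub hr2 hcu hcv hDu hDv y
        rw [hh, PHigh, this, hw]
        ring
      rw [e2]
      refine (norm_sub_le _ _).trans ((add_le_add
        (hu.norm_remainder_le hρ hC1 (fun N hN => (hC N hN).1) hA hδ hδ' hT hR hTr hRr y)
        (hv.norm_remainder_le hρ hC1 (fun N hN => (hC N hN).1) hA hδ hδ' hT hR hTr hRr y)).trans ?_)
      calc _ = 20 * C * A₀ * Λ * γ' * growth r y := by ring
        _ ≤ _ := by gcongr
    refine (norm_add_le _ _).trans ?_
    rw [norm_mul, norm_mul, RCLike.norm_conj]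
    calc ‖a y - a x‖ * ‖h y‖ + ‖b y - b x‖ * ‖h y‖
        ≤ (192 * C * A₀ ^ 4 * Λ ^ 4 * γ * growth r x ^ 4 * s ^ 5) *
            (20 * C * A₀ * Λ * γ' * (growth r x * s)) +
          (192 * C * A₀ ^ 4 * Λ ^ 4 * γ * growth r x ^ 4 * s ^ 5) *
            (20 * C * A₀ * Λ * γ' * (growth r x * s)) := by gcongr
      _ = _ := by ring
  · have : 0 ≤ C ^ 3 * A₀ ^ 5 * Λ ^ 5 * growth r x ^ 5 * (γ * γ') := by positivity
    calc _ = 7680 * Real.pi * (C ^ 3 * A₀ ^ 5 * Λ ^ 5 * growth r x ^ 5 * (γ * γ')) := by ring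
      _ ≤ 40000 * (C ^ 3 * A₀ ^ 5 * Λ ^ 5 * growth r x ^ 5 * (γ * γ')) := by
        gcongr
        linarith [Real.pi_lt_four]
      _ = _ := by ring

end

end GibbsNLS

/-! ### The polynomially weighted mass and the nonlinear estimate in weighted `L²`. -/

namespace GibbsNLS

/-- The localized mass with a polynomial weight. -/
noncomputable def polyMass (ρ : ℝ → ℝ) (r : ℝ) (f : ℝ → ℂ) : ℝ :=
  ∫ x : ℝ, ‖PLow ρ r f x‖ ^ 2 * polyWeight r x

lemma polyMass_nonneg (ρ : ℝ → ℝ) (r : ℝ) (f : ℝ → ℂ) : 0 ≤ polyMass ρ r f :=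
  integral_nonneg fun x => mul_nonneg (sq_nonneg _) (polyWeight_pos r x).le

lemma integrable_sq_mul_polyWeight {f : ℝ → ℂ} (hf : Continuous f) {D : ℝ} (hD : ∀ y, ‖f y‖ ≤ D)
    {r : ℝ} (hr : 0 < r) : Integrable fun x => ‖f x‖ ^ 2 * polyWeight r x :=
  (integrable_polyWeight hr).bdd_mul (c := D ^ 2) (by fun_prop) (.of_forall fun y => by
    rw [norm_pow, norm_norm]
    gcongr
    exact hD y)

lemma one_add_log_le {r : ℝ} (hr : 10 ≤ r) : 1 + Real.log (4 * r) ≤ 3 * Real.log r := by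
  have h : Real.log (Real.exp 1 * (4 * r)) ≤ Real.log (r ^ 3) := by
    refine Real.log_le_log (by positivity) ?_
    have := Real.exp_one_lt_d9
    calc Real.exp 1 * (4 * r) ≤ 3 * (4 * r) := by gcongr; linarith
      _ ≤ r ^ 2 * r := by nlinarith
      _ = r ^ 3 := by ring
  rw [Real.log_mul (Real.exp_pos 1).ne' (by positivity), Real.log_exp, Real.log_pow] at h
  exact_mod_cast h

/-- Ten logarithms, each at most a multiple of `r^(1/400)`, cost the power `1/40 = 5/8 - 3/5`. -/
lemma log_pow_mul_rpow_le {r : ℝ} (hr : 10 ≤ r) {s : ℝ} (hs : s ≤ -(5 / 8)) :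
    (1 + Real.log (4 * r)) ^ 10 * r ^ s ≤ 1200 ^ 10 * r ^ (-(3 / 5) : ℝ) := by
  have hr0 : 0 < r := by linarith
  have h1 := Real.log_le_rpow_div hr0.le (ε := 1 / 400) (by norm_num)
  have h2 : 1 + Real.log (4 * r) ≤ 1200 * r ^ (1 / 400 : ℝ) := by
    refine (one_add_log_le hr).trans ?_
    linarith
  have h3 := pow_le_pow_left₀ (zero_le_one.trans (one_add_log_pos hr)) h2 10
  have h4 : (r ^ (1 / 400 : ℝ)) ^ 10 = r ^ (1 / 40 : ℝ) := by
    rw [← Real.rpow_natCast, ← Real.rpow_mul hr0.le]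
    norm_num
  calc (1 + Real.log (4 * r)) ^ 10 * r ^ s
      ≤ (1200 * r ^ (1 / 400 : ℝ)) ^ 10 * r ^ (-(5 / 8) : ℝ) := by
        gcongr
        linarith
    _ = 1200 ^ 10 * (r ^ (1 / 40 : ℝ) * r ^ (-(5 / 8) : ℝ)) := by rw [mul_pow, h4]; ring
    _ = _ := by rw [← Real.rpow_add hr0]; norm_num

section

variable {ρ : ℝ → ℝ} {p A₀ δ T R : ℝ} {u v : ℝ → ℂ}

/-- The condition `2(p-1) ≤ p+3` is `p ≤ 5`. It limits the coefficients to one power of the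
logarithm, so that Gronwall's factor is a power of the scale. -/
lemma SliceBounds.rpow_le {X : ℝ} (hp : 3 ≤ p) (hp' : p ≤ 5) (hA : 1 ≤ A₀) (hX : 1 ≤ X) :
    (A₀ * X ^ (2 / (p + 3))) ^ (p - 1) ≤ A₀ ^ 4 * X := by
  rw [Real.mul_rpow (by linarith) (by positivity), ← Real.rpow_mul (by linarith)]
  have h1 : A₀ ^ (p - 1) ≤ A₀ ^ 4 := by
    rw [← Real.rpow_natCast]
    exact Real.rpow_le_rpow_of_exponent_le hA (by push_cast; linarith)
  have h2 : X ^ (2 / (p + 3) * (p - 1)) ≤ X := by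
    conv_rhs => rw [← Real.rpow_one X]
    refine Real.rpow_le_rpow_of_exponent_le hX ?_
    rw [div_mul_eq_mul_div, div_le_one (by linarith)]
    linarith
  gcongr

lemma norm_nonlinMain_le (hu : SliceBounds ρ p A₀ δ T R u) (hv : SliceBounds ρ p A₀ δ T R v)
    (hp : 3 ≤ p) (hp' : p ≤ 5) (hA : 1 ≤ A₀) (hT : 1 ≤ T) (hR : 10 ≤ R) (r y : ℝ) :
    ‖nonlinMain ρ p r u v y‖ ≤
      6 * A₀ ^ 4 * logWeight T R y * ‖PLow ρ (2 * r) (fun z => u z - v z) y‖ := by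
  have hl := one_le_logWeight hT hR y
  have hX := SliceBounds.rpow_le hp hp' hA hl
  have h1 := norm_segAvg_le (g := nonlinD p) (fun z hz => norm_nonlinD_le hp hp' hz)
    (hu.pointwise y) (hv.pointwise y)
  have h2 := norm_segAvg_le (g := nonlinDbar p) (fun z hz => norm_nonlinDbar_le hp hp' hz)
    (hu.pointwise y) (hv.pointwise y)
  refine (norm_add_le _ _).trans ?_
  rw [norm_mul, norm_mul, RCLike.norm_conj, ← add_mul]
  gcongr
  linarith

set_option maxHeartbeats 1000000 in
/-- The weighted `L²`-estimate for the low-frequency part of the nonlinearity. -/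
lemma exists_integral_PLow_nonlin_le (hρ : IsCutoff ρ) (hp : 3 ≤ p) (hp' : p ≤ 5) (hA : 1 ≤ A₀)
    (hδ : 0 < δ) (hδ' : δ ≤ 1 / 100) :
    ∃ K : ℝ, 1 ≤ K ∧ ∀ (T R r : ℝ) (u v : ℝ → ℂ), 1 ≤ T → 10 ≤ R → T ≤ r → R ≤ r →
      SliceBounds ρ p A₀ δ T R u → SliceBounds ρ p A₀ δ T R v →
      ∫ x, ‖PLow ρ r (fun y => nonlin p (u y) - nonlin p (v y)) x‖ ^ 2 * polyWeight r x ≤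
        K * (Real.log r ^ 2 * polyMass ρ (2 * r) (fun z => u z - v z) + r ^ (-(3 / 5) : ℝ)) := by
  obtain ⟨C, hC1, hC⟩ := hρ.exists_isMollifier
  set K₁ : ℝ := 2 * (4096 * C ^ 2 * (36 * A₀ ^ 8 * 16)) with hK₁
  set K₂ : ℝ := 2 * (4096 * C ^ 2 * (36 * A₀ ^ 8 * (64 * C ^ 2 * A₀ ^ 2 * 512))) * 1200 ^ 10 with hK₂
  set K₃ : ℝ := 2 * ((40000 * C ^ 3 * A₀ ^ 5) ^ 2 * 512) * 1200 ^ 10 with hK₃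
  have hK₂0 : 0 ≤ K₂ := by positivity
  have hK₃0 : 0 ≤ K₃ := by positivity
  have hK₁1 : 1 ≤ K₁ := by
    have : 1 ≤ C ^ 2 * A₀ ^ 8 := one_le_mul_of_one_le_of_one_le (one_le_pow₀ hC1) (one_le_pow₀ hA)
    rw [hK₁]
    linarith
  refine ⟨K₁ + K₂ + K₃, by linarith, fun T R r u v hT hR hTr hRr hu hv => ?_⟩
  have hr : 10 ≤ r := by linarith
  have hr0 : 0 < r := by linarith
  have hr2 : 0 < 2 * r := by linarith
  obtain ⟨Du, hDu⟩ := hu.bounded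
  obtain ⟨Dv, hDv⟩ := hv.bounded
  have hcu := hu.continuous
  have hcv := hv.continuous
  set w : ℝ → ℂ := fun z => u z - v z with hw
  have hcw : Continuous w := hcu.sub hcv
  have hDw : ∀ y, ‖w y‖ ≤ Du + Dv := fun y =>
    (norm_sub_le _ _).trans (add_le_add (hDu y) (hDv y))
  set w2 := PLow ρ (2 * r) w with hw2
  have hcw2 : Continuous w2 := (hC _ hr2).1.continuous_conv hr2 hcw hDw
  have hDw2 : ∀ y, ‖w2 y‖ ≤ (Du + Dv) * C * Real.pi := fun y =>
    (hC _ hr2).1.norm_conv_le_of_bounded hr2 y hcw.aestronglyMeasurable hDw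
  set D2 := (Du + Dv) * C * Real.pi
  set Λ := 1 + Real.log (4 * r) with hΛ
  have hΛ1 : 1 ≤ Λ := one_add_log_pos hr
  have hlog : 0 ≤ Real.log r := Real.log_nonneg (by linarith)
  set m := nonlinMain ρ p r u v with hm
  obtain ⟨A, hBA⟩ := exists_bound_segAvg (continuous_nonlinD hp) hu.bounded hv.bounded
  obtain ⟨B, hBB⟩ := exists_bound_segAvg (continuous_nonlinDbar hp) hu.bounded hv.bounded
  have hcm : Continuous m := ((continuous_segAvg (continuous_nonlinD hp) hcu hcv).mul hcw2).add
    ((continuous_segAvg (continuous_nonlinDbar hp) hcu hcv).mul (Complex.continuous_conj.comp hcw2))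
  have hDm : ∀ y, ‖m y‖ ≤ A * D2 + B * D2 := fun y => by
    refine (norm_add_le _ _).trans ?_
    rw [norm_mul, norm_mul, RCLike.norm_conj]
    exact add_le_add
      (mul_le_mul (hBA y) (hDw2 y) (norm_nonneg _) ((norm_nonneg _).trans (hBA 0)))
      (mul_le_mul (hBB y) (hDw2 y) (norm_nonneg _) ((norm_nonneg _).trans (hBB 0)))
  have hw2g : ∀ y, ‖w2 y‖ ≤ 8 * C * A₀ * Λ * growth r y := fun y => by
    have hwg : ∀ y, ‖w y‖ ≤ 2 * A₀ * Λ * growth r y := fun y => by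
      refine (norm_sub_le _ _).trans ?_
      have h1 := hu.norm_le hp hA hT hR (r := r) (by linarith) hTr hRr le_rfl y
      have h2 := hv.norm_le hp hA hT hR (r := r) (by linarith) hTr hRr le_rfl y
      linarith
    refine ((hC _ hr2).1.norm_conv_le_growth hr2 hr0 (by nlinarith) hcw.aestronglyMeasurable
      (by positivity) hwg y).trans (le_of_eq ?_)
    ring
  -- the main term
  have hmain : ∫ x, ‖m x‖ ^ 2 * polyWeight r x ≤ 36 * A₀ ^ 8 * (16 * Real.log r ^ 2 *
      polyMass ρ (2 * r) w + 64 * C ^ 2 * A₀ ^ 2 * Λ ^ 4 * (r ^ 8)⁻¹ * (512 * r)) := by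
    have hpt : ∀ x, ‖m x‖ ^ 2 * polyWeight r x ≤ 36 * A₀ ^ 8 * (16 * Real.log r ^ 2 *
        (‖w2 x‖ ^ 2 * polyWeight (2 * r) x) + 64 * C ^ 2 * A₀ ^ 2 * Λ ^ 4 * (r ^ 8)⁻¹ *
          (growth r x ^ 8 * polyWeight r x)) := fun x => by
      have hωp := (polyWeight_pos r x).le
      have hωm := polyWeight_mono hr0 (by linarith : r ≤ 2 * r) x
      have hl := logWeight_sq_le hT hR hTr hRr x
      have hg := one_le_growth hr0 x
      have h1 := norm_nonlinMain_le hu hv hp hp' hA hT hR r x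
      have hl1 := one_le_logWeight hT hR x
      calc ‖m x‖ ^ 2 * polyWeight r x
          ≤ (6 * A₀ ^ 4 * logWeight T R x * ‖w2 x‖) ^ 2 * polyWeight r x := by gcongr
        _ = 36 * A₀ ^ 8 * (logWeight T R x ^ 2 * (‖w2 x‖ ^ 2 * polyWeight r x)) := by ring
        _ ≤ 36 * A₀ ^ 8 * ((16 * Real.log r ^ 2 + Λ ^ 2 * growth r x ^ 6 * (r ^ 8)⁻¹) *
            (‖w2 x‖ ^ 2 * polyWeight r x)) := by gcongr
        _ = 36 * A₀ ^ 8 * (16 * Real.log r ^ 2 * (‖w2 x‖ ^ 2 * polyWeight r x) +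
            Λ ^ 2 * growth r x ^ 6 * (r ^ 8)⁻¹ * (‖w2 x‖ ^ 2 * polyWeight r x)) := by ring
        _ ≤ 36 * A₀ ^ 8 * (16 * Real.log r ^ 2 * (‖w2 x‖ ^ 2 * polyWeight (2 * r) x) +
            Λ ^ 2 * growth r x ^ 6 * (r ^ 8)⁻¹ *
              ((8 * C * A₀ * Λ * growth r x) ^ 2 * polyWeight r x)) := by
          gcongr
          exact hw2g x
        _ = _ := by ring
    have i1 := integrable_sq_mul_polyWeight hcw2 hDw2 hr2
    have i2 := integrable_growth_pow_mul_polyWeight hr0 (k := 8) (by norm_num)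
    calc ∫ x, ‖m x‖ ^ 2 * polyWeight r x
        ≤ ∫ x, 36 * A₀ ^ 8 * (16 * Real.log r ^ 2 *
          (‖w2 x‖ ^ 2 * polyWeight (2 * r) x) + 64 * C ^ 2 * A₀ ^ 2 * Λ ^ 4 * (r ^ 8)⁻¹ *
          (growth r x ^ 8 * polyWeight r x)) :=
          integral_mono (integrable_sq_mul_polyWeight hcm hDm hr0)
            (((i1.const_mul _).add (i2.const_mul _)).const_mul _) hpt
      _ = 36 * A₀ ^ 8 * (16 * Real.log r ^ 2 * polyMass ρ (2 * r) w +
          64 * C ^ 2 * A₀ ^ 2 * Λ ^ 4 * (r ^ 8)⁻¹ * ∫ x, growth r x ^ 8 * polyWeight r x) := by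
          rw [integral_const_mul, integral_add (i1.const_mul _) (i2.const_mul _),
            integral_const_mul, integral_const_mul]
          rfl
      _ ≤ _ := by
          gcongr
          exact integral_growth_pow_mul_polyWeight_le hr0 (by norm_num)
  have hschur := (hC r hr0).1.integral_norm_sq_conv_le (by linarith) hr0 hr0 (by nlinarith) hcm hDm
  -- the error term
  set E : ℝ := 40000 * C ^ 3 * A₀ ^ 5 * Λ ^ 5 * r ^ (-(5 / 6 : ℝ) + 2 * δ) with hE
  set g : ℝ → ℂ := fun y => nonlin p (u y) - nonlin p (v y) with hgdef
  have herr : ∀ x, ‖PLow ρ r g x - PLow ρ r m x‖ ≤ E * growth r x ^ 5 := fun x =>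
    norm_PLow_nonlin_sub_main_le hu hv hρ hC1 (fun N hN => ⟨(hC N hN).1, (hC N hN).2.1⟩) hp hp' hA
      hδ hδ' hT hR hTr hRr x
  have hcPm : Continuous (PLow ρ r m) := (hC r hr0).1.continuous_conv hr0 hcm hDm
  have hDPm : ∀ y, ‖PLow ρ r m y‖ ≤ (A * D2 + B * D2) * C * Real.pi := fun y =>
    (hC r hr0).1.norm_conv_le_of_bounded hr0 y hcm.aestronglyMeasurable hDm
  have i3 := integrable_sq_mul_polyWeight hcPm hDPm hr0
  have i4 := integrable_growth_pow_mul_polyWeight hr0 (k := 10) (by norm_num)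
  have htot : ∫ x, ‖PLow ρ r g x‖ ^ 2 * polyWeight r x ≤
      2 * ∫ x, ‖PLow ρ r m x‖ ^ 2 * polyWeight r x + E ^ 2 * (growth r x ^ 10 * polyWeight r x) := by
    rw [← integral_const_mul]
    refine integral_mono_of_nonneg (.of_forall fun x =>
      mul_nonneg (sq_nonneg _) (polyWeight_pos r x).le) ((i3.add (i4.const_mul _)).const_mul 2)
      (.of_forall fun x => ?_)
    have hωp := (polyWeight_pos r x).le
    have h1 : ‖PLow ρ r g x‖ ≤ ‖PLow ρ r m x‖ + E * growth r x ^ 5 := by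
      have := norm_sub_norm_le (PLow ρ r g x) (PLow ρ r m x)
      linarith [herr x]
    have h2 : ‖PLow ρ r g x‖ ^ 2 ≤ 2 * (‖PLow ρ r m x‖ ^ 2 + E ^ 2 * growth r x ^ 10) := by
      have h3 := pow_le_pow_left₀ (norm_nonneg _) h1 2
      have h4 : (E * growth r x ^ 5) ^ 2 = E ^ 2 * growth r x ^ 10 := by ring
      nlinarith [sq_nonneg (‖PLow ρ r m x‖ - E * growth r x ^ 5)]
    refine (mul_le_mul_of_nonneg_right h2 hωp).trans (le_of_eq ?_)
    simp only
    ring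
  rw [integral_add i3 (i4.const_mul _), integral_const_mul] at htot
  have hgint := integral_growth_pow_mul_polyWeight_le hr0 (k := 10) (by norm_num)
  -- collecting powers of `r`
  have hpow : Λ ^ 10 * r ^ (-(2 / 3 : ℝ) + 4 * δ) ≤ 1200 ^ 10 * r ^ (-(3 / 5) : ℝ) :=
    log_pow_mul_rpow_le hr (by linarith)
  have hp2 : Λ ^ 4 * (r ^ 8)⁻¹ * r ≤ 1200 ^ 10 * r ^ (-(3 / 5) : ℝ) := by
    have e : (r ^ 8)⁻¹ * r = r ^ (-7 : ℝ) := by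
      rw [show (-7 : ℝ) = -((7 : ℕ) : ℝ) by norm_num, Real.rpow_neg hr0.le, Real.rpow_natCast]
      field_simp
    rw [mul_assoc, e]
    exact (mul_le_mul_of_nonneg_right (pow_le_pow_right₀ hΛ1 (by norm_num))
      (Real.rpow_nonneg hr0.le _)).trans (log_pow_mul_rpow_le hr (s := -7) (by norm_num))
  have hp3 : E ^ 2 * r = (40000 * C ^ 3 * A₀ ^ 5) ^ 2 * (Λ ^ 10 * r ^ (-(2 / 3 : ℝ) + 4 * δ)) := by
    have e : (r ^ (-(5 / 6 : ℝ) + 2 * δ)) ^ 2 * r = r ^ (-(2 / 3 : ℝ) + 4 * δ) := by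
      rw [← Real.rpow_natCast, ← Real.rpow_mul hr0.le]
      conv_lhs => rw [← Real.rpow_one r, ← Real.rpow_mul hr0.le, one_mul, ← Real.rpow_add hr0]
      congr 1
      push_cast
      ring
    rw [← e, hE]
    ring
  set q := polyMass ρ (2 * r) w
  have hq : 0 ≤ q := polyMass_nonneg _ _ _
  set ε := r ^ (-(3 / 5) : ℝ)
  have hε : 0 ≤ ε := Real.rpow_nonneg hr0.le _
  have t1 : ∫ x, ‖PLow ρ r m x‖ ^ 2 * polyWeight r x ≤ 4096 * C ^ 2 * (36 * A₀ ^ 8 *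
      (16 * Real.log r ^ 2 * q + 64 * C ^ 2 * A₀ ^ 2 * 512 * (1200 ^ 10 * ε))) := by
    have t0 : 64 * C ^ 2 * A₀ ^ 2 * Λ ^ 4 * (r ^ 8)⁻¹ * (512 * r) ≤
        64 * C ^ 2 * A₀ ^ 2 * 512 * (1200 ^ 10 * ε) := by
      calc 64 * C ^ 2 * A₀ ^ 2 * Λ ^ 4 * (r ^ 8)⁻¹ * (512 * r)
          = 64 * C ^ 2 * A₀ ^ 2 * 512 * (Λ ^ 4 * (r ^ 8)⁻¹ * r) := by ring
        _ ≤ _ := mul_le_mul_of_nonneg_left hp2 (by positivity)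
    exact hschur.trans (mul_le_mul_of_nonneg_left
      (hmain.trans (mul_le_mul_of_nonneg_left (by linarith) (by positivity))) (by positivity))
  have t2 : E ^ 2 * ∫ x, growth r x ^ 10 * polyWeight r x ≤
      (40000 * C ^ 3 * A₀ ^ 5) ^ 2 * 512 * (1200 ^ 10 * ε) := by
    calc E ^ 2 * ∫ x, growth r x ^ 10 * polyWeight r x ≤ E ^ 2 * (512 * r) := by gcongr
      _ = 512 * (E ^ 2 * r) := by ring
      _ = 512 * ((40000 * C ^ 3 * A₀ ^ 5) ^ 2 * (Λ ^ 10 * r ^ (-(2 / 3 : ℝ) + 4 * δ))) := by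
        rw [hp3]
      _ ≤ 512 * ((40000 * C ^ 3 * A₀ ^ 5) ^ 2 * (1200 ^ 10 * ε)) := by gcongr
      _ = _ := by ring
  have hL : 0 ≤ Real.log r ^ 2 * q := by positivity
  calc _ ≤ 2 * (4096 * C ^ 2 * (36 * A₀ ^ 8 *
      (16 * Real.log r ^ 2 * q + 64 * C ^ 2 * A₀ ^ 2 * 512 * (1200 ^ 10 * ε))) +
        (40000 * C ^ 3 * A₀ ^ 5) ^ 2 * 512 * (1200 ^ 10 * ε)) := by
        refine htot.trans ?_
        gcongr
    _ = K₁ * (Real.log r ^ 2 * q) + (K₂ + K₃) * ε := by rw [hK₁, hK₂, hK₃]; ring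
    _ ≤ _ := by nlinarith [mul_nonneg hK₂0 hL, mul_nonneg hK₃0 hL, mul_nonneg (zero_le_one.trans hK₁1) hε]

end

end GibbsNLS

namespace GibbsNLS

/-! ### The evolution of the localized mass -/

/-- Functions of time and space which are continuous and bounded locally uniformly in time. -/
structure IsTimeBounded (f : ℝ → ℝ → ℂ) : Prop where
  continuous : Continuous fun z : ℝ × ℝ => f z.1 z.2
  bounded : ∀ a : ℝ, ∃ D, ∀ t ∈ Icc (-a) a, ∀ x, ‖f t x‖ ≤ D

namespace IsTimeBounded

variable {f g : ℝ → ℝ → ℂ}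

lemma slice (hf : IsTimeBounded f) (t : ℝ) : Continuous (f t) :=
  hf.continuous.comp (by fun_prop : Continuous fun x : ℝ => (t, x))

lemma exists_bound (hf : IsTimeBounded f) (t : ℝ) : ∃ D, ∀ x, ‖f t x‖ ≤ D := by
  obtain ⟨D, hD⟩ := hf.bounded |t|
  exact ⟨D, hD t ⟨neg_abs_le t, le_abs_self t⟩⟩

lemma exists_bound_ball (hf : IsTimeBounded f) (t : ℝ) :
    ∃ D, ∀ s ∈ Metric.ball t 1, ∀ x, ‖f s x‖ ≤ D := by
  obtain ⟨D, hD⟩ := hf.bounded (|t| + 1)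
  refine ⟨D, fun s hs => hD s ?_⟩
  rw [Metric.mem_ball, Real.dist_eq] at hs
  have := abs_lt.1 hs
  constructor <;> linarith [neg_abs_le t, le_abs_self t]

lemma sub (hf : IsTimeBounded f) (hg : IsTimeBounded g) :
    IsTimeBounded fun t x => f t x - g t x where
  continuous := hf.continuous.sub hg.continuous
  bounded a := by
    obtain ⟨D, hD⟩ := hf.bounded a
    obtain ⟨D', hD'⟩ := hg.bounded a
    exact ⟨D + D', fun t ht x => (norm_sub_le _ _).trans (add_le_add (hD t ht x) (hD' t ht x))⟩

lemma comp (hf : IsTimeBounded f) {F : ℂ → ℂ} (hF : Continuous F) :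
    IsTimeBounded fun t x => F (f t x) where
  continuous := hF.comp hf.continuous
  bounded a := by
    obtain ⟨D, hD⟩ := hf.bounded a
    obtain ⟨B, hB⟩ := (isCompact_closedBall (0 : ℂ) D).exists_bound_of_continuousOn hF.continuousOn
    exact ⟨B, fun t ht x => hB _ (by simpa using hD t ht x)⟩

lemma continuous_integral (hf : IsTimeBounded f) {h : ℝ → ℂ} (hh : Integrable h) :
    Continuous fun t => ∫ x, f t x * h x := by
  rw [continuous_iff_continuousAt]
  intro t
  obtain ⟨D, hD⟩ := hf.exists_bound_ball t
  refine continuousAt_of_dominated (bound := fun x => D * ‖h x‖)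
    (.of_forall fun s => (hf.slice s).aestronglyMeasurable.mul hh.aestronglyMeasurable)
    ?_ (hh.norm.const_mul D) (.of_forall fun x => ?_)
  · filter_upwards [Metric.ball_mem_nhds t one_pos] with s hs
    refine .of_forall fun x => ?_
    rw [norm_mul]
    gcongr
    exact hD s hs x
  · exact ((hf.continuous.comp (by fun_prop : Continuous fun s : ℝ => (s, x))).mul
      continuous_const).continuousAt

lemma continuous_conv (hf : IsTimeBounded f) {C N : ℝ} {H : ℝ → ℂ} (hH : IsMollifier C N H)
    (hN : 0 < N) (x : ℝ) : Continuous fun t => conv H (f t) x := by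
  have := hf.continuous_integral ((hH.integrable hN).comp_sub_left x)
  simpa only [conv, mul_comm] using this

end IsTimeBounded

namespace IsGlobalSolution

variable {p L : ℝ} {φ : ℝ → ℂ} {u : ℝ → ℝ → ℂ}

/-- Periodicity enters only here, through compactness of one period. The bound depends on the
solution but is used only qualitatively, so no final constant depends on `L`. -/
lemma isTimeBounded (h : IsGlobalSolution p L φ u) (hL : 0 < L) : IsTimeBounded u where
  continuous := h.continuous
  bounded a := by
    obtain ⟨D, hD⟩ := (isCompact_Icc.prod isCompact_Icc :
      IsCompact (Icc (-a) a ×ˢ Icc 0 (2 * Real.pi * L))).exists_bound_of_continuousOn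
      h.continuous.continuousOn
    refine ⟨D, fun t ht x => ?_⟩
    have hper : Function.Periodic (u t) (2 * Real.pi * L) := h.periodic t
    obtain ⟨y, hy, e⟩ := hper.exists_mem_Ico₀ (by positivity) x
    rw [e]
    exact hD (t, y) ⟨ht, Ico_subset_Icc_self hy⟩

end IsGlobalSolution

/-- Derivatives of a smooth function multiplied by the cut-offs `ρ (· / (n + 1))`. -/
lemma exists_cutoff_bound {ρ : ℝ → ℝ} (hρ : IsCutoff ρ) : ∃ B : ℝ, 1 ≤ B ∧
    ∀ c : ℝ, 0 < c → c ≤ 1 → ∀ x, |ρ (c * x)| ≤ B ∧ |deriv (fun x => ρ (c * x)) x| ≤ B ∧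
      |deriv (deriv (fun x => ρ (c * x))) x| ≤ B := by
  have hd : ∀ j : ℕ, ∃ B, ∀ x, ‖iteratedDeriv j ρ x‖ ≤ B := fun j => by
    obtain ⟨B, hB⟩ := (hρ.hasCompactSupport.toSchwartzMap hρ.smooth).decay 0 j
    refine ⟨B, fun x => ?_⟩
    have := hB.2 x
    rwa [pow_zero, one_mul, norm_iteratedFDeriv_eq_norm_iteratedDeriv] at this
  obtain ⟨B₁, h₁⟩ := hd 1
  obtain ⟨B₂, h₂⟩ := hd 2
  have h10 := (norm_nonneg _).trans (h₁ 0)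
  have h20 := (norm_nonneg _).trans (h₂ 0)
  refine ⟨1 + B₁ + B₂, by linarith, fun c hc hc1 x => ?_⟩
  have e : ∀ j : ℕ, iteratedDeriv j (fun x => ρ (c * x)) x = c ^ j * iteratedDeriv j ρ (c * x) :=
    fun j => by rw [iteratedDeriv_comp_const_mul (hρ.smooth.of_le (by exact_mod_cast le_top))]
  have e1 := e 1
  have e2 := e 2
  rw [iteratedDeriv_one] at e1
  rw [iteratedDeriv_succ, iteratedDeriv_one] at e2
  rw [e1, e2]
  have hρx := hρ.mem_Icc (c * x)
  refine ⟨?_, ?_, ?_⟩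
  · rw [abs_of_nonneg hρx.1]
    linarith [hρx.2]
  · rw [abs_mul, abs_of_pos (by positivity)]
    have := h₁ (c * x)
    rw [Real.norm_eq_abs] at this
    have hc' : c ^ 1 ≤ 1 := by simpa using hc1
    nlinarith [abs_nonneg (iteratedDeriv 1 ρ (c * x))]
  · rw [abs_mul, abs_of_pos (by positivity)]
    have := h₂ (c * x)
    rw [Real.norm_eq_abs] at this
    have hc' : c ^ 2 ≤ 1 := pow_le_one₀ hc.le hc1
    nlinarith [abs_nonneg (iteratedDeriv 2 ρ (c * x))]

/-- The equation holds for all smooth test functions which are integrable together with their first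
two derivatives. -/
lemma IsGlobalSolution.equation_of_integrable {ρ : ℝ → ℝ} (hρ : IsCutoff ρ) {p L : ℝ} {φ : ℝ → ℂ}
    {u : ℝ → ℝ → ℂ} (h : IsGlobalSolution p L φ u) (hp : 3 ≤ p) (hL : 0 < L) {ψ : ℝ → ℂ}
    (hψ : ContDiff ℝ (⊤ : ℕ∞) ψ) (i0 : Integrable ψ) (i1 : Integrable (deriv ψ))
    (i2 : Integrable (deriv (deriv ψ))) (t : ℝ) :
    Complex.I * ((∫ x : ℝ, u t x * ψ x) - ∫ x : ℝ, u 0 x * ψ x)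
        + (∫ s in (0 : ℝ)..t, ∫ x : ℝ, u s x * deriv (deriv ψ) x)
      = ∫ s in (0 : ℝ)..t, ∫ x : ℝ, nonlin p (u s x) * ψ x := by
  have hu := h.isTimeBounded hL
  have hN := hu.comp (continuous_nonlin hp)
  obtain ⟨B, hB1, hB⟩ := exists_cutoff_bound hρ
  -- The frequency cut-off `ρ` is reused as a spatial cut-off at radius about `n + 1`. Near each
  -- fixed point the truncated test functions eventually coincide with `ψ`, and dominated
  -- convergence handles the integrals.
  set c : ℕ → ℝ := fun n => ((n : ℝ) + 1)⁻¹ with hc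
  have hc0 : ∀ n, 0 < c n := fun n => by positivity
  have hc1 : ∀ n, c n ≤ 1 := fun n => inv_le_one_of_one_le₀ (by simp)
  set χ : ℕ → ℝ → ℝ := fun n x => ρ (c n * x) with hχ
  have hχs : ∀ n, ContDiff ℝ (⊤ : ℕ∞) (χ n) := fun n => hρ.smooth.comp (contDiff_const.mul contDiff_id)
  set ψn : ℕ → ℝ → ℂ := fun n x => (χ n x : ℂ) * ψ x with hψn
  have hψns : ∀ n, ContDiff ℝ (⊤ : ℕ∞) (ψn n) := fun n =>
    (Complex.ofRealCLM.contDiff.comp (hχs n)).mul hψ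
  have hψnc : ∀ n, HasCompactSupport (ψn n) := fun n =>
    HasCompactSupport.mul_right ((hρ.hasCompactSupport_scaled (hc0 n).ne').comp_left
      (g := fun r : ℝ => (r : ℂ)) (by simp))
  have hev : ∀ x : ℝ, ∀ᶠ n in Filter.atTop, ψn n =ᶠ[nhds x] ψ := fun x => by
    obtain ⟨n₀, hn₀⟩ := exists_nat_gt |x|
    filter_upwards [Filter.eventually_ge_atTop n₀] with n hn
    have hx : |x| < (n : ℝ) + 1 := hn₀.trans_le (by
      have : (n₀ : ℝ) ≤ n := by exact_mod_cast hn
      linarith)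
    have hopen : {y : ℝ | |y| < (n : ℝ) + 1} ∈ nhds x :=
      (isOpen_lt continuous_abs continuous_const).mem_nhds hx
    filter_upwards [hopen] with y hy
    have : χ n y = 1 := by
      refine hρ.eq_one _ ?_
      have hy' : |c n * y| ≤ 1 := by
        rw [abs_mul, abs_of_pos (hc0 n), hc, inv_mul_le_iff₀ (by positivity)]
        simpa using (show |y| < (n : ℝ) + 1 from hy).le
      exact abs_le.1 hy'
    simp [hψn, this]
  have hl0 : ∀ x, Filter.Tendsto (fun n => ψn n x) Filter.atTop (nhds (ψ x)) := fun x =>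
    tendsto_const_nhds.congr' ((hev x).mono fun n hn => hn.eq_of_nhds.symm)
  have hl2 : ∀ x, Filter.Tendsto (fun n => deriv (deriv (ψn n)) x) Filter.atTop
      (nhds (deriv (deriv ψ) x)) := fun x =>
    tendsto_const_nhds.congr' ((hev x).mono fun n hn => hn.deriv.deriv.eq_of_nhds.symm)
  have hb0 : ∀ n x, ‖ψn n x‖ ≤ B * ‖ψ x‖ := fun n x => by
    rw [hψn, norm_mul, Complex.norm_real]
    gcongr
    exact (hB (c n) (hc0 n) (hc1 n) x).1
  have hb2 : ∀ n x, ‖deriv (deriv (ψn n)) x‖ ≤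
      B * ‖ψ x‖ + 2 * B * ‖deriv ψ x‖ + B * ‖deriv (deriv ψ) x‖ := fun n x => by
    have hdχ := (contDiff_infty_iff_deriv.1 (hχs n))
    have hdψ := (contDiff_infty_iff_deriv.1 hψ)
    have d1χ : ∀ y, HasDerivAt (fun y => (χ n y : ℂ)) ((deriv (χ n) y : ℝ) : ℂ) y := fun y =>
      (hdχ.1 y).hasDerivAt.ofReal_comp
    have d2χ : ∀ y, HasDerivAt (fun y => ((deriv (χ n) y : ℝ) : ℂ)) ((deriv (deriv (χ n)) y : ℝ) : ℂ) y :=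
      fun y => ((hdχ.2.differentiable (by simp)) y).hasDerivAt.ofReal_comp
    have d1ψ : ∀ y, HasDerivAt ψ (deriv ψ y) y := fun y => (hdψ.1 y).hasDerivAt
    have d2ψ : ∀ y, HasDerivAt (deriv ψ) (deriv (deriv ψ) y) y := fun y =>
      ((hdψ.2.differentiable (by simp)) y).hasDerivAt
    have e1 : deriv (ψn n) = fun y => ((deriv (χ n) y : ℝ) : ℂ) * ψ y + (χ n y : ℂ) * deriv ψ y :=
      funext fun y => ((d1χ y).mul (d1ψ y)).deriv
    have e2 := (((d2χ x).mul (d1ψ x)).add ((d1χ x).mul (d2ψ x))).deriv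
    rw [e1]
    have hBx := hB (c n) (hc0 n) (hc1 n) x
    refine (congrArg norm e2).trans_le ?_
    refine (norm_add_le _ _).trans ((add_le_add (norm_add_le _ _) (norm_add_le _ _)).trans ?_)
    simp only [norm_mul, Complex.norm_real, Real.norm_eq_abs]
    nlinarith [mul_le_mul_of_nonneg_right hBx.1 (norm_nonneg (deriv (deriv ψ) x)),
      mul_le_mul_of_nonneg_right hBx.2.1 (norm_nonneg (deriv ψ x)),
      mul_le_mul_of_nonneg_right hBx.2.2 (norm_nonneg (ψ x))]
  have ib0 : Integrable fun x => B * ‖ψ x‖ := i0.norm.const_mul B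
  have ib2 : Integrable fun x => B * ‖ψ x‖ + 2 * B * ‖deriv ψ x‖ + B * ‖deriv (deriv ψ) x‖ :=
    (ib0.add (i1.norm.const_mul _)).add (i2.norm.const_mul _)
  have hcont0 : ∀ n, Continuous (ψn n) := fun n => (hψns n).continuous
  have hcont2 : ∀ n, Continuous (deriv (deriv (ψn n))) := fun n =>
    ((contDiff_infty_iff_deriv.1 (contDiff_infty_iff_deriv.1 (hψns n)).2).2).continuous
  have spatial : ∀ {f : ℝ → ℝ → ℂ}, IsTimeBounded f → ∀ {Ψ : ℕ → ℝ → ℂ} {Ψ' : ℝ → ℂ} {b : ℝ → ℝ},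
      (∀ n, Continuous (Ψ n)) → (∀ n x, ‖Ψ n x‖ ≤ b x) → Integrable b →
      (∀ x, Filter.Tendsto (fun n => Ψ n x) Filter.atTop (nhds (Ψ' x))) → ∀ s,
      Filter.Tendsto (fun n => ∫ x, f s x * Ψ n x) Filter.atTop (nhds (∫ x, f s x * Ψ' x)) := by
    intro f hf Ψ Ψ' b hΨ hΨb hb hlim s
    obtain ⟨D, hD⟩ := hf.exists_bound s
    refine tendsto_integral_of_dominated_convergence (fun x => D * b x)
      (fun n => ((hf.slice s).mul (hΨ n)).aestronglyMeasurable) (hb.const_mul D)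
      (fun n => .of_forall fun x => ?_) (.of_forall fun x => (hlim x).const_mul _)
    rw [norm_mul]
    exact mul_le_mul (hD x) (hΨb n x) (norm_nonneg _) ((norm_nonneg _).trans (hD x))
  have temporal : ∀ {f : ℝ → ℝ → ℂ}, IsTimeBounded f → ∀ {Ψ : ℕ → ℝ → ℂ} {Ψ' : ℝ → ℂ} {b : ℝ → ℝ},
      (∀ n, Continuous (Ψ n)) → (∀ n x, ‖Ψ n x‖ ≤ b x) → Integrable b →
      (∀ x, Filter.Tendsto (fun n => Ψ n x) Filter.atTop (nhds (Ψ' x))) →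
      Filter.Tendsto (fun n => ∫ s in (0 : ℝ)..t, ∫ x, f s x * Ψ n x) Filter.atTop
        (nhds (∫ s in (0 : ℝ)..t, ∫ x, f s x * Ψ' x)) := by
    intro f hf Ψ Ψ' b hΨ hΨb hb hlim
    obtain ⟨D, hD⟩ := hf.bounded |t|
    have hint : ∀ n, Integrable (Ψ n) := fun n =>
      hb.mono' (hΨ n).aestronglyMeasurable (.of_forall (hΨb n))
    refine intervalIntegral.tendsto_integral_filter_of_dominated_convergence
      (fun _ => ∫ x, D * b x)
      (.of_forall fun n => (hf.continuous_integral (hint n)).aestronglyMeasurable)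
      (.of_forall fun n => .of_forall fun s hs => ?_) (by simp)
      (.of_forall fun s _ => spatial hf hΨ hΨb hb hlim s)
    refine norm_integral_le_of_norm_le (hb.const_mul D) (.of_forall fun x => ?_)
    have hst : s ∈ Icc (-|t|) |t| := by
      have h1 := uIoc_subset_uIcc hs
      have h2 : |s| ≤ |t| := by simpa using abs_sub_left_of_mem_uIcc h1
      exact abs_le.1 h2
    rw [norm_mul]
    exact mul_le_mul (hD s hst x) (hΨb n x) (norm_nonneg _) ((norm_nonneg _).trans (hD s hst x))
  have hlhs := (((spatial hu hcont0 hb0 ib0 hl0 t).sub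
    (spatial hu hcont0 hb0 ib0 hl0 0)).const_mul Complex.I).add
    (temporal hu hcont2 hb2 ib2 hl2)
  have hrhs := temporal hN hcont0 hb0 ib0 hl0
  refine tendsto_nhds_unique hlhs (hrhs.congr fun n => ?_)
  exact (h.equation (ψn n) (hψns n) (hψnc n) t).symm

/-- The time derivative of the low-frequency part of a solution. -/
lemma IsGlobalSolution.hasDerivAt_PLow {ρ : ℝ → ℝ} (hρ : IsCutoff ρ) {p L : ℝ} {φ : ℝ → ℂ}
    {u : ℝ → ℝ → ℂ} (h : IsGlobalSolution p L φ u) (hp : 3 ≤ p) (hL : 0 < L) {r : ℝ} (hr : 0 < r)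
    (x t : ℝ) :
    HasDerivAt (fun t => PLow ρ r (u t) x)
      (Complex.I * (conv (deriv (deriv (kernel ρ r))) (u t) x
        - PLow ρ r (fun y => nonlin p (u t y)) x)) t := by
  obtain ⟨C, -, hC⟩ := hρ.exists_isMollifier
  obtain ⟨m0, m1, m2⟩ := hC r hr
  have hu := h.isTimeBounded hL
  have hN := hu.comp (continuous_nonlin hp)
  -- Testing against the translated and reflected kernel turns the weak equation into an integrated
  -- equation for the low-frequency part at `x`. Its integrands are continuous in time, so it can be
  -- differentiated.
  set ψ : ℝ → ℂ := fun y => kernel ρ r (x - y) with hψ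
  have d1 : deriv ψ = fun y => -deriv (kernel ρ r) (x - y) := by
    exact funext fun y => deriv_comp_const_sub (f := kernel ρ r) x y
  have d2 : deriv (deriv ψ) = fun y => deriv (deriv (kernel ρ r)) (x - y) := by
    rw [d1]
    ext y
    rw [deriv.fun_neg, deriv_comp_const_sub (f := deriv (kernel ρ r)), neg_neg]
  have key := fun t => h.equation_of_integrable hρ hp hL
    (ψ := ψ) ((hρ.contDiff_kernel hr).comp (contDiff_const.sub contDiff_id))
    ((m0.integrable hr).comp_sub_left x)
    (by rw [d1]; exact ((m1.integrable hr).comp_sub_left x).neg)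
    (by rw [d2]; exact (m2.integrable hr).comp_sub_left x) t
  simp only [d2] at key
  have key' : ∀ t, PLow ρ r (u t) x = PLow ρ r (u 0) x +
      Complex.I * ((∫ s in (0 : ℝ)..t, conv (deriv (deriv (kernel ρ r))) (u s) x)
        - ∫ s in (0 : ℝ)..t, PLow ρ r (fun y => nonlin p (u s y)) x) := fun t => by
    have := key t
    simp only [PLow, conv, mul_comm (kernel ρ r _), mul_comm (deriv (deriv (kernel ρ r)) _)]
    linear_combination (-Complex.I) * this +
      ((∫ x, u t x * ψ x) - ∫ x, u 0 x * ψ x) * Complex.I_mul_I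
  have hd := ((((hu.continuous_conv m2 hr x).integral_hasStrictDerivAt 0 t).hasDerivAt.sub
    ((hN.continuous_conv m0 hr x).integral_hasStrictDerivAt 0 t).hasDerivAt).const_mul
      Complex.I).const_add (PLow ρ r (u 0) x)
  exact hd.congr_of_eventuallyEq (.of_forall key')

end GibbsNLS

/-! ### Integration by parts against the weight and the differential inequality. -/

namespace GibbsNLS

/-- The derivative of the polynomial weight. -/
noncomputable def polyWeightDeriv (r x : ℝ) : ℝ :=
  -(16 * (x / r) / r * (1 + (x / r) ^ 2)⁻¹) * polyWeight r x

lemma hasDerivAt_polyWeight (r x : ℝ) :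
    HasDerivAt (polyWeight r) (polyWeightDeriv r x) x := by
  have h1 : HasDerivAt (fun x : ℝ => 1 + (x / r) ^ 2) (2 * (x / r) * (1 / r)) x := by
    simpa using (((hasDerivAt_id x).div_const r).pow 2).const_add 1
  have hp : 0 < 1 + (x / r) ^ 2 := by positivity
  refine ((h1.pow 8).inv (pow_pos hp 8).ne').congr_deriv ?_
  simp only [polyWeightDeriv, polyWeight, Pi.pow_apply]
  field_simp
  ring

lemma continuous_polyWeightDeriv (r : ℝ) : Continuous (polyWeightDeriv r) := by
  unfold polyWeightDeriv
  have := continuous_polyWeight r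
  have h2 : Continuous fun x : ℝ => (1 + (x / r) ^ 2)⁻¹ :=
    Continuous.inv₀ (by fun_prop) fun x => by positivity
  fun_prop

lemma abs_polyWeightDeriv_le {r : ℝ} (hr : 0 < r) (x : ℝ) :
    |polyWeightDeriv r x| ≤ 8 / r * polyWeight r x := by
  have hp : 0 < 1 + (x / r) ^ 2 := by positivity
  rw [polyWeightDeriv, abs_mul, abs_of_pos (polyWeight_pos r x), abs_neg]
  refine mul_le_mul_of_nonneg_right ?_ (polyWeight_pos r x).le
  rw [abs_mul, abs_div, abs_mul, abs_of_pos hr, abs_of_pos (inv_pos.2 hp), ← div_eq_mul_inv,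
    div_le_iff₀ hp, abs_of_pos (by norm_num : (0 : ℝ) < 16), ← sq_abs (x / r),
    div_mul_eq_mul_div, div_le_div_iff_of_pos_right hr]
  nlinarith [sq_nonneg (1 - |x / r|)]

lemma integrable_mul_polyWeight {f : ℝ → ℝ} (hf : Continuous f) {D : ℝ} (hD : ∀ y, ‖f y‖ ≤ D)
    {r : ℝ} (hr : 0 < r) : Integrable fun x => f x * polyWeight r x :=
  (integrable_polyWeight hr).bdd_mul (c := D) (by fun_prop) (.of_forall hD)

lemma norm_inner_I_mul_le (z w : ℂ) : ‖inner ℝ z (Complex.I * w)‖ ≤ ‖z‖ * ‖w‖ := by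
  refine (norm_inner_le_norm _ _).trans (le_of_eq ?_)
  rw [norm_mul, Complex.norm_I, one_mul]

/-- Integration by parts against the weight. -/
lemma integral_inner_second_deriv {W W' W'' : ℝ → ℂ} (h1 : ∀ x, HasDerivAt W (W' x) x)
    (h2 : ∀ x, HasDerivAt W' (W'' x) x) (hc : Continuous W'') {D : ℝ} (hD : ∀ x, ‖W x‖ ≤ D)
    (hD' : ∀ x, ‖W' x‖ ≤ D) (hD'' : ∀ x, ‖W'' x‖ ≤ D) {r : ℝ} (hr : 0 < r) :
    ∫ x, inner ℝ (W x) (Complex.I * W'' x) * polyWeight r x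
      = -∫ x, inner ℝ (W x) (Complex.I * W' x) * polyWeightDeriv r x := by
  have hcW : Continuous W := continuous_iff_continuousAt.2 fun x => (h1 x).continuousAt
  have hcW' : Continuous W' := continuous_iff_continuousAt.2 fun x => (h2 x).continuousAt
  have hD0 : 0 ≤ D := (norm_nonneg _).trans (hD 0)
  have b : ∀ {V : ℝ → ℂ}, (∀ x, ‖V x‖ ≤ D) → ∀ x, ‖inner ℝ (W x) (Complex.I * V x)‖ ≤ D * D :=
    fun hV x => (norm_inner_I_mul_le _ _).trans (mul_le_mul (hD x) (hV x) (norm_nonneg _) hD0)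
  have hder : ∀ x, HasDerivAt (fun x => inner ℝ (W x) (Complex.I * W' x) * polyWeight r x)
      (inner ℝ (W x) (Complex.I * W'' x) * polyWeight r x
        + inner ℝ (W x) (Complex.I * W' x) * polyWeightDeriv r x) x := fun x => by
    have e := ((h1 x).inner ℝ ((h2 x).const_mul Complex.I)).mul (hasDerivAt_polyWeight r x)
    -- Multiplication by `i` is a rotation by a right angle, so the term quadratic in the first
    -- derivative vanishes and only the derivative of the weight survives.
    have e0 : inner ℝ (W' x) (Complex.I * W' x) = 0 := by
      rw [Complex.inner]
      simp only [Complex.mul_re, Complex.conj_re, Complex.I_re, zero_mul, Complex.I_im, one_mul,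
        zero_sub, Complex.conj_im, Complex.mul_im, zero_add]
      ring
    refine e.congr_deriv ?_
    rw [e0, add_zero]
  have i0 : Integrable fun x => inner ℝ (W x) (Complex.I * W' x) * polyWeight r x :=
    integrable_mul_polyWeight (by fun_prop) (b hD') hr
  have i1 : Integrable fun x => inner ℝ (W x) (Complex.I * W'' x) * polyWeight r x :=
    integrable_mul_polyWeight (by fun_prop) (b hD'') hr
  have iω : Integrable (polyWeightDeriv r) :=
    ((integrable_polyWeight hr).const_mul (8 / r)).mono'
      (continuous_polyWeightDeriv r).aestronglyMeasurable
      (.of_forall fun x => abs_polyWeightDeriv_le hr x)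
  have i2 : Integrable fun x => inner ℝ (W x) (Complex.I * W' x) * polyWeightDeriv r x :=
    iω.bdd_mul (c := D * D) (Continuous.aestronglyMeasurable (by fun_prop)) (.of_forall (b hD'))
  have key := integral_eq_zero_of_hasDerivAt_of_integrable hder (i1.add i2) i0
  rw [integral_add i1 i2] at key
  linarith

section

variable {ρ : ℝ → ℝ} {p L L' : ℝ} {φ φ' : ℝ → ℂ} {u v : ℝ → ℝ → ℂ}

/-- The time derivative of the low-frequency part of the difference of two solutions. -/
noncomputable def lowVelocity (ρ : ℝ → ℝ) (p r : ℝ) (u v : ℝ → ℝ → ℂ) (t x : ℝ) : ℂ :=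
  Complex.I * (conv (deriv (deriv (kernel ρ r))) (fun y => u t y - v t y) x
    - PLow ρ r (fun y => nonlin p (u t y) - nonlin p (v t y)) x)

lemma hasDerivAt_PLow_sub (hρ : IsCutoff ρ) (hu : IsGlobalSolution p L φ u)
    (hv : IsGlobalSolution p L' φ' v) (hp : 3 ≤ p) (hL : 0 < L) (hL' : 0 < L') {r : ℝ}
    (hr : 0 < r) (x t : ℝ) :
    HasDerivAt (fun t => PLow ρ r (fun y => u t y - v t y) x) (lowVelocity ρ p r u v t x) t := by
  obtain ⟨C, -, hC⟩ := hρ.exists_isMollifier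
  obtain ⟨m0, -, m2⟩ := hC r hr
  have hub := hu.isTimeBounded hL
  have hvb := hv.isTimeBounded hL'
  have hsub : ∀ {H : ℝ → ℂ} {C' : ℝ}, IsMollifier C' r H → ∀ {f g : ℝ → ℝ → ℂ}, IsTimeBounded f →
      IsTimeBounded g → ∀ t, conv H (fun y => f t y - g t y) x = conv H (f t) x - conv H (g t) x :=
    fun hH f g hf hg t => by
      obtain ⟨D, hD⟩ := hf.exists_bound t
      obtain ⟨D', hD'⟩ := hg.exists_bound t
      exact hH.conv_sub hr (hf.slice t) (hg.slice t) hD hD' x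
  have h := (hu.hasDerivAt_PLow hρ hp hL hr x t).sub (hv.hasDerivAt_PLow hρ hp hL' hr x t)
  refine (h.congr_of_eventuallyEq (.of_forall fun s => hsub m0 hub hvb s)).congr_deriv ?_
  have e1 := hsub m2 hub hvb t
  have e2 := hsub m0 (hub.comp (continuous_nonlin hp)) (hvb.comp (continuous_nonlin hp)) t
  simp only [lowVelocity, PLow_eq_conv]
  rw [e1, e2]
  ring

/-- Bounds uniform over a unit ball of times, multiplied by the integrable weight, permit
differentiation under the integral. -/
lemma hasDerivAt_polyMass (hρ : IsCutoff ρ) (hu : IsGlobalSolution p L φ u)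
    (hv : IsGlobalSolution p L' φ' v) (hp : 3 ≤ p) (hL : 0 < L) (hL' : 0 < L') {r : ℝ}
    (hr : 0 < r) (t : ℝ) :
    HasDerivAt (fun t => polyMass ρ r (fun y => u t y - v t y))
      (∫ x, 2 * inner ℝ (PLow ρ r (fun y => u t y - v t y) x) (lowVelocity ρ p r u v t x)
        * polyWeight r x) t := by
  obtain ⟨C, -, hC⟩ := hρ.exists_isMollifier
  obtain ⟨m0, -, m2⟩ := hC r hr
  have hub := hu.isTimeBounded hL
  have hvb := hv.isTimeBounded hL'
  have hw := hub.sub hvb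
  have hg := (hub.comp (continuous_nonlin hp)).sub (hvb.comp (continuous_nonlin hp))
  obtain ⟨Dw, hDw⟩ := hw.exists_bound_ball t
  obtain ⟨Dg, hDg⟩ := hg.exists_bound_ball t
  have ht : t ∈ Metric.ball t 1 := Metric.mem_ball_self one_pos
  have hcW : ∀ s, Continuous (PLow ρ r (fun y => u s y - v s y)) := fun s => by
    obtain ⟨D, hD⟩ := hw.exists_bound s
    exact m0.continuous_conv hr (hw.slice s) hD
  have hcV : Continuous (lowVelocity ρ p r u v t) :=
    continuous_const.mul ((m2.continuous_conv hr (hw.slice t) (hDw t ht)).sub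
      (m0.continuous_conv hr (hg.slice t) (hDg t ht)))
  have hbW : ∀ s ∈ Metric.ball t 1, ∀ x, ‖PLow ρ r (fun y => u s y - v s y) x‖ ≤ Dw * C * Real.pi :=
    fun s hs x => m0.norm_conv_le_of_bounded hr x (hw.slice s).aestronglyMeasurable (hDw s hs)
  have hbV : ∀ s ∈ Metric.ball t 1, ∀ x, ‖lowVelocity ρ p r u v s x‖ ≤
      Dw * (C * r ^ 2) * Real.pi + Dg * C * Real.pi := fun s hs x => by
    rw [lowVelocity, norm_mul, Complex.norm_I, one_mul]
    exact (norm_sub_le _ _).trans (add_le_add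
      (m2.norm_conv_le_of_bounded hr x (hw.slice s).aestronglyMeasurable (hDw s hs))
      (m0.norm_conv_le_of_bounded hr x (hg.slice s).aestronglyMeasurable (hDg s hs)))
  refine (hasDerivAt_integral_of_dominated_loc_of_deriv_le (Metric.ball_mem_nhds t one_pos)
    (F := fun s x => ‖PLow ρ r (fun y => u s y - v s y) x‖ ^ 2 * polyWeight r x)
    (F' := fun s x => 2 * inner ℝ (PLow ρ r (fun y => u s y - v s y) x)
      (lowVelocity ρ p r u v s x) * polyWeight r x)
    (bound := fun x => 2 * ((Dw * C * Real.pi) *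
      (Dw * (C * r ^ 2) * Real.pi + Dg * C * Real.pi)) * polyWeight r x)
    (.of_forall fun s => ?_) (integrable_sq_mul_polyWeight (hcW t) (hbW t ht) hr) ?_
    (.of_forall fun x s hs => ?_) ((integrable_polyWeight hr).const_mul _)
    (.of_forall fun x s hs => ?_)).2
  · have := hcW s
    have := continuous_polyWeight r
    exact Continuous.aestronglyMeasurable (by fun_prop)
  · have := hcW t
    have := continuous_polyWeight r
    exact Continuous.aestronglyMeasurable (by fun_prop)
  · rw [norm_mul, norm_mul, Real.norm_of_nonneg (polyWeight_pos r x).le,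
      Real.norm_of_nonneg zero_le_two]
    have hω := (polyWeight_pos r x).le
    have := (norm_inner_le_norm (𝕜 := ℝ) (PLow ρ r (fun y => u s y - v s y) x)
      (lowVelocity ρ p r u v s x)).trans (mul_le_mul (hbW s hs x) (hbV s hs x) (norm_nonneg _)
        ((norm_nonneg _).trans (hbW s hs x)))
    gcongr
  · exact ((hasDerivAt_PLow_sub hρ hu hv hp hL hL' hr x s).norm_sq).mul_const _

/-- The differential inequality for the localized mass. -/
lemma exists_deriv_polyMass_le (hρ : IsCutoff ρ) (hp : 3 ≤ p) (hp' : p ≤ 5) {A₀ δ : ℝ}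
    (hA : 1 ≤ A₀) (hδ : 0 < δ) (hδ' : δ ≤ 1 / 100) :
    ∃ K : ℝ, 1 ≤ K ∧ ∀ (T R r L L' t : ℝ) (φ φ' : ℝ → ℂ) (u v : ℝ → ℝ → ℂ), 1 ≤ T → 10 ≤ R →
      T ≤ r → R ≤ r → 0 < L → 0 < L' → IsGlobalSolution p L φ u → IsGlobalSolution p L' φ' v →
      SliceBounds ρ p A₀ δ T R (u t) → SliceBounds ρ p A₀ δ T R (v t) →
      ∫ x, 2 * inner ℝ (PLow ρ r (fun y => u t y - v t y) x) (lowVelocity ρ p r u v t x)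
          * polyWeight r x ≤
        K * Real.log r * (polyMass ρ (2 * r) (fun y => u t y - v t y) + r ^ (-(3 / 5) : ℝ)) := by
  obtain ⟨C, hC1, hC⟩ := hρ.exists_isMollifier
  obtain ⟨K, hK1, hK⟩ := exists_integral_PLow_nonlin_le hρ hp hp' hA hδ hδ'
  refine ⟨17 * (4096 * C ^ 2) + K, by nlinarith [sq_nonneg C], ?_⟩
  intro T R r L L' t φ φ' u v hT hR hTr hRr hL hL' hu hv hus hvs
  have hr : 10 ≤ r := by linarith
  have hr0 : 0 < r := by linarith
  have hr2 : 0 < 2 * r := by linarith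
  have hlog : 1 ≤ Real.log r := by
    rw [Real.le_log_iff_exp_le hr0]
    linarith [Real.exp_one_lt_d9]
  set l := Real.log r with hl
  obtain ⟨m0, m1, m2⟩ := hC r hr0
  have hub := hu.isTimeBounded hL
  have hvb := hv.isTimeBounded hL'
  have hw := (hub.sub hvb).slice t
  obtain ⟨Dw, hDw⟩ := (hub.sub hvb).exists_bound t
  have hg := ((hub.comp (continuous_nonlin hp)).sub (hvb.comp (continuous_nonlin hp))).slice t
  obtain ⟨Dg, hDg⟩ :=
    ((hub.comp (continuous_nonlin hp)).sub (hvb.comp (continuous_nonlin hp))).exists_bound t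
  have hKt := hK T R r (u t) (v t) hT hR hTr hRr hus hvs
  simp only [lowVelocity]
  set w : ℝ → ℂ := fun y => u t y - v t y with hwdef
  set g : ℝ → ℂ := fun y => nonlin p (u t y) - nonlin p (v t y) with hgdef
  set W := PLow ρ r w with hW
  set W' := conv (deriv (kernel ρ r)) w with hW'
  set W'' := conv (deriv (deriv (kernel ρ r))) w with hW''
  set G := PLow ρ r g with hG
  set w2 := PLow ρ (2 * r) w with hw2
  have d1 : ∀ x, HasDerivAt W (W' x) x := m0.hasDerivAt_conv m1 hr0 (hρ.hasDerivAt_kernel hr0) hw hDw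
  have d2 : ∀ x, HasDerivAt W' (W'' x) x :=
    m1.hasDerivAt_conv m2 hr0 (hρ.hasDerivAt_deriv_kernel hr0) hw hDw
  have cW : Continuous W := m0.continuous_conv hr0 hw hDw
  have cW' : Continuous W' := m1.continuous_conv hr0 hw hDw
  have cW'' : Continuous W'' := m2.continuous_conv hr0 hw hDw
  have cG : Continuous G := m0.continuous_conv hr0 hg hDg
  have cw2 : Continuous w2 := (hC _ hr2).1.continuous_conv hr2 hw hDw
  have bW : ∀ x, ‖W x‖ ≤ Dw * C * Real.pi := fun x =>
    m0.norm_conv_le_of_bounded hr0 x hw.aestronglyMeasurable hDw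
  have bW' : ∀ x, ‖W' x‖ ≤ Dw * (C * r) * Real.pi := fun x =>
    m1.norm_conv_le_of_bounded hr0 x hw.aestronglyMeasurable hDw
  have bW'' : ∀ x, ‖W'' x‖ ≤ Dw * (C * r ^ 2) * Real.pi := fun x =>
    m2.norm_conv_le_of_bounded hr0 x hw.aestronglyMeasurable hDw
  have bG : ∀ x, ‖G x‖ ≤ Dg * C * Real.pi := fun x =>
    m0.norm_conv_le_of_bounded hr0 x hg.aestronglyMeasurable hDg
  have bw2 : ∀ x, ‖w2 x‖ ≤ Dw * C * Real.pi := fun x =>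
    (hC _ hr2).1.norm_conv_le_of_bounded hr2 x hw.aestronglyMeasurable hDw
  -- reproducing identities
  have eW : W = PLow ρ r w2 := (PLow_PLow hρ hρ hr0 (by linarith) hw hDw).symm
  -- Differentiating the identity for `W` gives the one for `W'`. Both are then controlled by the
  -- mass at scale `2r`, with `W'` costing a factor `r`.
  have eW' : W' = conv (deriv (kernel ρ r)) w2 := funext fun x => (d1 x).unique (by
    rw [eW]
    exact m0.hasDerivAt_conv m1 hr0 (hρ.hasDerivAt_kernel hr0) cw2 bw2 x)
  set q := polyMass ρ (2 * r) w with hq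
  have hw2q : ∫ x, ‖w2 x‖ ^ 2 * polyWeight r x ≤ q :=
    integral_mono (integrable_sq_mul_polyWeight cw2 bw2 hr0)
      (integrable_sq_mul_polyWeight cw2 bw2 hr2) fun x =>
        mul_le_mul_of_nonneg_left (polyWeight_mono hr0 (by linarith) x) (sq_nonneg _)
  have sW : ∫ x, ‖W x‖ ^ 2 * polyWeight r x ≤ 4096 * C ^ 2 * q := by
    rw [eW]
    exact (m0.integral_norm_sq_conv_le (by linarith) hr0 hr0 (by nlinarith) cw2 bw2).trans
      (mul_le_mul_of_nonneg_left hw2q (by positivity))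
  have sW' : ∫ x, ‖W' x‖ ^ 2 * polyWeight r x ≤ 4096 * (C * r) ^ 2 * q := by
    rw [eW']
    exact (m1.integral_norm_sq_conv_le (by positivity) hr0 hr0 (by nlinarith) cw2 bw2).trans
      (mul_le_mul_of_nonneg_left hw2q (by positivity))
  -- splitting the derivative
  set D := max (Dw * C * Real.pi) (max (Dw * (C * r) * Real.pi) (Dw * (C * r ^ 2) * Real.pi))
  have hparts := integral_inner_second_deriv d1 d2 cW'' (D := D)
    (fun x => (bW x).trans (le_max_left _ _))
    (fun x => (bW' x).trans ((le_max_left _ _).trans (le_max_right _ _)))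
    (fun x => (bW'' x).trans ((le_max_right _ _).trans (le_max_right _ _))) hr0
  have hIb : ∀ {V : ℝ → ℂ} {B : ℝ}, (∀ x, ‖V x‖ ≤ B) → ∀ x,
      ‖inner ℝ (W x) (Complex.I * V x)‖ ≤ Dw * C * Real.pi * B := fun hV x =>
    (norm_inner_I_mul_le _ _).trans (mul_le_mul (bW x) (hV x) (norm_nonneg _)
      ((norm_nonneg _).trans (bW x)))
  have i1 : Integrable fun x => inner ℝ (W x) (Complex.I * W'' x) * polyWeight r x :=
    integrable_mul_polyWeight (by fun_prop) (hIb bW'') hr0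
  have i2 : Integrable fun x => inner ℝ (W x) (Complex.I * G x) * polyWeight r x :=
    integrable_mul_polyWeight (by fun_prop) (hIb bG) hr0
  have iω : Integrable (polyWeightDeriv r) :=
    ((integrable_polyWeight hr0).const_mul (8 / r)).mono'
      (continuous_polyWeightDeriv r).aestronglyMeasurable
      (.of_forall fun x => abs_polyWeightDeriv_le hr0 x)
  have i3 : Integrable fun x => inner ℝ (W x) (Complex.I * W' x) * polyWeightDeriv r x :=
    iω.bdd_mul (c := Dw * C * Real.pi * (Dw * (C * r) * Real.pi))
      (Continuous.aestronglyMeasurable (by fun_prop)) (.of_forall (hIb bW'))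
  have iW := integrable_sq_mul_polyWeight cW bW hr0
  have iW' := integrable_sq_mul_polyWeight cW' bW' hr0
  have iG := integrable_sq_mul_polyWeight cG bG hr0
  have esplit : ∫ x, 2 * inner ℝ (W x) (Complex.I * (W'' x - G x)) * polyWeight r x =
      ∫ x, (-2) * (inner ℝ (W x) (Complex.I * W' x) * polyWeightDeriv r x) +
        (-2) * (inner ℝ (W x) (Complex.I * G x) * polyWeight r x) := by
    have e1 : ∀ x, 2 * inner ℝ (W x) (Complex.I * (W'' x - G x)) * polyWeight r x =
        2 * (inner ℝ (W x) (Complex.I * W'' x) * polyWeight r x) +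
          (-2) * (inner ℝ (W x) (Complex.I * G x) * polyWeight r x) := fun x => by
      rw [mul_sub, inner_sub_right]
      ring
    simp only [e1]
    rw [integral_add (i1.const_mul _) (i2.const_mul _), integral_add (i3.const_mul _)
      (i2.const_mul _), integral_const_mul, integral_const_mul, integral_const_mul, hparts]
    ring
  rw [esplit]
  -- Young's inequality with parameter `l = log r` balances the nonlinear term, whose squared norm
  -- carries `l²`, so that only one power of `l` multiplies the mass.
  have hpt : ∀ x, (-2) * (inner ℝ (W x) (Complex.I * W' x) * polyWeightDeriv r x) +
        (-2) * (inner ℝ (W x) (Complex.I * G x) * polyWeight r x) ≤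
      (8 + l) * (‖W x‖ ^ 2 * polyWeight r x) + 8 / r ^ 2 * (‖W' x‖ ^ 2 * polyWeight r x) +
        l⁻¹ * (‖G x‖ ^ 2 * polyWeight r x) := fun x => by
    have hω := (polyWeight_pos r x).le
    have a1 : (-2) * (inner ℝ (W x) (Complex.I * W' x) * polyWeightDeriv r x) ≤
        2 * (‖W x‖ * ‖W' x‖ * (8 / r * polyWeight r x)) := by
      have b1 := norm_inner_I_mul_le (W x) (W' x)
      have b2 := abs_polyWeightDeriv_le hr0 x
      have b3 : |inner ℝ (W x) (Complex.I * W' x) * polyWeightDeriv r x| ≤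
          ‖W x‖ * ‖W' x‖ * (8 / r * polyWeight r x) := by
        rw [abs_mul]
        exact mul_le_mul b1 b2 (abs_nonneg _) (by positivity)
      linarith [neg_abs_le (inner ℝ (W x) (Complex.I * W' x) * polyWeightDeriv r x)]
    have a2 : (-2) * (inner ℝ (W x) (Complex.I * G x) * polyWeight r x) ≤
        2 * (‖W x‖ * ‖G x‖ * polyWeight r x) := by
      have b1 := norm_inner_I_mul_le (W x) (G x)
      rw [Real.norm_eq_abs] at b1
      have b2 := (neg_abs_le (inner ℝ (W x) (Complex.I * G x)))
      nlinarith
    have a3 : 2 * (‖W x‖ * ‖W' x‖ * (8 / r)) ≤ 8 * ‖W x‖ ^ 2 + 8 / r ^ 2 * ‖W' x‖ ^ 2 := by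
      have : 8 * ‖W x‖ ^ 2 + 8 / r ^ 2 * ‖W' x‖ ^ 2 - 2 * (‖W x‖ * ‖W' x‖ * (8 / r)) =
          8 * (‖W x‖ - ‖W' x‖ / r) ^ 2 := by field_simp; ring
      nlinarith [sq_nonneg (‖W x‖ - ‖W' x‖ / r)]
    have a4 : 2 * (‖W x‖ * ‖G x‖) ≤ l * ‖W x‖ ^ 2 + l⁻¹ * ‖G x‖ ^ 2 := by
      have : l * ‖W x‖ ^ 2 + l⁻¹ * ‖G x‖ ^ 2 - 2 * (‖W x‖ * ‖G x‖) =
          l⁻¹ * (l * ‖W x‖ - ‖G x‖) ^ 2 := by field_simp; ring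
      have : 0 ≤ l⁻¹ * (l * ‖W x‖ - ‖G x‖) ^ 2 := by positivity
      linarith
    have a5 := mul_le_mul_of_nonneg_right a3 hω
    have a6 := mul_le_mul_of_nonneg_right a4 hω
    linarith
  have hε : 0 ≤ r ^ (-(3 / 5) : ℝ) := Real.rpow_nonneg hr0.le _
  have hq0 : 0 ≤ q := polyMass_nonneg _ _ _
  calc _ ≤ ∫ x, ((8 + l) * (‖W x‖ ^ 2 * polyWeight r x) +
          8 / r ^ 2 * (‖W' x‖ ^ 2 * polyWeight r x) + l⁻¹ * (‖G x‖ ^ 2 * polyWeight r x)) :=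
        integral_mono ((i3.const_mul _).add (i2.const_mul _))
          (((iW.const_mul _).add (iW'.const_mul _)).add (iG.const_mul _)) hpt
    _ = (8 + l) * (∫ x, ‖W x‖ ^ 2 * polyWeight r x) +
          8 / r ^ 2 * (∫ x, ‖W' x‖ ^ 2 * polyWeight r x) +
          l⁻¹ * (∫ x, ‖G x‖ ^ 2 * polyWeight r x) := by
        rw [integral_add (f := fun x => (8 + l) * (‖W x‖ ^ 2 * polyWeight r x) +
            8 / r ^ 2 * (‖W' x‖ ^ 2 * polyWeight r x))
            ((iW.const_mul _).add (iW'.const_mul _)) (iG.const_mul _),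
          integral_add (iW.const_mul _) (iW'.const_mul _), integral_const_mul, integral_const_mul,
          integral_const_mul]
    _ ≤ (8 + l) * (4096 * C ^ 2 * q) + 8 / r ^ 2 * (4096 * (C * r) ^ 2 * q) +
          l⁻¹ * (K * (l ^ 2 * q + r ^ (-(3 / 5) : ℝ))) := by gcongr
    _ = (16 + l) * (4096 * C ^ 2 * q) + K * (l * q + l⁻¹ * r ^ (-(3 / 5) : ℝ)) := by
        field_simp
        ring
    _ ≤ 17 * l * (4096 * C ^ 2 * q) + K * (l * q + l * r ^ (-(3 / 5) : ℝ)) := by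
        gcongr
        · linarith
        · exact (inv_le_one_of_one_le₀ hlog).trans hlog
    _ ≤ _ := by
        have : 0 ≤ C ^ 2 * l * r ^ (-(3 / 5) : ℝ) := by positivity
        nlinarith

end

end GibbsNLS

namespace GibbsNLS

/-! ### Comparison of localized masses -/

/-- The exponential series gives `e^b ≥ b^16 / 16!`, and `b^16` with `b = ⟨x/r⟩` is the reciprocal
of the polynomial weight. -/
lemma weight_le_polyWeight (r x : ℝ) : weight r x ≤ (Nat.factorial 16 : ℝ) * polyWeight r x := by
  have hb : bracket (x / r) ^ 2 = 1 + (x / r) ^ 2 := Real.sq_sqrt (by positivity)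
  have h0 : 0 ≤ bracket (x / r) := Real.sqrt_nonneg _
  have h := Real.pow_div_factorial_le_exp _ h0 16
  have e : bracket (x / r) ^ 16 = (1 + (x / r) ^ 2) ^ 8 := by rw [← hb]; ring
  rw [e, div_le_iff₀ (by positivity)] at h
  rw [weight, Real.exp_neg, polyWeight, ← div_eq_mul_inv, le_div_iff₀ (by positivity),
    inv_mul_le_iff₀ (Real.exp_pos _)]
  exact h

lemma mass_le_polyMass {ρ : ℝ → ℝ} (hρ : IsCutoff ρ) {f : ℝ → ℂ} (hf : Continuous f) {D : ℝ}
    (hD : ∀ y, ‖f y‖ ≤ D) {r : ℝ} (hr : 0 < r) :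
    mass ρ r f ≤ (Nat.factorial 16 : ℝ) * polyMass ρ r f := by
  obtain ⟨C, -, hC⟩ := hρ.exists_isMollifier
  rw [mass, polyMass, ← integral_const_mul]
  refine integral_mono_of_nonneg (.of_forall fun x => by unfold weight; positivity)
    ((integrable_sq_mul_polyWeight ((hC r hr).1.continuous_conv hr hf hD)
      (fun y => (hC r hr).1.norm_conv_le_of_bounded hr y hf.aestronglyMeasurable hD) hr).const_mul _)
    (.of_forall fun x => ?_)
  have := mul_le_mul_of_nonneg_left (weight_le_polyWeight r x) (sq_nonneg ‖PLow ρ r f x‖)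
  simp only
  linarith

/-- Inserting `P_{≤ r'}` changes nothing, and the outer `P_{≤ r}` is then removed by the weighted
`L²` bound. The weight stays at scale `r`, as needed for the initial data. -/
lemma polyMass_le_integral {ρ : ℝ → ℝ} (hρ : IsCutoff ρ) {C : ℝ} (hC1 : 1 ≤ C)
    (hC : ∀ N : ℝ, 0 < N → IsMollifier C N (kernel ρ N)) {f : ℝ → ℂ} (hf : Continuous f) {D : ℝ}
    (hD : ∀ y, ‖f y‖ ≤ D) {r r' : ℝ} (hr : 1 ≤ r) (h : 9 / 8 * r ≤ r') :
    polyMass ρ r f ≤ 4096 * C ^ 2 * ∫ x, ‖PLow ρ r' f x‖ ^ 2 * polyWeight r x := by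
  have hr0 : 0 < r := by linarith
  have hr'0 : 0 < r' := by linarith
  rw [polyMass, ← PLow_PLow hρ hρ hr0 h hf hD]
  exact (hC r hr0).integral_norm_sq_conv_le (by linarith) hr0 hr0 (by nlinarith)
    ((hC r' hr'0).continuous_conv hr'0 hf hD)
    (fun y => (hC r' hr'0).norm_conv_le_of_bounded hr'0 y hf.aestronglyMeasurable hD)

lemma polyMass_le_polyMass {ρ : ℝ → ℝ} (hρ : IsCutoff ρ) {C : ℝ} (hC1 : 1 ≤ C)
    (hC : ∀ N : ℝ, 0 < N → IsMollifier C N (kernel ρ N)) {f : ℝ → ℂ} (hf : Continuous f) {D : ℝ}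
    (hD : ∀ y, ‖f y‖ ≤ D) {r r' : ℝ} (hr : 1 ≤ r) (h : 9 / 8 * r ≤ r') :
    polyMass ρ r f ≤ 4096 * C ^ 2 * polyMass ρ r' f := by
  have hr0 : 0 < r := by linarith
  have hr'0 : 0 < r' := by linarith
  have hc := (hC r' hr'0).continuous_conv hr'0 hf hD
  have hb := fun y => (hC r' hr'0).norm_conv_le_of_bounded hr'0 y hf.aestronglyMeasurable hD
  refine (polyMass_le_integral hρ hC1 hC hf hD hr h).trans ?_
  refine mul_le_mul_of_nonneg_left (integral_mono (integrable_sq_mul_polyWeight hc hb hr0)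
    (integrable_sq_mul_polyWeight hc hb hr'0) fun x => ?_) (by positivity)
  exact mul_le_mul_of_nonneg_left (polyWeight_mono hr0 (by linarith) x) (sq_nonneg _)

lemma le_sq_of_sq_le_cube {Q r : ℝ} (hQ : 10 ≤ Q) (hr : 0 ≤ r) (h : r ^ 2 ≤ Q ^ 3) :
    9 / 8 * r ≤ Q ^ 2 := by
  refine (pow_le_pow_iff_left₀ (by positivity) (by positivity) two_ne_zero).1 ?_
  have : 0 ≤ Q ^ 3 := by positivity
  nlinarith

lemma one_add_log_sq_le {s : ℝ} (hs : 10 ≤ s) : (1 + Real.log (4 * s)) ^ 2 ≤ 16 * s := by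
  have hs0 : 0 < s := by linarith
  have h1 : Real.log (4 * s) = 2 * Real.log (2 * Real.sqrt s) := by
    rw [← Real.log_rpow (by positivity)]
    congr 1
    rw [Real.rpow_two, mul_pow, Real.sq_sqrt hs0.le]
    norm_num
  have h2 := Real.log_le_sub_one_of_pos (show 0 < 2 * Real.sqrt s by positivity)
  have h3 := one_add_log_pos hs
  have h4 : 1 + Real.log (4 * s) ≤ 4 * Real.sqrt s := by linarith
  calc (1 + Real.log (4 * s)) ^ 2 ≤ (4 * Real.sqrt s) ^ 2 := by gcongr
    _ = 16 * s := by rw [mul_pow, Real.sq_sqrt hs0.le]; norm_num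

section

variable {ρ : ℝ → ℝ} {p A₀ δ T R : ℝ} {u v : ℝ → ℂ}

lemma norm_PLow_sub_le (hu : SliceBounds ρ p A₀ δ T R u) (hv : SliceBounds ρ p A₀ δ T R v) {C : ℝ}
    (hC : ∀ N : ℝ, 0 < N → IsMollifier C N (kernel ρ N)) (hp : 3 ≤ p) (hA : 1 ≤ A₀) (hT : 1 ≤ T)
    (hR : 10 ≤ R) {s r r' : ℝ} (hr : 1 ≤ r) (hTs : T ≤ s) (hRs : R ≤ s) (hrs : r ≤ s)
    (hr' : 1 ≤ r') (x : ℝ) :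
    ‖PLow ρ r' (fun z => u z - v z) x‖ ≤ 8 * C * A₀ * (1 + Real.log (4 * s)) * growth r x := by
  have hΛ := one_add_log_pos (hR.trans hRs)
  refine ((hC r' (by linarith)).norm_conv_le_growth (r := r) (by linarith) (by linarith)
    (one_le_mul_of_one_le_of_one_le hr' hr)
    (hu.continuous.sub hv.continuous).aestronglyMeasurable
    (D := 2 * A₀ * (1 + Real.log (4 * s))) (by positivity) (fun y => ?_) x).trans (le_of_eq ?_)
  · refine (norm_sub_le _ _).trans ?_
    have h1 := hu.norm_le hp hA hT hR hr hTs hRs hrs y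
    have h2 := hv.norm_le hp hA hT hR hr hTs hRs hrs y
    linarith
  · ring

/-- The a priori bound on the localized mass of the difference. -/
lemma polyMass_le_of_sliceBounds (hu : SliceBounds ρ p A₀ δ T R u)
    (hv : SliceBounds ρ p A₀ δ T R v) {C : ℝ} (hC1 : 1 ≤ C)
    (hC : ∀ N : ℝ, 0 < N → IsMollifier C N (kernel ρ N)) (hp : 3 ≤ p) (hA : 1 ≤ A₀) (hT : 1 ≤ T)
    (hR : 10 ≤ R) {s r : ℝ} (hr : 1 ≤ r) (hTs : T ≤ s) (hRs : R ≤ s) (hrs : r ≤ s) :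
    polyMass ρ r (fun z => u z - v z) ≤ 2 ^ 19 * C ^ 2 * A₀ ^ 2 * (s * r) := by
  have hr0 : 0 < r := by linarith
  have hs : 10 ≤ s := hR.trans hRs
  have hΛ := one_add_log_sq_le hs
  have hi := integral_growth_pow_mul_polyWeight_le hr0 (k := 2) (by norm_num)
  set Λ := 1 + Real.log (4 * s)
  calc polyMass ρ r (fun z => u z - v z)
      ≤ ∫ x, (8 * C * A₀ * Λ) ^ 2 * (growth r x ^ 2 * polyWeight r x) := by
        refine integral_mono_of_nonneg (.of_forall fun x =>
          mul_nonneg (sq_nonneg _) (polyWeight_pos r x).le)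
          ((integrable_growth_pow_mul_polyWeight hr0 (by norm_num)).const_mul _)
          (.of_forall fun x => ?_)
        have h1 := pow_le_pow_left₀ (norm_nonneg _)
          (norm_PLow_sub_le hu hv hC hp hA hT hR hr hTs hRs hrs hr x) 2
        calc _ ≤ _ := mul_le_mul_of_nonneg_right h1 (polyWeight_pos r x).le
          _ = _ := by ring
    _ = 64 * C ^ 2 * A₀ ^ 2 * (Λ ^ 2 * ∫ x, growth r x ^ 2 * polyWeight r x) := by
        rw [integral_const_mul]; ring
    _ ≤ 64 * C ^ 2 * A₀ ^ 2 * (16 * s * (512 * r)) :=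
        mul_le_mul_of_nonneg_left (mul_le_mul hΛ hi (integral_nonneg fun x =>
          mul_nonneg (sq_nonneg _) (polyWeight_pos r x).le) (by positivity)) (by positivity)
    _ = _ := by ring

/-- The bound at the initial time, where the mass is only known to be small with respect to an
exponentially decaying weight. -/
lemma polyMass_le_of_mass_le (hρ : IsCutoff ρ) (hu : SliceBounds ρ p A₀ δ T R u)
    (hv : SliceBounds ρ p A₀ δ T R v) {C : ℝ} (hC1 : 1 ≤ C)
    (hC : ∀ N : ℝ, 0 < N → IsMollifier C N (kernel ρ N)) (hp : 3 ≤ p) (hA : 1 ≤ A₀) (hT : 1 ≤ T)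
    (hR : 10 ≤ R) {Q r A : ℝ} (hTQ : T ≤ Q) (hRQ : R ≤ Q) (hQr : Q ≤ r) (hrQ : r ^ 2 ≤ Q ^ 3)
    (hA1 : 1 ≤ A) (hm : mass ρ (Q ^ 2) (fun z => u z - v z) ≤ A * Q⁻¹) :
    polyMass ρ r (fun z => u z - v z) ≤ 2 ^ 33 * C ^ 4 * A₀ ^ 2 * A * Q⁻¹ := by
  have hQ : 10 ≤ Q := hR.trans hRQ
  have hr : 10 ≤ r := hQ.trans hQr
  have hr0 : 0 < r := by linarith
  have hQ0 : 0 < Q := by linarith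
  obtain ⟨Du, hDu⟩ := hu.bounded
  obtain ⟨Dv, hDv⟩ := hv.bounded
  set w : ℝ → ℂ := fun z => u z - v z with hw
  have hcw : Continuous w := hu.continuous.sub hv.continuous
  have hDw : ∀ y, ‖w y‖ ≤ Du + Dv := fun y =>
    (norm_sub_le _ _).trans (add_le_add (hDu y) (hDv y))
  have hQ2 : 0 < Q ^ 2 := by positivity
  have hrQ2 := le_sq_of_sq_le_cube hQ hr0.le hrQ
  have hcW := (hC _ hQ2).continuous_conv hQ2 hcw hDw
  have hbW := fun y => (hC _ hQ2).norm_conv_le_of_bounded hQ2 y hcw.aestronglyMeasurable hDw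
  set Λ := 1 + Real.log (4 * r) with hΛdef
  have hΛ := one_add_log_sq_le hr
  have hpt : ∀ x, ‖PLow ρ (Q ^ 2) w x‖ ^ 2 * polyWeight r x ≤
      9 * (‖PLow ρ (Q ^ 2) w x‖ ^ 2 * weight (Q ^ 2) x) +
        (8 * C * A₀ * Λ) ^ 2 * (Q ^ 4)⁻¹ * (growth r x ^ 10 * polyWeight r x) := fun x => by
    have hω := (polyWeight_pos r x).le
    have hg := one_le_growth hr0 x
    have hwt : 0 ≤ weight (Q ^ 2) x := (Real.exp_pos _).le
    -- For `|x| ≤ Q²` the exponential weight is bounded below. Beyond, the growth function is at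
    -- least `Q²/r ≥ Q^(1/2)`, so eight spare powers gain `Q^(-4)` against the a priori bound.
    rcases le_or_gt |x| (Q ^ 2) with h | h
    · have h1 : polyWeight r x ≤ 9 * weight (Q ^ 2) x := by
        have hb : bracket (x / Q ^ 2) ≤ 2 := by
          refine (bracket_le _).trans ?_
          rw [abs_div, abs_of_pos hQ2]
          linarith [(div_le_one hQ2).2 h]
        have h2 : Real.exp 2 ≤ 9 := by
          have : Real.exp 2 = Real.exp 1 ^ 2 := by rw [← Real.exp_nat_mul]; norm_num
          rw [this]
          nlinarith [Real.exp_one_lt_d9, Real.exp_pos 1]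
        have h3 : 1 ≤ Real.exp 2 * weight (Q ^ 2) x := by
          rw [weight, ← Real.exp_add]
          exact Real.one_le_exp (by linarith)
        calc polyWeight r x ≤ 1 := polyWeight_le_one r x
          _ ≤ _ := h3
          _ ≤ _ := by gcongr
      have h2 : 0 ≤ (8 * C * A₀ * Λ) ^ 2 * (Q ^ 4)⁻¹ * (growth r x ^ 10 * polyWeight r x) := by
        positivity
      nlinarith [mul_le_mul_of_nonneg_left h1 (sq_nonneg ‖PLow ρ (Q ^ 2) w x‖)]
    · have hgQ : Q ≤ growth r x ^ 2 := by
        have h1 : Q ^ 2 / r ≤ growth r x := by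
          have : Q ^ 2 / r ≤ |x| / r := by gcongr
          unfold growth
          linarith
        calc Q ≤ Q ^ 4 / r ^ 2 := by
              rw [le_div_iff₀ (by positivity)]
              nlinarith
          _ = (Q ^ 2 / r) ^ 2 := by rw [div_pow]; ring
          _ ≤ _ := by gcongr
      have hg8 : 1 ≤ (Q ^ 4)⁻¹ * growth r x ^ 8 := by
        rw [inv_mul_eq_div, one_le_div (by positivity)]
        calc Q ^ 4 ≤ (growth r x ^ 2) ^ 4 := by gcongr
          _ = _ := by ring
      have h1 := pow_le_pow_left₀ (norm_nonneg _) (norm_PLow_sub_le hu hv hC hp hA hT hR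
        (r := r) (r' := Q ^ 2) (by linarith) (hTQ.trans hQr) (hRQ.trans hQr) le_rfl
        (by nlinarith) x) 2
      have h2 : 0 ≤ 9 * (‖PLow ρ (Q ^ 2) w x‖ ^ 2 * weight (Q ^ 2) x) := by positivity
      calc ‖PLow ρ (Q ^ 2) w x‖ ^ 2 * polyWeight r x
          ≤ (8 * C * A₀ * Λ * growth r x) ^ 2 * polyWeight r x :=
            mul_le_mul_of_nonneg_right h1 hω
        _ ≤ (8 * C * A₀ * Λ * growth r x) ^ 2 * polyWeight r x *
              ((Q ^ 4)⁻¹ * growth r x ^ 8) := le_mul_of_one_le_right (by positivity) hg8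
        _ = (8 * C * A₀ * Λ) ^ 2 * (Q ^ 4)⁻¹ * (growth r x ^ 10 * polyWeight r x) := by ring
        _ ≤ _ := by linarith
  have iw : Integrable fun x => ‖PLow ρ (Q ^ 2) w x‖ ^ 2 * weight (Q ^ 2) x := by
    refine ((integrable_sq_mul_polyWeight hcW hbW hQ2).const_mul (Nat.factorial 16 : ℝ)).mono'
      (Continuous.aestronglyMeasurable ?_) (.of_forall fun x => ?_)
    · have hcw' : Continuous (weight (Q ^ 2)) := by unfold weight bracket; fun_prop
      exact (hcW.norm.pow 2).mul hcw'
    · have := mul_le_mul_of_nonneg_left (weight_le_polyWeight (Q ^ 2) x)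
        (sq_nonneg ‖PLow ρ (Q ^ 2) w x‖)
      rw [Real.norm_of_nonneg (by unfold weight; positivity)]
      calc _ ≤ _ := this
        _ = _ := by rw [PLow_eq_conv]; ring
  have ig := integrable_growth_pow_mul_polyWeight hr0 (k := 10) (by norm_num)
  have hgi := integral_growth_pow_mul_polyWeight_le hr0 (k := 10) (by norm_num)
  have hI : ∫ x, ‖PLow ρ (Q ^ 2) w x‖ ^ 2 * polyWeight r x ≤
      9 * (A * Q⁻¹) + (8 * C * A₀ * Λ) ^ 2 * (Q ^ 4)⁻¹ * (512 * r) := by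
    calc _ ≤ ∫ x, (9 * (‖PLow ρ (Q ^ 2) w x‖ ^ 2 * weight (Q ^ 2) x) +
        (8 * C * A₀ * Λ) ^ 2 * (Q ^ 4)⁻¹ * (growth r x ^ 10 * polyWeight r x)) :=
          integral_mono (integrable_sq_mul_polyWeight hcW hbW hr0)
            ((iw.const_mul _).add (ig.const_mul _)) hpt
      _ = 9 * mass ρ (Q ^ 2) w + (8 * C * A₀ * Λ) ^ 2 * (Q ^ 4)⁻¹ *
          ∫ x, growth r x ^ 10 * polyWeight r x := by
          rw [integral_add (iw.const_mul _) (ig.const_mul _), integral_const_mul,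
            integral_const_mul]
          rfl
      _ ≤ _ := by gcongr
  -- Here `Λ² ≤ 16 r` and `r² ≤ Q³` leave exactly `Q^(-1)`.
  have hlast : (8 * C * A₀ * Λ) ^ 2 * (Q ^ 4)⁻¹ * (512 * r) ≤ 2 ^ 19 * C ^ 2 * A₀ ^ 2 * Q⁻¹ := by
    calc (8 * C * A₀ * Λ) ^ 2 * (Q ^ 4)⁻¹ * (512 * r)
        = 2 ^ 15 * C ^ 2 * A₀ ^ 2 * (Λ ^ 2 * r * (Q ^ 4)⁻¹) := by ring
      _ ≤ 2 ^ 15 * C ^ 2 * A₀ ^ 2 * (16 * Q⁻¹) := by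
        refine mul_le_mul_of_nonneg_left ?_ (by positivity)
        rw [← div_eq_mul_inv, div_le_iff₀ (by positivity)]
        calc Λ ^ 2 * r ≤ 16 * r * r := by gcongr
          _ = 16 * r ^ 2 := by ring
          _ ≤ 16 * Q ^ 3 := by gcongr
          _ = 16 * Q⁻¹ * Q ^ 4 := by field_simp
      _ = _ := by ring
  have hCA : 1 ≤ C ^ 2 * A₀ ^ 2 :=
    one_le_mul_of_one_le_of_one_le (one_le_pow₀ hC1) (one_le_pow₀ hA)
  have hQi : 0 ≤ Q⁻¹ := by positivity
  calc polyMass ρ r w ≤ 4096 * C ^ 2 * ∫ x, ‖PLow ρ (Q ^ 2) w x‖ ^ 2 * polyWeight r x :=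
        polyMass_le_integral hρ hC1 hC hcw hDw (by linarith) hrQ2
    _ ≤ 4096 * C ^ 2 * (9 * (A * Q⁻¹) + 2 ^ 19 * C ^ 2 * A₀ ^ 2 * Q⁻¹) := by
        refine mul_le_mul_of_nonneg_left ?_ (by positivity)
        linarith
    _ ≤ 4096 * C ^ 2 * (9 * (C ^ 2 * A₀ ^ 2 * (A * Q⁻¹)) + 2 ^ 19 * C ^ 2 * A₀ ^ 2 * (A * Q⁻¹)) := by
        have h1 : A * Q⁻¹ ≤ C ^ 2 * A₀ ^ 2 * (A * Q⁻¹) :=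
          le_mul_of_one_le_left (by positivity) hCA
        have h2 : 2 ^ 19 * C ^ 2 * A₀ ^ 2 * Q⁻¹ ≤ 2 ^ 19 * C ^ 2 * A₀ ^ 2 * (A * Q⁻¹) :=
          mul_le_mul_of_nonneg_left (le_mul_of_one_le_left hQi hA1) (by positivity)
        exact mul_le_mul_of_nonneg_left (by linarith) (by positivity)
    _ = (4096 * (9 + 2 ^ 19)) * (C ^ 4 * A₀ ^ 2 * A * Q⁻¹) := by ring
    _ ≤ 2 ^ 33 * (C ^ 4 * A₀ ^ 2 * A * Q⁻¹) := by
        gcongr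
        norm_num
    _ = _ := by ring

end

/-! ### Iteration over dyadic scales -/

/-- A hierarchy of differential inequalities `n_k' ≤ a n_{k+1}`. -/
lemma hierarchy_bound {n n' : ℕ → ℝ → ℝ} {t₀ t₁ a X Y l : ℝ} {K : ℕ} (ha : 0 ≤ a) (hX : 0 ≤ X)
    (hY : 0 ≤ Y) (hl : 0 < l) (hl1 : l ≤ 1)
    (hd : ∀ k < K, ∀ t ∈ Icc t₀ t₁, HasDerivAt (n k) (n' k t) t)
    (hle : ∀ k < K, ∀ t ∈ Icc t₀ t₁, n' k t ≤ a * n (k + 1) t) (h0 : ∀ k < K, n k t₀ ≤ X)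
    (hK : ∀ t ∈ Icc t₀ t₁, n K t ≤ Y) (j : ℕ) (hj : j ≤ K) :
    ∀ t ∈ Icc t₀ t₁, n (K - j) t ≤ (X + Y * l ^ j) * Real.exp (a / l * (t - t₀)) := by
  induction j with
  | zero =>
    intro t ht
    have h1 : 1 ≤ Real.exp (a / l * (t - t₀)) :=
      Real.one_le_exp (mul_nonneg (by positivity) (by linarith [ht.1]))
    have h2 := hK t ht
    rw [Nat.sub_zero, pow_zero, mul_one]
    nlinarith
  | succ j ih =>
    have hk : K - (j + 1) < K := by omega
    have hk1 : K - (j + 1) + 1 = K - j := by omega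
    -- The right-hand side is a supersolution: for `l ≤ 1`, `a (X + Y l^j) ≤ (a/l)(X + Y l^(j+1))`.
    -- Enlarging the exponential rate by `1/l` buys one factor `l` on the top-scale bound per step.
    refine image_le_of_deriv_right_le_deriv_boundary (f' := n' (K - (j + 1)))
      (B' := fun t => (X + Y * l ^ (j + 1)) * (Real.exp (a / l * (t - t₀)) * (a / l)))
      (fun t ht => (hd _ hk t ht).continuousAt.continuousWithinAt)
      (fun t ht => (hd _ hk t (Ico_subset_Icc_self ht)).hasDerivWithinAt) ?_
      (Continuous.continuousOn (by fun_prop)) (fun t ht => ?_) (fun t ht => ?_)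
    · rw [sub_self, mul_zero, Real.exp_zero, mul_one]
      exact (h0 _ hk).trans (le_add_of_nonneg_right (by positivity))
    · have h1 : HasDerivAt (fun t => a / l * (t - t₀)) (a / l) t := by
        simpa using ((hasDerivAt_id t).sub_const t₀).const_mul (a / l)
      exact (h1.exp.const_mul _).hasDerivWithinAt
    · have ht' := Ico_subset_Icc_self ht
      have h1 := hle _ hk t ht'
      rw [hk1] at h1
      have h2 := ih (by omega) t ht'
      have hE := (Real.exp_pos (a / l * (t - t₀))).le
      calc n' (K - (j + 1)) t ≤ a * ((X + Y * l ^ j) * Real.exp (a / l * (t - t₀))) :=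
            h1.trans (mul_le_mul_of_nonneg_left h2 ha)
        _ = (X * l + Y * l ^ (j + 1)) * (Real.exp (a / l * (t - t₀)) * (a / l)) := by
            field_simp
            ring
        _ ≤ _ := by
            gcongr
            nlinarith

end GibbsNLS

namespace GibbsNLS

/-! ### The iterated difference estimate -/

lemma norm_le_of_supNorm_le {T a b θ : ℝ} {V : ℝ → ℝ} {f : ℝ → ℝ → ℂ} (ha : 0 < a) (hb : 0 ≤ b)
    (hV : ∀ x, 0 < V x)
    (h : ENNReal.ofReal a * supNorm T (fun t x => ((V x ^ (-θ) : ℝ) : ℂ) * f t x)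
      ≤ ENNReal.ofReal b) {t : ℝ} (ht : t ∈ Icc (-T) T) (x : ℝ) :
    a * ‖f t x‖ ≤ b * V x ^ θ := by
  have h1 : ‖((V x ^ (-θ) : ℝ) : ℂ) * f t x‖ₑ
      ≤ supNorm T (fun t x => ((V x ^ (-θ) : ℝ) : ℂ) * f t x) :=
    (le_iSup (fun x => ‖((V x ^ (-θ) : ℝ) : ℂ) * f t x‖ₑ) x).trans
      (le_iSup₂ (f := fun t (_ : t ∈ Icc (-T) T) => ⨆ x : ℝ, ‖((V x ^ (-θ) : ℝ) : ℂ) * f t x‖ₑ)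
        t ht)
  have hVθ : 0 < V x ^ θ := Real.rpow_pos_of_pos (hV x) θ
  have h2 := (mul_le_mul_right h1 (ENNReal.ofReal a)).trans h
  rw [← ofReal_norm, ← ENNReal.ofReal_mul ha.le, ENNReal.ofReal_le_ofReal_iff hb, norm_mul,
    Complex.norm_real, Real.rpow_neg (hV x).le, Real.norm_of_nonneg (by positivity)] at h2
  calc a * ‖f t x‖ = a * ((V x ^ θ)⁻¹ * ‖f t x‖) * V x ^ θ := by field_simp
    _ ≤ _ := by gcongr

lemma GoodBounds.sliceBounds {ρ : ℝ → ℝ} {p A₀ δ T R : ℝ} {u : ℝ → ℝ → ℂ}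
    (h : GoodBounds ρ p A₀ δ T R u) (hu : IsTimeBounded u) (hA : 1 ≤ A₀) (hT : 1 ≤ T) (hR : 10 ≤ R)
    {t : ℝ} (ht : t ∈ Icc (-T) T) : SliceBounds ρ p A₀ δ T R (u t) where
  continuous := hu.slice t
  bounded := hu.exists_bound t
  pointwise x := by
    have := norm_le_of_supNorm_le (a := 1) (b := A₀) (V := logWeight T R) (f := u)
      (θ := 2 / (p + 3)) one_pos (by linarith) (fun x => zero_lt_one.trans_le (one_le_logWeight hT hR x))
      (by rw [ENNReal.ofReal_one, one_mul]; exact h.pointwise) ht x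
    rwa [one_mul] at this
  high k x :=
    norm_le_of_supNorm_le (by positivity) (by linarith)
      (fun x => zero_lt_one.trans_le (one_le_logWeight hT hR x))
      ((le_iSup _ k).trans h.high_frequency) ht x

section

variable {ρ : ℝ → ℝ} {p A₀ δ : ℝ}

/-- Propagation over a short time interval. The smallness at the initial time is required on all
scales between `Q` and `Q ^ (3 / 2)`. -/
lemma exists_polyMass_propagation (hρ : IsCutoff ρ) (hp : 3 ≤ p) (hp' : p ≤ 5) (hA : 1 ≤ A₀)
    (hδ : 0 < δ) (hδ' : δ ≤ 1 / 100) {C : ℝ} (hC1 : 1 ≤ C)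
    (hC : ∀ N : ℝ, 0 < N → IsMollifier C N (kernel ρ N)) :
    ∃ τ₀ : ℝ, 0 < τ₀ ∧ τ₀ ≤ 1 ∧ ∀ (T R Q L L' A t₀ t₁ : ℝ) (φ φ' : ℝ → ℂ) (u v : ℝ → ℝ → ℂ),
      1 ≤ T → 10 ≤ R → T ≤ Q → R ≤ Q → 0 < L → 0 < L' → 1 ≤ A →
      IsGlobalSolution p L φ u → IsGlobalSolution p L' φ' v →
      (∀ t ∈ Icc t₀ t₁, SliceBounds ρ p A₀ δ T R (u t)) →
      (∀ t ∈ Icc t₀ t₁, SliceBounds ρ p A₀ δ T R (v t)) → t₁ - t₀ ≤ τ₀ →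
      (∀ r, Q ≤ r → r ^ 2 ≤ Q ^ 3 → polyMass ρ r (fun x => u t₀ x - v t₀ x) ≤ A * Q⁻¹) →
      ∀ t ∈ Icc t₀ t₁, polyMass ρ Q (fun x => u t x - v t x) ≤
        (2 + 2 ^ 9 * (2 ^ 19 * C ^ 2 * A₀ ^ 2)) * A * Q ^ (-(1 / 2) : ℝ) := by
  obtain ⟨K, hK1, hK⟩ := exists_deriv_polyMass_le hρ hp hp' hA hδ hδ'
  -- With rate `2 K log Q` and `l = 2^(-8)`, the value `5120 = 2 · 2^8 · 10` makes the exponential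
  -- at most `Q^(1/10)`, which is the room between `-3/5` and `-1/2`.
  refine ⟨1 / (5120 * K), by positivity, (div_le_one (by positivity)).2 (by linarith), ?_⟩
  intro T R Q L L' A t₀ t₁ φ φ' u v hT hR hTQ hRQ hL hL' hA1 hu hv hus hvs hτ h0 t ht
  have hQ : 10 ≤ Q := hR.trans hRQ
  have hQ0 : 0 < Q := by linarith
  have hQ1 : 1 ≤ Q := by linarith
  have hlog : 0 ≤ Real.log Q := Real.log_nonneg hQ1
  obtain ⟨k₀, hk1, hk2⟩ := exists_dyadic_near (x := Real.sqrt Q) (Real.one_le_sqrt.2 hQ1)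
  have hS : Real.sqrt Q ^ 2 = Q := Real.sq_sqrt hQ0.le
  have hc : (1 : ℝ) ≤ 2 ^ 19 * C ^ 2 * A₀ ^ 2 :=
    one_le_mul_of_one_le_of_one_le (one_le_mul_of_one_le_of_one_le (by norm_num)
      (one_le_pow₀ hC1)) (one_le_pow₀ hA)
  set c : ℝ := 2 ^ 19 * C ^ 2 * A₀ ^ 2
  have hscale : ∀ k ≤ k₀, Q ≤ 2 ^ k * Q ∧ (2 ^ k * Q) ^ 2 ≤ Q ^ 3 := fun k hk => by
    refine ⟨le_mul_of_one_le_left hQ0.le (one_le_pow₀ (by norm_num)), ?_⟩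
    have h1 : (2 : ℝ) ^ k ≤ Real.sqrt Q := (pow_le_pow_right₀ (by norm_num) hk).trans hk1
    calc (2 ^ k * Q) ^ 2 ≤ (Real.sqrt Q * Q) ^ 2 := by gcongr
      _ = Q ^ 3 := by rw [mul_pow, hS]; ring
  -- Adding the constant `Q^(-3/5)` absorbs the inhomogeneous term, so the hierarchy becomes
  -- homogeneous.
  set n : ℕ → ℝ → ℝ := fun k t =>
    polyMass ρ (2 ^ k * Q) (fun y => u t y - v t y) + Q ^ (-(3 / 5) : ℝ) with hn
  have hQ35 : Q ^ (-(3 / 5) : ℝ) ≤ 1 := Real.rpow_le_one_of_one_le_of_nonpos hQ1 (by norm_num)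
  have hinv : Q⁻¹ ≤ Q ^ (-(3 / 5) : ℝ) := by
    rw [← Real.rpow_neg_one]
    exact Real.rpow_le_rpow_of_exponent_le hQ1 (by norm_num)
  have hmain := hierarchy_bound (n := n) (n' := fun k t => ∫ x, 2 * inner ℝ
      (PLow ρ (2 ^ k * Q) (fun y => u t y - v t y) x) (lowVelocity ρ p (2 ^ k * Q) u v t x)
        * polyWeight (2 ^ k * Q) x) (t₀ := t₀) (t₁ := t₁) (a := 2 * K * Real.log Q)
    (X := A * Q⁻¹ + Q ^ (-(3 / 5) : ℝ)) (Y := 2 * c * Q ^ 3) (l := 1 / 2 ^ 8) (K := k₀)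
    (by positivity) (by positivity) (by positivity) (by norm_num) (by norm_num)
    (fun k hk s hs => (hasDerivAt_polyMass hρ hu hv hp hL hL' (by positivity) s).add_const _)
    (fun k hk s hs => ?_) (fun k hk => ?_) (fun s hs => ?_) k₀ le_rfl t ht
  · rw [hn, Nat.sub_self] at hmain
    simp only [pow_zero, one_mul] at hmain
    -- As `2^k₀` is comparable to `Q^(1/2)`, the gain `2^(-8 k₀)` is about `Q^(-4)`; it turns the
    -- crude bound `Q³` at the top scale into `Q^(-1)`.
    have hY : 2 * c * Q ^ 3 * (1 / 2 ^ 8) ^ k₀ ≤ 2 ^ 9 * c * Q ^ (-(3 / 5) : ℝ) := by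
      have h1 : Q ^ 4 ≤ 2 ^ 8 * (2 ^ 8) ^ k₀ := by
        calc Q ^ 4 = Real.sqrt Q ^ 8 := by rw [← hS]; ring_nf; rw [hS]
          _ ≤ (2 * 2 ^ k₀) ^ 8 := by gcongr
          _ = _ := by rw [mul_pow, ← pow_mul, ← pow_mul, mul_comm k₀]
      have h2 : Q ^ 3 * (1 / 2 ^ 8) ^ k₀ ≤ 2 ^ 8 * Q⁻¹ := by
        rw [one_div, inv_pow, ← div_eq_mul_inv, ← div_eq_mul_inv,
          div_le_div_iff₀ (by positivity) hQ0]
        linarith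
      calc 2 * c * Q ^ 3 * (1 / 2 ^ 8) ^ k₀ = 2 * c * (Q ^ 3 * (1 / 2 ^ 8) ^ k₀) := by ring
        _ ≤ 2 * c * (2 ^ 8 * Q⁻¹) := by gcongr
        _ = 2 ^ 9 * c * Q⁻¹ := by ring
        _ ≤ _ := by gcongr
    have hE : Real.exp (2 * K * Real.log Q / (1 / 2 ^ 8) * (t - t₀)) ≤ Q ^ (1 / 10 : ℝ) := by
      rw [Real.rpow_def_of_pos hQ0]
      refine Real.exp_le_exp.2 ?_
      have h1 : t - t₀ ≤ 1 / (5120 * K) := by linarith [ht.2]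
      calc 2 * K * Real.log Q / (1 / 2 ^ 8) * (t - t₀)
          ≤ 2 * K * Real.log Q / (1 / 2 ^ 8) * (1 / (5120 * K)) :=
            mul_le_mul_of_nonneg_left h1 (by positivity)
        _ = Real.log Q * (1 / 10) := by field_simp; ring
    have hX : A * Q⁻¹ + Q ^ (-(3 / 5) : ℝ) + 2 * c * Q ^ 3 * (1 / 2 ^ 8) ^ k₀ ≤
        (2 + 2 ^ 9 * c) * A * Q ^ (-(3 / 5) : ℝ) := by
      have h1 : A * Q⁻¹ ≤ A * Q ^ (-(3 / 5) : ℝ) := by gcongr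
      have h2 : Q ^ (-(3 / 5) : ℝ) ≤ A * Q ^ (-(3 / 5) : ℝ) :=
        le_mul_of_one_le_left (by positivity) hA1
      have h3 : 2 ^ 9 * c * Q ^ (-(3 / 5) : ℝ) ≤ 2 ^ 9 * c * (A * Q ^ (-(3 / 5) : ℝ)) := by
        gcongr
      linarith
    have hpow : Q ^ (-(3 / 5) : ℝ) * Q ^ (1 / 10 : ℝ) = Q ^ (-(1 / 2) : ℝ) := by
      rw [← Real.rpow_add hQ0]
      norm_num
    have h35 : 0 ≤ Q ^ (-(3 / 5) : ℝ) := by positivity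
    calc polyMass ρ Q (fun x => u t x - v t x)
        ≤ (A * Q⁻¹ + Q ^ (-(3 / 5) : ℝ) + 2 * c * Q ^ 3 * (1 / 2 ^ 8) ^ k₀) *
          Real.exp (2 * K * Real.log Q / (1 / 2 ^ 8) * (t - t₀)) := by linarith
      _ ≤ (2 + 2 ^ 9 * c) * A * Q ^ (-(3 / 5) : ℝ) * Q ^ (1 / 10 : ℝ) :=
          mul_le_mul hX hE (Real.exp_pos _).le (by positivity)
      _ = _ := by rw [mul_assoc, hpow]
  · obtain ⟨h1, h2⟩ := hscale k hk.le
    have hd := hK T R (2 ^ k * Q) L L' s φ φ' u v hT hR (hTQ.trans h1) (hRQ.trans h1) hL hL' hu hv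
      (hus s hs) (hvs s hs)
    have hlk : Real.log (2 ^ k * Q) ≤ 2 * Real.log Q := by
      have h3 := Real.log_le_log (by positivity) h2
      rw [Real.log_pow, Real.log_pow] at h3
      push_cast at h3
      linarith
    have hrk : (2 ^ k * Q) ^ (-(3 / 5) : ℝ) ≤ Q ^ (-(3 / 5) : ℝ) :=
      Real.rpow_le_rpow_of_nonpos hQ0 h1 (by norm_num)
    have e : 2 * (2 ^ k * Q) = 2 ^ (k + 1) * Q := by ring
    have hm := polyMass_nonneg ρ (2 ^ (k + 1) * Q) (fun y => u s y - v s y)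
    rw [e] at hd
    calc _ ≤ _ := hd
      _ ≤ K * (2 * Real.log Q) * n (k + 1) s := by
          have h4 : 0 ≤ (2 ^ k * Q) ^ (-(3 / 5) : ℝ) := by positivity
          refine mul_le_mul (mul_le_mul_of_nonneg_left hlk (by linarith)) ?_ (by linarith)
            (by positivity)
          simp only [hn]
          linarith
      _ = _ := by ring
  · obtain ⟨h1, h2⟩ := hscale k hk.le
    simp only [hn]
    linarith [h0 _ h1 h2]
  · obtain ⟨h1, h2⟩ := hscale k₀ le_rfl
    have h3 := polyMass_le_of_sliceBounds (hus s hs) (hvs s hs) hC1 hC hp hA hT hR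
      (hQ1.trans h1) (hTQ.trans h1) (hRQ.trans h1) le_rfl
    have h4 : c * (2 ^ k₀ * Q * (2 ^ k₀ * Q)) ≤ c * Q ^ 3 := by
      refine mul_le_mul_of_nonneg_left ?_ (by linarith)
      rwa [← sq]
    have h5 : 1 ≤ c * Q ^ 3 := one_le_mul_of_one_le_of_one_le hc (one_le_pow₀ hQ1)
    simp only [hn]
    linarith

end

/-- If `n` is propagated on short time intervals from scale `Q` to scale `Q` and the square of a
scale controls the scale, then `n` is controlled on long time intervals. -/
lemma scale_iteration {n : ℝ → ℝ → ℝ} {R τ A K M B : ℝ} {J : ℕ} (hR : 1 ≤ R) (hτ : 0 ≤ τ)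
    (hK : 1 ≤ K) (hM : 1 ≤ M) (hB : 1 ≤ B) (hKB : K * B ≤ A) (hKM : K * M ≤ A) (hA : 1 ≤ A)
    (hstep : ∀ Q, R ≤ Q → ∀ j < J, ∀ A', 1 ≤ A' →
      (∀ r, Q ≤ r → r ^ 2 ≤ Q ^ 3 → n r (j * τ) ≤ A' * Q⁻¹) →
      ∀ t ∈ Icc (j * τ) ((j + 1 : ℕ) * τ), n Q t ≤ K * A' * Q ^ (-(1 / 2) : ℝ))
    (hscale : ∀ Q, R ≤ Q → ∀ r, Q ≤ r → r ^ 2 ≤ Q ^ 3 → ∀ t ∈ Icc 0 (J * τ),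
      n r t ≤ M * n (Q ^ 2) t)
    (h0 : ∀ Q, R ≤ Q → Q ^ 2 = R ^ 2 ^ J → ∀ r, Q ≤ r → r ^ 2 ≤ Q ^ 3 → n r 0 ≤ B * A * Q⁻¹)
    (j : ℕ) (hj1 : 1 ≤ j) (hj : j ≤ J) :
    ∀ t ∈ Icc 0 (j * τ), n (R ^ 2 ^ (J - j)) t ≤
      A ^ (j + 1) * (R ^ 2 ^ (J - j)) ^ (-(1 / 2) : ℝ) := by
  have hRpow : ∀ k : ℕ, R ≤ R ^ 2 ^ k := fun k => le_self_pow₀ hR (by positivity)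
  have hsq : ∀ j < J, (R ^ 2 ^ (J - (j + 1))) ^ 2 = R ^ 2 ^ (J - j) := fun j hj => by
    rw [← pow_mul, ← pow_succ]
    congr 3
    omega
  -- The induction starts at one because the initial smallness comes from the exponentially weighted
  -- mass, through `h0` rather than `hscale`.
  induction j, hj1 using Nat.le_induction with
  | base =>
    intro t ht
    have hs := hsq 0 (by omega)
    rw [zero_add, Nat.sub_zero] at hs
    have hQ := hRpow (J - 1)
    set Q := R ^ 2 ^ (J - 1)
    refine (hstep Q hQ 0 (by omega) (B * A) (one_le_mul_of_one_le_of_one_le hB hA) ?_ t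
      (by simpa using ht)).trans ?_
    · simpa using h0 Q hQ hs
    · have : K * (B * A) ≤ A ^ (1 + 1) := by
        rw [← mul_assoc, one_add_one_eq_two, sq]
        gcongr
      have hQ0 : 0 < Q := by linarith
      gcongr
  | succ j hj1 ih =>
    have hQ := hRpow (J - (j + 1))
    have hs := hsq j (by omega)
    set Q := R ^ 2 ^ (J - (j + 1))
    have hQ0 : 0 < Q := by linarith
    have hjJ : (j : ℝ) * τ ≤ J * τ := by gcongr; omega
    have hAj : 1 ≤ A ^ (j + 1) := one_le_pow₀ hA
    have hfin : K * (M * A ^ (j + 1)) ≤ A ^ (j + 1 + 1) := by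
      rw [pow_succ A (j + 1)]
      nlinarith
    -- The previous bound at scale `Q²` is `Q^(-1)` in terms of `Q`. Comparison of scales gives what
    -- the next time step needs, and also the claim for earlier times.
    have hearly : ∀ r, Q ≤ r → r ^ 2 ≤ Q ^ 3 → ∀ t ∈ Icc 0 (j * τ),
        n r t ≤ M * A ^ (j + 1) * Q⁻¹ := fun r h1 h2 t ht => by
      have h3 := ih (by omega) t ht
      have e : (Q ^ 2) ^ (-(1 / 2) : ℝ) = Q⁻¹ := by
        rw [← Real.rpow_natCast, ← Real.rpow_mul hQ0.le, ← Real.rpow_neg_one]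
        norm_num
      rw [← hs, e] at h3
      calc n r t ≤ M * n (Q ^ 2) t := hscale Q hQ r h1 h2 t ⟨ht.1, ht.2.trans hjJ⟩
        _ ≤ M * (A ^ (j + 1) * Q⁻¹) := by gcongr
        _ = _ := by ring
    intro t ht
    rcases le_total t (j * τ) with h | h
    · refine (hearly Q le_rfl (pow_le_pow_right₀ (hR.trans hQ) (by norm_num)) t ⟨ht.1, h⟩).trans ?_
      have h1 : Q⁻¹ ≤ Q ^ (-(1 / 2) : ℝ) := by
        rw [← Real.rpow_neg_one]
        exact Real.rpow_le_rpow_of_exponent_le (hR.trans hQ) (by norm_num)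
      have h2 : M * A ^ (j + 1) ≤ K * (M * A ^ (j + 1)) := le_mul_of_one_le_left (by positivity) hK
      exact mul_le_mul (h2.trans hfin) h1 (by positivity) (by positivity)
    · refine (hstep Q hQ j (by omega) (M * A ^ (j + 1)) (one_le_mul_of_one_le_of_one_le hM hAj)
        (fun r h1 h2 => hearly r h1 h2 _ ⟨by positivity, le_rfl⟩) t ⟨h, ht.2⟩).trans ?_
      gcongr

/-- When `R ≤ T ≤ J`, the factor `A^J ≥ 8^J ≥ J³ ≥ T³` beats `T R` and still leaves `T^(-1) ≤
R^(-1/2)`. -/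
lemma mul_le_pow_mul_rpow {A B T R : ℝ} {J : ℕ} (hB : 0 ≤ B) (hR : 1 ≤ R) (hRT : R ≤ T)
    (hTJ : T ≤ J) (hA : 8 ≤ A) (hBA : B ≤ A) :
    B * (T * R) ≤ A ^ (J + 2) * R ^ (-(1 / 2) : ℝ) := by
  have hT : 0 < T := by linarith
  have hR0 : 0 < R := by linarith
  have hJ8 : T ^ 3 ≤ A ^ J := by
    have h1 : (J : ℝ) ≤ 2 ^ J := by exact_mod_cast Nat.lt_two_pow_self.le
    calc T ^ 3 ≤ (2 ^ J) ^ 3 := by gcongr; exact hTJ.trans h1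
      _ = 8 ^ J := by rw [← pow_mul, mul_comm, pow_mul]; norm_num
      _ ≤ A ^ J := by gcongr
  have hRinv : T⁻¹ ≤ R ^ (-(1 / 2) : ℝ) := by
    calc T⁻¹ ≤ R⁻¹ := by gcongr
      _ = R ^ (-1 : ℝ) := (Real.rpow_neg_one R).symm
      _ ≤ _ := Real.rpow_le_rpow_of_exponent_le hR (by norm_num)
  have hBA2 : B ≤ A ^ 2 := by nlinarith
  calc B * (T * R) ≤ B * (T * T) := by gcongr
    _ = B * T ^ 3 * T⁻¹ := by field_simp
    _ ≤ A ^ 2 * A ^ J * R ^ (-(1 / 2) : ℝ) := by gcongr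
    _ = _ := by ring

end GibbsNLS

/-! ### Choice of constants and conclusion. -/

open GibbsNLS in
theorem lemma5p4 :
    ∃ δ₀ : ℝ, 0 < δ₀ ∧
    ∀ (ρ : ℝ → ℝ), GibbsNLS.IsCutoff ρ →
    ∀ (p : ℝ), 3 ≤ p → p ≤ 5 →
    ∀ (A₀ : ℝ), 1 ≤ A₀ →
    ∀ (δ : ℝ), 0 < δ → δ ≤ δ₀ →
    ∃ A₃min : ℝ, 1 ≤ A₃min ∧ ∃ τ₀ : ℝ, 0 < τ₀ ∧
    ∀ (A₃ : ℝ), A₃min ≤ A₃ →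
    ∀ (Ω : Type*) (φ : ℝ → Ω → ℝ → ℂ) (u : ℝ → Ω → ℝ → ℝ → ℂ)
      (L T R : ℝ), 10 ≤ L → 1 ≤ T → 10 ≤ R →
    ∀ (J : ℕ), 1 ≤ J → T / (J : ℝ) ≤ τ₀ →
    ∀ ω ∈ GibbsNLS.goodEvent ρ p A₀ δ u L T R,
      GibbsNLS.IsGlobalSolution p L (φ L ω) (u L ω) →
      GibbsNLS.IsGlobalSolution p (L / 2) (φ (L / 2) ω) (u (L / 2) ω) →
      GibbsNLS.mass ρ (R ^ (2 ^ J)) (GibbsNLS.diff u L ω 0)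
        ≤ A₃ * (R ^ (2 ^ J)) ^ (-(1 / 2) : ℝ) →
      ∀ t ∈ Set.Icc (0 : ℝ) T,
        GibbsNLS.mass ρ R (GibbsNLS.diff u L ω t) ≤ A₃ ^ (J + 2) * R ^ (-(1 / 2) : ℝ) := by
  refine ⟨1 / 100, by norm_num, fun ρ hρ p hp hp' A₀ hA δ hδ hδ' => ?_⟩
  obtain ⟨C, hC1, hCC⟩ := hρ.exists_isMollifier
  have hC : ∀ N : ℝ, 0 < N → IsMollifier C N (kernel ρ N) := fun N hN => (hCC N hN).1
  obtain ⟨τ₀, hτ₀, hτ₀', hprop⟩ := exists_polyMass_propagation hρ hp hp' hA hδ hδ' hC1 hC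
  have hC2 : 1 ≤ C ^ 2 := one_le_pow₀ hC1
  have hA2 : 1 ≤ A₀ ^ 2 := one_le_pow₀ hA
  have hCA : 1 ≤ C ^ 2 * A₀ ^ 2 := one_le_mul_of_one_le_of_one_le hC2 hA2
  obtain ⟨F, hF⟩ : ∃ F : ℝ, F = (Nat.factorial 16 : ℝ) := ⟨_, rfl⟩
  have hF8 : 8 ≤ F := by rw [hF]; norm_num [Nat.factorial]
  set c : ℝ := 2 ^ 19 * C ^ 2 * A₀ ^ 2 with hcdef
  have hc : 1 ≤ c := by rw [hcdef]; nlinarith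
  set K : ℝ := 2 + 2 ^ 9 * c with hKdef
  have hK : 1 ≤ K := by rw [hKdef]; linarith
  set M : ℝ := 4096 * C ^ 2 with hMdef
  have hM : 1 ≤ M := by rw [hMdef]; linarith
  set B : ℝ := 2 ^ 33 * C ^ 4 * A₀ ^ 2 with hBdef
  have hB : 1 ≤ B := by
    have : 1 ≤ C ^ 4 := one_le_pow₀ hC1
    rw [hBdef]
    nlinarith [one_le_mul_of_one_le_of_one_le this hA2]
  have hKM : 1 ≤ K * M := one_le_mul_of_one_le_of_one_le hK hM
  have hKB : 1 ≤ K * B := one_le_mul_of_one_le_of_one_le hK hB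
  -- All four constants are at least one, so their product dominates each combination needed: `K B`
  -- and `K M` in the iteration, `F` in the return to the exponential weight, and `F K` when `R <
  -- T`.
  refine ⟨F * K * M * B, ?_, τ₀, hτ₀, ?_⟩
  · calc (1 : ℝ) ≤ F * (K * M * B) := one_le_mul_of_one_le_of_one_le (by linarith)
          (one_le_mul_of_one_le_of_one_le hKM hB)
      _ = _ := by ring
  intro A hAmin Ω φ u L T R hL hT hR J hJ hTJ ω hω hu hv h0 t ht
  have hF1 : 1 ≤ F := by linarith
  have hAK : F * K ≤ A := by
    calc F * K ≤ F * K * (M * B) :=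
          le_mul_of_one_le_right (by positivity) (one_le_mul_of_one_le_of_one_le hM hB)
      _ = F * K * M * B := by ring
      _ ≤ A := hAmin
  have hAF : F ≤ A := (le_mul_of_one_le_right (by positivity) hK).trans hAK
  have hA1 : 1 ≤ A := hF1.trans hAF
  have hAKM : K * M ≤ A := by
    calc K * M ≤ K * M * (F * B) :=
          le_mul_of_one_le_right (by positivity) (one_le_mul_of_one_le_of_one_le hF1 hB)
      _ = F * K * M * B := by ring
      _ ≤ A := hAmin
  have hAKB : K * B ≤ A := by
    calc K * B ≤ K * B * (F * M) :=
          le_mul_of_one_le_right (by positivity) (one_le_mul_of_one_le_of_one_le hF1 hM)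
      _ = F * K * M * B := by ring
      _ ≤ A := hAmin
  have hL0 : 0 < L := by linarith
  have hL0' : 0 < L / 2 := by linarith
  have hu' := hu.isTimeBounded hL0
  have hv' := hv.isTimeBounded hL0'
  have hw' := hu'.sub hv'
  have hus : ∀ s ∈ Icc 0 T, SliceBounds ρ p A₀ δ T R (u L ω s) := fun s hs =>
    hω.1.sliceBounds hu' hA hT hR ⟨by linarith [hs.1], hs.2⟩
  have hvs : ∀ s ∈ Icc 0 T, SliceBounds ρ p A₀ δ T R (u (L / 2) ω s) := fun s hs =>
    hω.2.sliceBounds hv' hA hT hR ⟨by linarith [hs.1], hs.2⟩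
  have hR0 : 0 < R := by linarith
  have hR1 : 1 ≤ R := by linarith
  obtain ⟨D, hD⟩ := hw'.exists_bound t
  have hmass := mass_le_polyMass hρ (hw'.slice t) hD hR0
  rw [← hF] at hmass
  change mass ρ R (fun x => u L ω t x - u (L / 2) ω t x) ≤ _
  have hJ0 : (0 : ℝ) < J := by exact_mod_cast hJ
  -- The differential inequality needs scales above `T`, so the iteration runs only for `T ≤ R`.
  -- Otherwise `τ₀ ≤ 1` gives `T ≤ J`, and the a priori bound suffices.
  rcases lt_or_ge R T with hRT | hRT
  · refine hmass.trans ?_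
    have hFc : F * c ≤ A := (mul_le_mul_of_nonneg_left (by linarith) (by linarith)).trans hAK
    have hTJ' : T ≤ J := by
      rw [div_le_iff₀ hJ0] at hTJ
      exact hTJ.trans (mul_le_of_le_one_left hJ0.le hτ₀')
    refine (mul_le_mul_of_nonneg_left (polyMass_le_of_sliceBounds (hus t ht) (hvs t ht) hC1 hC hp hA
      hT hR hR1 le_rfl hRT.le hRT.le) (by linarith)).trans ?_
    rw [← hcdef, ← mul_assoc]
    exact mul_le_pow_mul_rpow (by positivity) hR1 hRT.le hTJ' (hF8.trans hAF) hFc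
  · have hτ : 0 ≤ T / J := by positivity
    have hJτ : (J : ℝ) * (T / J) = T := by field_simp
    have hmono : ∀ j ≤ J, (j : ℝ) * (T / J) ≤ T := fun j hj => by
      calc (j : ℝ) * (T / J) ≤ J * (T / J) := by gcongr
        _ = T := hJτ
    have hsqrt : ∀ Q, R ≤ Q → ∀ r, Q ≤ r → r ^ 2 ≤ Q ^ 3 → 9 / 8 * r ≤ Q ^ 2 :=
      fun Q hQ r h1 h2 =>
        le_sq_of_sq_le_cube (hR.trans hQ) (by linarith) h2
    have hfin := scale_iteration
      (n := fun r s => polyMass ρ r (fun x => u L ω s x - u (L / 2) ω s x)) (J := J) hR1 hτ hK hM hB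
      hAKB hAKM hA1 (fun Q hQ j hj A' hA' h s hs => ?_) (fun Q hQ r h1 h2 s hs => ?_)
      (fun Q hQ hQJ r h1 h2 => ?_) J hJ le_rfl t (by rwa [hJτ])
    · simp only [Nat.sub_self, pow_zero, pow_one] at hfin
      have hAJ : 0 ≤ A ^ (J + 1) := by positivity
      -- The iteration yields the exponent `J + 1`; the comparison constant `F ≤ A` accounts for the
      -- last factor.
      calc mass ρ R (fun x => u L ω t x - u (L / 2) ω t x)
          ≤ F * polyMass ρ R (fun x => u L ω t x - u (L / 2) ω t x) := hmass
        _ ≤ A * (A ^ (J + 1) * R ^ (-(1 / 2) : ℝ)) :=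
            mul_le_mul hAF hfin (polyMass_nonneg _ _ _) (by linarith)
        _ = _ := by ring
    · have hsub : Icc (j * (T / J)) ((j + 1 : ℕ) * (T / J)) ⊆ Icc 0 T :=
        Icc_subset_Icc (by positivity) (hmono _ hj)
      exact hprop T R Q L (L / 2) A' _ _ _ _ _ _ hT hR (hRT.trans hQ) hQ hL0 hL0' hA' hu hv
        (fun s hs => hus s (hsub hs)) (fun s hs => hvs s (hsub hs))
        (by push_cast; linarith) h s hs
    · obtain ⟨D, hD⟩ := hw'.exists_bound s
      exact polyMass_le_polyMass hρ hC1 hC (hw'.slice s) hD (by linarith) (hsqrt Q hQ r h1 h2)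
    · have hQ0 : 0 < Q := by linarith
      have e : (Q ^ 2) ^ (-(1 / 2) : ℝ) = Q⁻¹ := by
        rw [← Real.rpow_natCast, ← Real.rpow_mul hQ0.le, ← Real.rpow_neg_one]
        norm_num
      rw [← hQJ, e] at h0
      have hz : (0 : ℝ) ∈ Icc 0 T := ⟨le_rfl, by linarith⟩
      exact polyMass_le_of_mass_le hρ (hus 0 hz) (hvs 0 hz) hC1 hC hp hA hT hR (hRT.trans hQ) hQ h1
        h2 hA1 h0
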